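/- Let $(B,\mathscr P)$ be the dual intersection complex of a toric degeneration of a pair $(X,D)$, where $X$ is a surface and $D$ a smooth very ample anticanonical divisor. Thus $\mathscr P$ consists of one bounded maximal cell $\sigma_0$, a reflexive lattice polygon, and of one unbounded maximal cell $[v_i,v_{i+1}]+\mathbb R_{\ge 0}m_{\mathrm{out}}$ over each bounded edge $[v_i,v_{i+1}]\subset\partial\sigma_0$. Here $v_1,\dots,v_n$ are boundary lattice points of $\sigma_0$ in cyclic order, including all its corners. $B$ has an integral affine structure away from a finite set $\Delta$ of singularities, one in the interior of each bounded edge. In it all unbounded edges have the same direction $m_{\mathrm{out}}$, which near the vertex $v_i$ is the direction of the vector $v_i$. Let $\varphi$ be the piecewise affine function on $B$ which is $0$ on $\sigma_0$ and has slope $1$ along $m_{\mathrm{out}}$ on all unbounded cells. A rational tropical curve $h:\Gamma\to B$ is a weighted tree $\Gamma$ with legs and without univalent or bivalent vertices, together with a continuous map $h$ which is straight on edges and legs, the velocity on an edge or leg $E$ being its positive weight $w_E$ times a primitive integral tangent vector, such that: * each bounded leg ends in a point of $\Delta$ (along the monodromy invariant direction), and each unbounded leg finally has direction $m_{\mathrm{out}}$;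 * at every vertex $V$ the weight vectors $u_{(V,E)}$ (the outgoing velocities at $V$) of the adjacent edges and legs add up to $0$. A straight line without vertices, unbounded in both directions, is admitted; it has two unbounded ends, and the whole line is the leg belonging to each of them. A rational tropical disk $h^\circ:\Gamma\to B$ is defined in the same way, except that there is exactly one univalent vertex $V_\infty$, at which balancing is not required; $E_\infty$ denotes the edge or leg at $V_\infty$. Curves and disks are considered up to isomorphism. Let $p,q$ be positive integers and let $P\in B$. * $\mathfrak H^\circ_{p,q}(P)$ is the set of rational tropical disks with exactly one unbounded leg, of weight $q$, with $h^\circ(V_\infty)=P$ and $u_{(V_\infty,E_\infty)}=-p\,m_{\mathrm{out}}$. * $\mathfrak H_{p,q}(P)$ is the set of rational tropical curves with exactly two unbounded legs, of weights $p$ and $q$, such that the image of the unbounded leg of weight $p$ contains $P$ (if $p=q$: of one of the two). Assume that $P$ is a general point in an unbounded chamber of the wall structure $\mathscr S_{p+q}$ consistent to order $p+q$. It is enough that $P$ is a general point with the following property: $P$ lies in an unbounded connected component of the interior of an unbounded maximal cell minus the initial walls of $t$-order at most $p+q$. Here the initial walls are the straight rays leaving the singularities in the two monodromy invariant directions, and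 the $t$-order at a point of such a ray is the derivative of $\varphi$ along the primitive direction of the ray. "General" means: outside a subset of $B$ (depending on $B,p,q$) which in every affine chart is covered by countably many lines. Then there is a bijection $$\mathfrak H^\circ_{p,q}(P)\longrightarrow\mathfrak H_{p,q}(P),\qquad h^\circ\mapsto h .$$ Here $h$ is obtained from $h^\circ$ by prolonging the final edge $E_\infty$, which at $P$ is parallel to $m_{\mathrm{out}}$, by the ray $P+\mathbb R_{\ge0}\,m_{\mathrm{out}}$ to an unbounded leg of weight $p$, forgetting the vertex $V_\infty$ and leaving everything else unchanged. -/

import Mathlib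

open Set Filter Topology

noncomputable section

namespace DelPezzo

/-- The determinant (wedge product) of two vectors of the plane. -/
def wedge {R : Type*} [CommRing R] (x y : R × R) : R := x.1 * y.2 - x.2 * y.1

/-- A lattice vector, viewed as a real vector. -/
def toReal (m : ℤ × ℤ) : ℝ × ℝ := ((m.1 : ℝ), (m.2 : ℝ))

/-- Combinatorial data of the dual intersection complex `(B, 𝒫)` of a toric degeneration of a
pair `(X, D)`, `X` a smooth del Pezzo surface with very ample anticanonical class and `D` a
smooth anticanonical divisor.

The bounded maximal cell is a reflexive polygon `σ₀` (all its edges have lattice distance `1`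
from the origin). The points `v i` are the vertices of `𝒫` on the boundary of `σ₀`, in
counterclockwise cyclic order; all corners of `σ₀` are among them. The bounded edge
`[v i, v (i + 1)]` has lattice length `len i` and primitive direction `e i`, and carries one affine
singularity in its interior, at parameter `pos i`. -/
structure DualComplex where
  n : ℕ
  n_ne_zero : NeZero n
  v : ZMod n → ℤ × ℤ
  e : ZMod n → ℤ × ℤ
  len : ZMod n → ℕ
  pos : ZMod n → ℝ
  v_injective : Function.Injective v
  len_pos : ∀ i, 0 < len i
  edge : ∀ i, v (i + 1) = v i + (len i : ℤ) • e i
  distance_one : ∀ i, wedge (v i) (e i) = 1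
  convex : ∀ i j, wedge (v i) (e j) ≤ 1
  pos_mem : ∀ i, pos i ∈ Ioo (0 : ℝ) 1

namespace DualComplex

variable (S : DualComplex)

instance : NeZero S.n := S.n_ne_zero

/-- The real vectors underlying the vertices and the edge directions. -/
def vtx (i : ZMod S.n) : ℝ × ℝ := toReal (S.v i)

def dir (i : ZMod S.n) : ℝ × ℝ := toReal (S.e i)

/-- The affine singularity in the interior of the bounded edge `[v i, v (i + 1)]`. -/
def sing (i : ZMod S.n) : ℝ × ℝ := S.vtx i + (S.pos i * S.len i) • S.dir i

/-- The gauge (Minkowski functional) of `σ₀`, so that `σ₀ = {x | gauge x ≤ 1}`.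

The underlying topological space of `B` is the plane `ℝ × ℝ`: the bounded cell is `σ₀`, and for
`b` on the boundary of `σ₀` and `s ≥ 0` the point `(1 + s) • b` is the point
at height `s` above `b`, in the direction `m_out`, in an unbounded cell. The unbounded cell over the
edge `[v i, v (i + 1)]` is therefore the part outside `σ₀` of the cone over this edge. The
affine structure is not the one of the plane; it is given by the charts below. -/
def gauge (x : ℝ × ℝ) : ℝ :=
  Finset.univ.sup' Finset.univ_nonempty (fun j : ZMod S.n => wedge x (S.dir j))

/-- The height over the bounded cell. This is the piecewise affine function `φ`: it is `0` on `σ₀`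
and has slope `1` in the direction `m_out` on all unbounded cells. -/
def phi (x : ℝ × ℝ) : ℝ := max (S.gauge x - 1) 0

/-- The affine chart around the vertex `v i`: the identity on `σ₀`, and
`b + s • v i` at the point of height `s` above a boundary point `b`. Thus `m_out` is `v i`
in this chart. It is used on `chartDomain i` only. -/
def chart (i : ZMod S.n) (x : ℝ × ℝ) : ℝ × ℝ :=
  if S.gauge x ≤ 1 then x
  else (S.gauge x)⁻¹ • x + (S.gauge x - 1) • S.vtx i

/-- The domain of the chart at `v i`: the interior of `σ₀`, the interiors of the two unbounded cells
containing `v i`, the unbounded edge at `v i` without its end point, and the part of the boundary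
of `σ₀` strictly between the two singularities next to `v i`. These domains cover the
complement of the singularities. -/
def chartDomain (i : ZMod S.n) : Set (ℝ × ℝ) :=
  {x | S.gauge x < 1 ∨
    (1 < S.gauge x ∧
      ((0 < wedge (S.vtx (i - 1)) x ∧ 0 ≤ wedge x (S.vtx i)) ∨
        (0 ≤ wedge (S.vtx i) x ∧ 0 < wedge x (S.vtx (i + 1))))) ∨
    (S.gauge x = 1 ∧
      ((0 < wedge (S.sing (i - 1)) x ∧ 0 ≤ wedge x (S.vtx i)) ∨
        (0 ≤ wedge (S.vtx i) x ∧ 0 < wedge x (S.sing i))))}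

/-- The path `γ : I → B` is, near the time `t ∈ I`, affine with velocity `c` in the chart at `v i`.
At the singularity `sing i` only velocities along the monodromy invariant direction
`dir i` are tangent vectors of the affine structure. -/
def HasVelocity (γ : ℝ → ℝ × ℝ) (I : Set ℝ) (t : ℝ) (i : ZMod S.n) (c : ℝ × ℝ) : Prop :=
  (γ t ∈ S.chartDomain i ∨ (γ t = S.sing i ∧ ∃ a : ℝ, c = a • S.dir i)) ∧
    ∀ᶠ s in 𝓝[I] t, S.chart i (γ s) = S.chart i (γ t) + (s - t) • c

/-- `γ : I → B` is a straight path whose velocity is everywhere `w` times a primitive integral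
tangent vector. -/
def IsStraight (γ : ℝ → ℝ × ℝ) (I : Set ℝ) (w : ℕ) : Prop :=
  ContinuousOn γ I ∧ ∀ t ∈ I, ∃ (i : ZMod S.n) (m : ℤ × ℤ),
    IsCoprime m.1 m.2 ∧ S.HasVelocity γ I t i ((w : ℝ) • toReal m)

/-- The ray from a point `x` outside `σ₀` in the direction `w • m_out`. -/
def outRay (x : ℝ × ℝ) (w : ℕ) (s : ℝ) : ℝ × ℝ := (1 + w * s / S.gauge x) • x

/-- The interior of the unbounded maximal cell over the edge `[v i, v (i + 1)]`. -/
def openCell (i : ZMod S.n) : Set (ℝ × ℝ) :=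
  {x | 1 < S.gauge x ∧ 0 < wedge (S.vtx i) x ∧ 0 < wedge x (S.vtx (i + 1))}

/-- The part of `t`-order at most `k` (inside the open unbounded cells) of the walls of the initial
wall structure, i.e. of the rays that leave the singularities in the two monodromy invariant
directions. The `t`-order at `x` of the monomial `z^(m, 0)` of such a ray is the
derivative of `φ` at `x` in the direction `-m` of the ray. -/
def initialWalls (k : ℕ) : Set (ℝ × ℝ) :=
  {x | ∃ (j : ZMod S.n) (ε : ℝ) (γ : ℝ → ℝ × ℝ) (t c : ℝ), (ε = 1 ∨ ε = -1) ∧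
    γ 0 = S.sing j ∧ S.IsStraight γ (Ici 0) 1 ∧ S.HasVelocity γ (Ici 0) 0 j (ε • S.dir j) ∧
    0 < t ∧ γ t = x ∧ HasDerivAt (fun s => S.phi (γ s)) c t ∧ c ≤ k}

/-- `P` lies in (the interior of) an unbounded chamber of the initial wall structure to
`t`-order `k`. Chambers are subsets of cells. As the initial walls belong to every wall
structure `𝒮_k` consistent to order `k`, this holds whenever `P` is in the interior of an unbounded
chamber of `𝒮_k`. -/
def InUnboundedChamber (k : ℕ) (P : ℝ × ℝ) : Prop :=
  ∃ i, ¬ Bornology.IsBounded (connectedComponentIn (S.openCell i \ S.initialWalls k) P)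

/-- A subset of `B` is thin if, in every affine chart, it is covered by countably many lines. -/
def IsThin (N : Set (ℝ × ℝ)) : Prop :=
  ∃ 𝓛 : Set (AffineSubspace ℝ (ℝ × ℝ)), 𝓛.Countable ∧
    (∀ l ∈ 𝓛, Module.finrank ℝ l.direction = 1) ∧
    ∀ i, ∀ x ∈ N ∩ S.chartDomain i, ∃ l ∈ 𝓛, S.chart i x ∈ l

/-- A weighted rational graph with a map to `B` which is straight on edges and legs.

`G` is the finite tree obtained by adding to the graph an end point for each leg, so
edges of `G` are the edges and legs of the graph. The vertex `v` of `G` is mapped to `pos v`, with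
`pos v = none` for the end points at infinity. The edge `{a, b}`, oriented from `a` to `b`, is
parametrized by `path a b` on the closed interval `dom a b`, which starts at
`start a b` if `a` is not at infinity, and ends at `-start b a` if `b` is not at infinity. -/
structure TropicalMap where
  m : ℕ
  G : SimpleGraph (Fin m)
  tree : G.IsTree
  pos : Fin m → Option (ℝ × ℝ)
  weight : Fin m → Fin m → ℕ
  start : Fin m → Fin m → ℝ
  path : Fin m → Fin m → ℝ → ℝ × ℝ
  weight_pos : ∀ a b, G.Adj a b → 0 < weight a b
  weight_symm : ∀ a b, G.Adj a b → weight b a = weight a b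
  start_lt : ∀ a b, G.Adj a b → pos a ≠ none → pos b ≠ none → start a b < -start b a
  path_start : ∀ a b x, G.Adj a b → pos a = some x → path a b (start a b) = x
  path_symm : ∀ a b t, G.Adj a b → (pos a ≠ none → start a b ≤ t) →
    (pos b ≠ none → t ≤ -start b a) → path b a (-t) = path a b t
  straight : ∀ a b, G.Adj a b →
    S.IsStraight (path a b)
      {t | (pos a ≠ none → start a b ≤ t) ∧ (pos b ≠ none → t ≤ -start b a)} (weight a b)
  /-- Unbounded legs finally have direction `m_out`. -/
  unbounded : ∀ a b, G.Adj a b → pos b = none →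
    ∃ (T : ℝ) (x : ℝ × ℝ), (pos a ≠ none → start a b ≤ T) ∧ 1 < S.gauge x ∧
      ∀ s, 0 ≤ s → path a b (T + s) = S.outRay x (weight a b) s

namespace TropicalMap

variable {S}
variable (h : S.TropicalMap)

/-- The parameter interval of the edge from `a` to `b`. -/
def dom (a b : Fin h.m) : Set ℝ :=
  {t | (h.pos a ≠ none → h.start a b ≤ t) ∧ (h.pos b ≠ none → t ≤ -h.start b a)}

/-- `a` is the end point of a leg: an unbounded one, or a bounded one ending in a singularity. -/
def IsLegEnd (a : Fin h.m) : Prop :=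
  (h.G.neighborSet a).ncard = 1 ∧ (h.pos a = none ∨ ∃ i, h.pos a = some (S.sing i))

/-- The balancing condition at the vertex `a`: the weight vectors `u b` of the edges and legs at `a`
(their initial velocities) add up to zero. -/
def IsBalanced (a : Fin h.m) : Prop :=
  ∃ (i : ZMod S.n) (u : Fin h.m → ℝ × ℝ),
    (∀ b, h.G.Adj a b → S.HasVelocity (h.path a b) (h.dom a b) (h.start a b) i (u b)) ∧
    (∀ b, ¬ h.G.Adj a b → u b = 0) ∧ ∑ b, u b = 0

/-- A vertex of the graph proper: not univalent or bivalent, and balanced. -/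
def IsInnerVertex (a : Fin h.m) : Prop :=
  3 ≤ (h.G.neighborSet a).ncard ∧ h.pos a ≠ none ∧ h.IsBalanced a

/-- Rational tropical curves. (The graph may have no vertex at all: it is then a
straight line.) -/
def IsCurve : Prop := ∀ a, h.IsLegEnd a ∨ h.IsInnerVertex a

/-- Rational tropical disks with univalent vertex `r`, mapped to `P`. -/
def IsDisk (r : Fin h.m) (P : ℝ × ℝ) : Prop :=
  (h.G.neighborSet r).ncard = 1 ∧ h.pos r = some P ∧
    ∀ a, a ≠ r → h.IsLegEnd a ∨ h.IsInnerVertex a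

/-- The leg with end point `a` has weight `w`. -/
def LegWeight (a : Fin h.m) (w : ℕ) : Prop := ∃ b, h.G.Adj b a ∧ h.weight b a = w

/-- The image of the leg with end point `a` contains `P`. -/
def LegContains (a : Fin h.m) (P : ℝ × ℝ) : Prop :=
  ∃ b, h.G.Adj b a ∧ ∃ t ∈ h.dom b a, h.path b a t = P

/-- The edge `{a, b}` of `h` and the edge `{a', b'}` of `h'` are mapped to `B` in the same way, up to
a translation of the parameter. -/
def SameEdge (a b : Fin h.m) (h' : S.TropicalMap) (a' b' : Fin h'.m) : Prop :=
  ∃ c : ℝ, ∀ t, (t + c ∈ h'.dom a' b' ↔ t ∈ h.dom a b) ∧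
    (t ∈ h.dom a b → h'.path a' b' (t + c) = h.path a b t)

/-- `f` is an isomorphism between `h` and `h'`. -/
def IsIso (h' : S.TropicalMap) (f : h.G ≃g h'.G) : Prop :=
  (∀ a, h'.pos (f a) = h.pos a) ∧ ∀ a b, h.G.Adj a b → h.SameEdge a b h' (f a) (f b)

theorem SameEdge.symm {h h' : S.TropicalMap} {a b : Fin h.m} {a' b' : Fin h'.m}
    (H : h.SameEdge a b h' a' b') : h'.SameEdge a' b' h a b := by
  obtain ⟨c, hc⟩ := H
  refine ⟨-c, fun t => ?_⟩
  have := hc (t + -c)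
  simp only [neg_add_cancel_right] at this
  exact ⟨this.1.symm, fun ht => (this.2 (this.1.1 ht)).symm⟩

theorem SameEdge.trans {h h' h'' : S.TropicalMap} {a b : Fin h.m} {a' b' : Fin h'.m}
    {a'' b'' : Fin h''.m} (H : h.SameEdge a b h' a' b') (H' : h'.SameEdge a' b' h'' a'' b'') :
    h.SameEdge a b h'' a'' b'' := by
  obtain ⟨c, hc⟩ := H
  obtain ⟨c', hc'⟩ := H'
  refine ⟨c + c', fun t => ?_⟩
  rw [← add_assoc]
  refine ⟨(hc' (t + c)).1.trans (hc t).1, fun ht => ?_⟩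
  rw [(hc' (t + c)).2 ((hc t).1.2 ht), (hc t).2 ht]

theorem IsIso.refl (h : S.TropicalMap) : h.IsIso h (SimpleGraph.Iso.refl) :=
  ⟨fun _ => rfl, fun _ _ _ => ⟨0, fun t => by simp⟩⟩

theorem IsIso.symm {h h' : S.TropicalMap} {f : h.G ≃g h'.G} (H : h.IsIso h' f) :
    h'.IsIso h f.symm := by
  refine ⟨fun a => ?_, fun a b hab => ?_⟩
  · have := H.1 (f.symm a)
    rw [RelIso.apply_symm_apply] at this
    exact this.symm
  · have := H.2 (f.symm a) (f.symm b) (f.symm.map_rel_iff.2 hab)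
    rw [RelIso.apply_symm_apply, RelIso.apply_symm_apply] at this
    exact this.symm

theorem IsIso.trans {h h' h'' : S.TropicalMap} {f : h.G ≃g h'.G} {g : h'.G ≃g h''.G}
    (H : h.IsIso h' f) (H' : h'.IsIso h'' g) : h.IsIso h'' (f.trans g) := by
  refine ⟨fun a => ?_, fun a b hab => ?_⟩
  · exact (H'.1 (f a)).trans (H.1 a)
  · exact (H.2 a b hab).trans (H'.2 (f a) (f b) (f.map_rel_iff.2 hab))

end TropicalMap

/-- Representatives of the elements of `ℌ°_{p,q}(P)`: rational tropical disks with univalent vertex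
`root` mapped to `P`, exactly one unbounded leg, of weight `q`, and with weight vector
`-p • m_out` at `root`. -/
structure Disk (p q : ℕ) (P : ℝ × ℝ) where
  map : S.TropicalMap
  root : Fin map.m
  isDisk : map.IsDisk root P
  leg : ∃ b, (∀ a, map.pos a = none ↔ a = b) ∧ map.LegWeight b q
  velocity : ∃ a, map.G.Adj root a ∧ ∃ i, S.HasVelocity (map.path root a) (map.dom root a)
    (map.start root a) i (-(p : ℝ) • S.vtx i)

/-- Representatives of the elements of `ℌ_{p,q}(P)`: rational tropical curves with exactly two
unbounded legs, of weights `p` and `q`, such that the image of the leg of weight `p`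
contains `P`. -/
structure Curve (p q : ℕ) (P : ℝ × ℝ) where
  map : S.TropicalMap
  isCurve : map.IsCurve
  legs : ∃ a b, a ≠ b ∧ (∀ c, map.pos c = none ↔ c = a ∨ c = b) ∧
    map.LegWeight a p ∧ map.LegWeight b q ∧ map.LegContains a P

instance diskSetoid (p q : ℕ) (P : ℝ × ℝ) : Setoid (S.Disk p q P) where
  r d d' := ∃ f : d.map.G ≃g d'.map.G, d.map.IsIso d'.map f ∧ f d.root = d'.root
  iseqv :=
    ⟨fun d => ⟨_, TropicalMap.IsIso.refl d.map, rfl⟩,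
      fun ⟨f, hf, hr⟩ => ⟨f.symm, hf.symm, by rw [← hr, RelIso.symm_apply_apply]⟩,
      fun ⟨f, hf, hr⟩ ⟨g, hg, hs⟩ => ⟨f.trans g, hf.trans hg, by
        rw [← hs, ← hr]; rfl⟩⟩

instance curveSetoid (p q : ℕ) (P : ℝ × ℝ) : Setoid (S.Curve p q P) where
  r h h' := ∃ f : h.map.G ≃g h'.map.G, h.map.IsIso h'.map f
  iseqv :=
    ⟨fun h => ⟨_, TropicalMap.IsIso.refl h.map⟩,
      fun ⟨f, hf⟩ => ⟨f.symm, hf.symm⟩,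
      fun ⟨f, hf⟩ ⟨g, hg⟩ => ⟨f.trans g, hf.trans hg⟩⟩

/-- The set `ℌ°_{p,q}(P)` of isomorphism classes of tropical disks. -/
abbrev DiskClass (p q : ℕ) (P : ℝ × ℝ) := Quotient (S.diskSetoid p q P)

/-- The set `ℌ_{p,q}(P)` of isomorphism classes of tropical curves. -/
abbrev CurveClass (p q : ℕ) (P : ℝ × ℝ) := Quotient (S.curveSetoid p q P)

variable {S}

/-- The tropical curve `h` arises from the tropical disk `d` by prolonging the edge `E_∞` at the
univalent vertex (mapped to `P`) to an unbounded leg, by the ray from `P` in the direction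
`p • m_out`, and forgetting the vertex. Everything else is unchanged. -/
def Disk.IsCompletedTo {p q : ℕ} {P : ℝ × ℝ} (d : S.Disk p q P) (h : S.Curve p q P) : Prop :=
  ∃ f : d.map.G ≃g h.map.G,
    h.map.pos (f d.root) = none ∧
    (∀ a, a ≠ d.root → h.map.pos (f a) = d.map.pos a) ∧
    (∀ a b, d.map.G.Adj a b → a ≠ d.root → b ≠ d.root →
      d.map.SameEdge a b h.map (f a) (f b)) ∧
    ∀ a, d.map.G.Adj a d.root → ∃ c : ℝ,
      (∀ t, t + c ∈ h.map.dom (f a) (f d.root) ↔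
        t ∈ d.map.dom a d.root ∨ -d.map.start d.root a ≤ t) ∧
      (∀ t ∈ d.map.dom a d.root,
        h.map.path (f a) (f d.root) (t + c) = d.map.path a d.root t) ∧
      ∀ s, 0 ≤ s → h.map.path (f a) (f d.root) (-d.map.start d.root a + s + c) = S.outRay P p s

end DualComplex

end DelPezzo

end

/-!
Prolonging a disk along `P + ℝ≥0 m_out` always gives a curve, because no condition of balancing is
imposed at `P` and all unbounded edges are parallel to `m_out`. The content of the theorem is that
a curve whose leg of weight `p` passes a general point `P` of an unbounded chamber does so in the
direction `m_out`, at a point which is not a vertex, and that there is only one way to cut it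
there.

*Flat coordinates.* Cut open and developed, the complement of the interior of `σ₀` becomes the
region `0 ≤ Y + F X` of the plane, where `F` is convex and piecewise affine with integral slopes
`sl j`, and `Y + F X` is the function `φ`. The direction `m_out` is `(0, 1)`, and a straight path
is an affine line as long as it does not enter the interior of `σ₀` (`IsStraight.lift`). The order
of a direction `(a, c)` in the cell `j`, that is, the growth of `φ` along it, is `c + a * sl j`;
by convexity it increases along a line (`order_mono`). A line on which `φ` increases therefore
never returns to `σ₀`; if it is part of the leg of weight `p`, its direction is the final one,
`m_out`.

*Walls.* A tropical curve with two unbounded legs is a tree with a path between the two unbounded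
ends. A branch off this path has only singularities as its ends. Followed from there towards the
path, it never descends, since the initial directions are tangent to `∂σ₀`, sums of ascending
directions ascend, and orders increase along lines. The same induction (`HasEnds.isWall`) shows
that the last edge of the branch has an order that is divisible by the common divisor `g` of the
changes `kink i` of the slopes of `F`, that its moment `X c - Y a` is an integer, and that it
stays below a ray of the same order starting at `∂σ₀`. These properties are collected in
`IsWallDir`.

*The leg points outwards.* Suppose that the leg of weight `p` descends at `P` on the way to its
unbounded end. Followed backwards it ascends to a vertex, where it meets at least one wall, and
from there the path leads to the other end. On this path the order is at most `q`, as the final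
order is `q` and walls only contribute nonnegative orders (`HasEnds.order_le`). If the leg is not
parallel to `m_out`, it has to return to `σ₀`, so `P` lies below a ray of order at most `q - g`;
if it is parallel to `m_out`, then `P` lies below a wall of order less than `q` that is a multiple
of `g`. Both are impossible by `InUnboundedChamber.not_below`: the slopes of `F` increase by at
most `2 + g` at a time, because the origin is the only interior lattice point of the polar polygon
of `σ₀` (`exists_dvd_kink`), so there is an initial wall of order at most `q + 1 ≤ p + q` above
`P`. This proves `HasEnds.exists_outRay`. If the curve is a line without vertices, the leg of
weight `p` may also be the other half of it, which is why the ends may be exchanged there.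

*General points.* The exceptional set is `integralLines`, the countable union of the lines with
integral direction and integral moment. If the leg started at a vertex mapped to `P`, a wall would
arrive there, with integral moment; so `P` lies in the interior of the leg. If both legs passed
`P` with the same weight in the direction `m_out`, then the moments of all edges, which are
antisymmetric in the orientation and add up to integers at the vertices and the singularities,
would show that `2 p X` is an integer (`HasEnds.mem_integralLines`). Hence the disk can be
recovered from the completed curve (`Disk.equiv_of_isCompletedTo`), as `φ` is injective on a ray
in the direction `m_out`.
-/

noncomputable section

namespace DelPezzo

/-! ### Determinants in the plane -/

section wedge

variable {R : Type*} [CommRing R]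

theorem wedge_add_left (x y z : R × R) : wedge (x + y) z = wedge x z + wedge y z := by
  simp only [wedge, Prod.fst_add, Prod.snd_add]; ring

theorem wedge_add_right (x y z : R × R) : wedge x (y + z) = wedge x y + wedge x z := by
  simp only [wedge, Prod.fst_add, Prod.snd_add]; ring

theorem wedge_smul_left (a : R) (x y : R × R) : wedge (a • x) y = a * wedge x y := by
  simp only [wedge, Prod.smul_fst, Prod.smul_snd, smul_eq_mul]; ring

theorem wedge_smul_right (a : R) (x y : R × R) : wedge x (a • y) = a * wedge x y := by
  simp only [wedge, Prod.smul_fst, Prod.smul_snd, smul_eq_mul]; ring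

theorem wedge_neg_right (x y : R × R) : wedge x (-y) = -wedge x y := by
  simp only [wedge, Prod.fst_neg, Prod.snd_neg]; ring

@[simp] theorem wedge_self (x : R × R) : wedge x x = 0 := by simp only [wedge]; ring

theorem wedge_swap (x y : R × R) : wedge x y = -wedge y x := by simp only [wedge]; ring

@[simp] theorem wedge_zero_left (x : R × R) : wedge 0 x = 0 := by simp [wedge]

@[simp] theorem wedge_zero_right (x : R × R) : wedge x 0 = 0 := by simp [wedge]

/-- Cramer's rule: the coordinates of `x` in the basis `v`, `e`. -/
theorem wedge_smul_eq (v e x : R × R) : wedge v e • x = wedge v x • e + wedge x e • v := by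
  ext <;> simp only [wedge, Prod.smul_fst, Prod.smul_snd, smul_eq_mul, Prod.fst_add,
    Prod.snd_add] <;> ring

theorem eq_of_wedge_eq_one {v e : R × R} (h : wedge v e = 1) (x : R × R) :
    x = wedge v x • e + wedge x e • v := by
  rw [← wedge_smul_eq, h, one_smul]

end wedge

theorem toReal_add (x y : ℤ × ℤ) : toReal (x + y) = toReal x + toReal y := by
  simp [toReal]

theorem toReal_smul (a : ℤ) (x : ℤ × ℤ) : toReal (a • x) = (a : ℝ) • toReal x := by
  simp [toReal]

theorem wedge_toReal (x y : ℤ × ℤ) : wedge (toReal x) (toReal y) = (wedge x y : ℤ) := by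
  simp [wedge, toReal]

/-! ### The reflexive polygon -/

namespace DualComplex

variable (S : DualComplex)

theorem wedge_v_succ_e (i : ZMod S.n) : wedge (S.v (i + 1)) (S.e i) = 1 := by
  rw [S.edge, wedge_add_left, S.distance_one, wedge_smul_left, wedge_self, mul_zero, add_zero]

theorem wedge_v_e_pred (i : ZMod S.n) : wedge (S.v i) (S.e (i - 1)) = 1 := by
  have := S.wedge_v_succ_e (i - 1)
  rwa [sub_add_cancel] at this

/-- The lattice length of the edge of the polar polygon dual to the vertex `v i`. It is the change
of the slope of `φ` along a straight line that crosses the unbounded edge at `v i`, and it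
vanishes if `v i` is not a corner of `σ₀`. -/
def kink (i : ZMod S.n) : ℤ := wedge (S.e (i - 1)) (S.e i)

theorem e_pred (i : ZMod S.n) : S.e (i - 1) = S.e i + S.kink i • S.v i := by
  have := eq_of_wedge_eq_one (S.distance_one i) (S.e (i - 1))
  rwa [wedge_v_e_pred, one_smul] at this

theorem kink_nonneg (i : ZMod S.n) : 0 ≤ S.kink i := by
  have h := S.convex (i + 1) (i - 1)
  rw [S.edge, wedge_add_left, wedge_v_e_pred, wedge_smul_left, wedge_swap] at h
  have := S.len_pos i
  unfold kink
  by_contra! hk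
  nlinarith

theorem sum_len_e : ∑ i, (S.len i : ℤ) • S.e i = 0 := by
  have h : ∑ i, S.v (i + 1) = ∑ i, S.v i := Equiv.sum_comp (Equiv.addRight (1 : ZMod S.n)) S.v
  simp only [S.edge, Finset.sum_add_distrib] at h
  simpa using h

/-- A cyclic property of the indices is propagated from one index to all. -/
theorem forall_of_succ {p : ZMod S.n → Prop} (i : ZMod S.n) (hi : p i)
    (h : ∀ j, p j → p (j + 1)) (j : ZMod S.n) : p j := by
  have : ∀ m : ℕ, p (i + m) := by
    intro m
    induction m with
    | zero => simpa using hi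
    | succ m ih => have := h _ ih; rwa [add_assoc, ← Nat.cast_succ] at this
  have h2 := this (j - i).val
  rwa [ZMod.natCast_zmod_val, add_sub_cancel] at h2

theorem exists_kink_pos : ∃ i, 0 < S.kink i := by
  by_contra! h
  have hk : ∀ i, S.kink i = 0 := fun i => le_antisymm (h i) (S.kink_nonneg i)
  have he : ∀ j, S.e j = S.e 0 := by
    refine S.forall_of_succ (p := fun j => S.e j = S.e 0) 0 rfl fun j hj => ?_
    have := S.e_pred (j + 1)
    rw [hk, zero_smul, add_zero, add_sub_cancel_right] at this
    rw [← this, hj]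
  have h1 := S.sum_len_e
  simp only [he, ← Finset.sum_smul] at h1
  have h2 := congrArg (wedge (S.v 0)) h1
  rw [wedge_smul_right, S.distance_one, wedge_zero_right, mul_one] at h2
  have h3 : 0 < ∑ i, (S.len i : ℤ) :=
    Finset.sum_pos (fun i _ => by exact_mod_cast S.len_pos i) Finset.univ_nonempty
  omega

/-- The origin is an interior point of `σ₀`. -/
theorem exists_wedge_v_pos {w : ℤ × ℤ} (hw : w ≠ 0) : ∃ j, 0 < wedge (S.v j) w := by
  by_contra! h
  obtain ⟨i, -, hi⟩ := Finset.exists_max_image Finset.univ (fun j => wedge (S.v j) w)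
    Finset.univ_nonempty
  have hi : ∀ j, wedge (S.v j) w ≤ wedge (S.v i) w := fun j => hi j (Finset.mem_univ j)
  have key : ∀ j, wedge (S.v j) w = wedge (S.v i) w →
      S.kink j = 0 ∧ wedge (S.v (j + 1)) w = wedge (S.v i) w := by
    intro j hj
    have h1 := hi (j + 1)
    have h2 := hi (j - 1)
    have h3 := S.edge (j - 1)
    rw [sub_add_cancel] at h3
    have hl := S.len_pos j
    have hl' := S.len_pos (j - 1)
    have hk := S.kink_nonneg j
    have h4 := eq_of_wedge_eq_one (S.distance_one j) w
    have hneg := h j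
    rw [S.edge, wedge_add_left, wedge_smul_left] at h1 ⊢
    rw [h3] at hj
    have h5 : wedge (S.v j) w = wedge (S.v i) w := by rw [h3]; exact hj
    rw [wedge_add_left, wedge_smul_left] at hj
    rw [S.e_pred, wedge_add_left, wedge_smul_left] at hj
    have a1 : wedge (S.e j) w ≤ 0 := by by_contra! hc; nlinarith
    have a2 : 0 ≤ wedge (S.e j) w + S.kink j * wedge (S.v j) w := by by_contra! hc; nlinarith
    have a3 : S.kink j * wedge (S.v j) w ≤ 0 := by nlinarith
    have a4 : wedge (S.e j) w = 0 := by linarith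
    have a5 : S.kink j * wedge (S.v j) w = 0 := by linarith
    rw [wedge_swap w, a4] at h4
    refine ⟨?_, by rw [a4]; linarith⟩
    rcases mul_eq_zero.1 a5 with h6 | h6
    · exact h6
    · rw [h6] at h4; simp at h4; exact absurd h4 hw
  have h1 := S.forall_of_succ (p := fun j => wedge (S.v j) w = wedge (S.v i) w) i rfl
    fun j hj => (key j hj).2
  obtain ⟨j, hj⟩ := S.exists_kink_pos
  have := (key j (h1 j)).1
  omega

theorem exists_wedge_v_e_neg (i : ZMod S.n) : ∃ j, wedge (S.v i) (S.e j) < 0 := by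
  by_contra! h
  have h1 := congrArg (wedge (S.v i)) S.sum_len_e
  have h2 : ∀ s : Finset (ZMod S.n), wedge (S.v i) (∑ j ∈ s, (S.len j : ℤ) • S.e j) =
      ∑ j ∈ s, (S.len j : ℤ) * wedge (S.v i) (S.e j) := by
    intro s
    induction s using Finset.induction_on with
    | empty => simp
    | insert a s ha ih => rw [Finset.sum_insert ha, Finset.sum_insert ha, wedge_add_right, ih,
        wedge_smul_right]
  rw [h2, wedge_zero_right] at h1
  have h3 : 0 < ∑ j, (S.len j : ℤ) * wedge (S.v i) (S.e j) := by
    refine Finset.sum_pos' (fun j _ => mul_nonneg (by positivity) (h j)) ⟨i, Finset.mem_univ i, ?_⟩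
    rw [S.distance_one, mul_one]
    exact_mod_cast S.len_pos i
  omega

/-- Coordinates of `v j` and `e j` with respect to `v i` and `e i`. -/
theorem wedge_v_e_eq (i j l : ZMod S.n) : wedge (S.v j) (S.e l) =
    wedge (S.v j) (S.e i) * wedge (S.v i) (S.e l) -
      wedge (S.v i) (S.v j) * wedge (S.e l) (S.e i) := by
  have h := S.distance_one i
  simp only [wedge] at h ⊢
  linear_combination (-((S.v j).1 * (S.e l).2 - (S.v j).2 * (S.e l).1)) * h

theorem corner_of_constraints {x y a b a' b' : ℤ} (d1 : -3 * x - -1 * y ≤ 1)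
    (d2 : 1 * x - 1 * y ≤ 1) (d3 : x ≤ 1) (e1 : a * x - b * y = 1) (e2 : a' * x - b' * y = 1)
    (f1 : a ≤ 1) (f2 : a' ≤ 1) (f3 : a - b * 4 ≤ 1) (f4 : a' - b' * 4 ≤ 1)
    (f5 : a * -1 - b * -2 ≤ 1) (f6 : a' * -1 - b' * -2 ≤ 1) (hne : ¬ (a = a' ∧ b = b')) :
    (x = 1 ∧ y = 0) ∨ (x = 1 ∧ y = 4) ∨ (x = -1 ∧ y = -2) := by
  have hx : -1 ≤ x := by omega
  have hy : -2 ≤ y := by omega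
  have hy' : y ≤ 4 := by omega
  interval_cases x <;> interval_cases y <;> omega

/-- The slopes of `φ` change by little at the vertices of `σ₀`, compared with their common
divisor. An edge of the polar polygon has lattice length at most `4`, because the origin
is the only interior lattice point of that polygon; if some edge has length `4`, the polar polygon
is a triangle with edges of lattice lengths `4`, `2`, `2`. -/
theorem exists_dvd_kink : ∃ g : ℤ, 0 < g ∧ ∀ i, g ∣ S.kink i ∧ S.kink i ≤ 2 + g := by
  by_cases h3 : ∀ i, S.kink i ≤ 3
  · exact ⟨1, one_pos, fun i => ⟨one_dvd _, by linarith [h3 i]⟩⟩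
  push Not at h3
  obtain ⟨i, hi⟩ := h3
  -- `v j = α v + β e` and `e l = x e + y v` in the basis `v = v i`, `e = e i`
  set α : ZMod S.n → ℤ := fun j => wedge (S.v j) (S.e i) with hα
  set β : ZMod S.n → ℤ := fun j => wedge (S.v i) (S.v j) with hβ
  set x : ZMod S.n → ℤ := fun l => wedge (S.v i) (S.e l) with hx
  set y : ZMod S.n → ℤ := fun l => wedge (S.e l) (S.e i) with hy
  have hve : ∀ j l, wedge (S.v j) (S.e l) = α j * x l - β j * y l := fun j l =>
    S.wedge_v_e_eq i j l
  have hc : ∀ j l, α j * x l - β j * y l ≤ 1 := fun j l => by rw [← hve]; exact S.convex j l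
  have hα1 : ∀ j, α j ≤ 1 := fun j => S.convex j i
  have hx1 : ∀ l, x l ≤ 1 := fun l => S.convex i l
  have hxi : x (i - 1) = 1 := S.wedge_v_e_pred i
  have hyi : y (i - 1) = S.kink i := rfl
  have hαk : ∀ j, α j - β j * S.kink i ≤ 1 := fun j => by
    have := hc j (i - 1); rw [hxi, hyi] at this; linarith
  have hvne : S.v i ≠ 0 := by
    intro h; have := S.distance_one i; rw [h, wedge_zero_left] at this; omega
  obtain ⟨j1, hj1⟩ : ∃ j, β j < 0 := by
    obtain ⟨j, hj⟩ := S.exists_wedge_v_pos hvne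
    exact ⟨j, by rw [hβ]; simp only; rw [wedge_swap]; linarith⟩
  obtain ⟨j2, hj2⟩ : ∃ j, 0 < β j := by
    obtain ⟨j, hj⟩ := S.exists_wedge_v_pos (neg_ne_zero.2 hvne)
    exact ⟨j, by rw [hβ]; simp only; rw [wedge_swap]; rwa [wedge_neg_right] at hj⟩
  obtain ⟨m, hm⟩ : ∃ m, x m < 0 := S.exists_wedge_v_e_neg i
  have c1 := hc j1 m
  have c2 := hc j2 m
  have c3 := hαk j1
  have c4 := hα1 j2
  have hy2 : -(1 - x m) ≤ y m := by
    by_contra! hcon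
    nlinarith
  have hk4 : (-β j1) * S.kink i * (-x m) ≤ (1 - x m) * (1 - β j1) := by nlinarith
  have hkle : S.kink i ≤ 4 ∧ (S.kink i = 4 → x m = -1 ∧ β j1 = -1) := by
    obtain ⟨B, hB⟩ : ∃ B : ℤ, B = -β j1 := ⟨_, rfl⟩
    obtain ⟨Z, hZ⟩ : ∃ Z : ℤ, Z = -x m := ⟨_, rfl⟩
    have hB1 : 1 ≤ B := by omega
    have hZ1 : 1 ≤ Z := by omega
    have hk5 : B * S.kink i * Z ≤ (1 + Z) * (1 + B) := by
      have e1 : β j1 = -B := by omega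
      have e2 : x m = -Z := by omega
      rw [e1, e2] at hk4
      linarith
    have hBZ : (1 + Z) * (1 + B) ≤ 4 * (B * Z) := by nlinarith
    have hBZ1 : 1 ≤ B * Z := by nlinarith
    have h4 : S.kink i ≤ 4 := by by_contra! hcon; nlinarith
    refine ⟨h4, fun h => ?_⟩
    rw [h] at hk5
    have : B = 1 := by by_contra hne; have : 2 ≤ B := by omega
                       nlinarith
    have : Z = 1 := by by_contra hne; have : 2 ≤ Z := by omega
                       nlinarith
    constructor <;> omega
  have hk : S.kink i = 4 := by omega
  obtain ⟨hxm, hb1⟩ := hkle.2 hk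
  rw [hxm] at c1 c2 hy2
  rw [hb1] at c1 c3
  rw [hk] at c3
  have hym : y m = -2 := by omega
  have ha1 : α j1 = -3 := by omega
  rw [hym] at c2
  have hb2 : β j2 = 1 := by omega
  have ha2 : α j2 = 1 := by omega
  -- the points of the polar polygon that are primitive normals of edges are its three corners
  have hcorner : ∀ l, (x l = 1 ∧ y l = 0) ∨ (x l = 1 ∧ y l = 4) ∨ (x l = -1 ∧ y l = -2) := by
    intro l
    have d1 := hc j1 l
    have d2 := hc j2 l
    have d3 := hx1 l
    rw [ha1, hb1] at d1
    rw [ha2, hb2] at d2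
    -- the two end points of the edge of `σ₀` on which `e l` is constant differ
    have e1 : α l * x l - β l * y l = 1 := by rw [← hve]; exact S.distance_one l
    have e2 : α (l + 1) * x l - β (l + 1) * y l = 1 := by rw [← hve]; exact S.wedge_v_succ_e l
    have f1 := hα1 l
    have f2 := hα1 (l + 1)
    have f3 := hαk l
    have f4 := hαk (l + 1)
    have f5 := hc l m
    have f6 := hc (l + 1) m
    rw [hxm, hym] at f5 f6
    rw [hk] at f3 f4
    have hne : ¬ (α l = α (l + 1) ∧ β l = β (l + 1)) := by
      rintro ⟨g1, g2⟩
      have g3 : ∀ j, S.v j = β j • S.e i + α j • S.v i := fun j =>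
        eq_of_wedge_eq_one (S.distance_one i) _
      have g4 : S.v l = S.v (l + 1) := by rw [g3 l, g3 (l + 1), g1, g2]
      have g5 := S.v_injective g4
      have g6 := S.edge l
      rw [← g5] at g6
      have g7 := congrArg (wedge (S.v l)) (left_eq_add.1 g6)
      rw [wedge_smul_right, S.distance_one, wedge_zero_right] at g7
      have := S.len_pos l
      omega
    exact corner_of_constraints d1 d2 d3 e1 e2 f1 f2 f3 f4 f5 f6 hne
  refine ⟨2, two_pos, fun l => ⟨?_, ?_⟩⟩
  · have hw : S.kink l = y (l - 1) * x l - x (l - 1) * y l := by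
      have h := S.distance_one i
      simp only [hx, hy, kink]
      simp only [wedge] at h ⊢
      linear_combination
        (-((S.e (l - 1)).1 * (S.e l).2 - (S.e (l - 1)).2 * (S.e l).1)) * h
    rw [hw]
    rcases hcorner l with ⟨h1, h2⟩ | ⟨h1, h2⟩ | ⟨h1, h2⟩ <;>
    rcases hcorner (l - 1) with ⟨h1', h2'⟩ | ⟨h1', h2'⟩ | ⟨h1', h2'⟩ <;>
    rw [h1, h2, h1', h2'] <;> norm_num
  · have hw : S.kink l = y (l - 1) * x l - x (l - 1) * y l := by
      have h := S.distance_one i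
      simp only [hx, hy, kink]
      simp only [wedge] at h ⊢
      linear_combination
        (-((S.e (l - 1)).1 * (S.e l).2 - (S.e (l - 1)).2 * (S.e l).1)) * h
    rw [hw]
    rcases hcorner l with ⟨h1, h2⟩ | ⟨h1, h2⟩ | ⟨h1, h2⟩ <;>
    rcases hcorner (l - 1) with ⟨h1', h2'⟩ | ⟨h1', h2'⟩ | ⟨h1', h2'⟩ <;>
    rw [h1, h2, h1', h2'] <;> norm_num

/-- An edge whose relative interior meets a line on which the normal `e l` is maximal has that
normal. -/
theorem e_eq_of_interior {m l : ZMod S.n} {s : ℝ} (h0 : 0 < s) (h1 : s < S.len m)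
    (h : wedge (S.vtx m + s • S.dir m) (S.dir l) = 1) : S.e l = S.e m := by
  have hl := S.convex m l
  have hr := S.convex (m + 1) l
  rw [S.edge, wedge_add_left, wedge_smul_left] at hr
  rw [wedge_add_left, wedge_smul_left, vtx, dir, dir, wedge_toReal, wedge_toReal] at h
  have hl' : ((wedge (S.v m) (S.e l) : ℤ) : ℝ) ≤ 1 := by exact_mod_cast hl
  have hr' : ((wedge (S.v m) (S.e l) : ℤ) : ℝ) + S.len m * ((wedge (S.e m) (S.e l) : ℤ) : ℝ) ≤
      1 := by
    exact_mod_cast hr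
  have hz : ((wedge (S.e m) (S.e l) : ℤ) : ℝ) = 0 := by nlinarith
  have hv : ((wedge (S.v m) (S.e l) : ℤ) : ℝ) = 1 := by rw [hz] at h; linarith
  have hz' : wedge (S.e m) (S.e l) = 0 := by exact_mod_cast hz
  have hv' : wedge (S.v m) (S.e l) = 1 := by exact_mod_cast hv
  have := eq_of_wedge_eq_one (S.distance_one m) (S.e l)
  rwa [hv', wedge_swap, hz', neg_zero, zero_smul, one_smul, add_zero] at this

theorem len_smul_e_ne {i : ZMod S.n} {r : ℤ} (h : r • S.e i = 0) : r = 0 := by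
  have := congrArg (wedge (S.v i)) h
  rwa [wedge_smul_right, S.distance_one, wedge_zero_right, mul_one] at this

theorem e_eq_of_v_eq {m i : ZMod S.n} {r : ℤ} (h0 : 0 < r) (h1 : r < S.len i)
    (h : S.v m = S.v i + r • S.e i) : S.e m = S.e i := by
  refine S.e_eq_of_interior (s := r) (by exact_mod_cast h0) (by exact_mod_cast h1) ?_
  have h2 := S.distance_one m
  rw [vtx, dir, ← toReal_smul, ← toReal_add, ← h, dir, wedge_toReal, h2, Int.cast_one]

/-- The boundary polygon is traversed only once: no vertex lies in the relative interior of an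
edge. -/
theorem not_vertex_in_edge (m i : ZMod S.n) (r : ℤ) (h0 : 0 < r) (h1 : r < S.len i) :
    S.v m ≠ S.v i + r • S.e i := by
  classical
  intro hm
  -- on the line through an edge, take the last vertex that lies inside another edge
  set T := Finset.univ.filter fun m' : ZMod S.n => ∃ (i' : ZMod S.n) (r' : ℤ), 0 < r' ∧
    r' < S.len i' ∧ S.v m' = S.v i' + r' • S.e i' ∧ S.e i' = S.e i with hT
  have hne : T.Nonempty :=
    ⟨m, by rw [hT, Finset.mem_filter]; exact ⟨Finset.mem_univ _, i, r, h0, h1, hm, rfl⟩⟩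
  obtain ⟨m', hm', hmax⟩ := T.exists_max_image (fun m' => wedge (S.v i) (S.v m')) hne
  rw [hT, Finset.mem_filter] at hm'
  obtain ⟨-, i', r', h0', h1', hv, he⟩ := hm'
  have hem : S.e m' = S.e i := (S.e_eq_of_v_eq h0' h1' hv).trans he
  have hlm := S.len_pos m'
  have hmono : ∀ (q : ZMod S.n) (t : ℤ), 0 < t → S.v q = S.v m' + t • S.e i → q ∉ T := by
    intro q t ht hq hqT
    have := hmax q hqT
    simp only [hq, wedge_add_right, wedge_smul_right, S.distance_one] at this
    linarith
  have hnext := S.edge m'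
  rw [hem] at hnext
  rcases lt_trichotomy (r' + S.len m') (S.len i') with hlt | heq | hgt
  · refine hmono (m' + 1) _ (by exact_mod_cast hlm) hnext ?_
    rw [hT, Finset.mem_filter]
    refine ⟨Finset.mem_univ _, i', r' + S.len m', by omega, hlt, ?_, he⟩
    rw [hnext, hv, he, add_smul, add_assoc]
  · have : S.v (m' + 1) = S.v (i' + 1) := by
      rw [hnext, hv, S.edge, he, add_assoc, ← add_smul, heq]
    have := add_right_cancel (S.v_injective this)
    rw [this] at hv
    have := S.len_smul_e_ne (left_eq_add.1 hv)
    omega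
  · have hi : S.v (i' + 1) = S.v m' + (S.len i' - r') • S.e i := by
      rw [S.edge, hv, he, add_assoc, ← add_smul]; congr 2; ring
    refine hmono (i' + 1) _ (by omega) hi ?_
    rw [hT, Finset.mem_filter]
    exact ⟨Finset.mem_univ _, m', S.len i' - r', by omega, by omega, by rw [hi, hem], hem⟩

/-- The half-open edges of `σ₀` are disjoint. -/
theorem edge_unique {m i : ZMod S.n} {s t : ℝ} (hs : 0 ≤ s) (hs' : s < S.len m)
    (ht : 0 ≤ t) (ht' : t < S.len i)
    (h : S.vtx m + s • S.dir m = S.vtx i + t • S.dir i) : m = i := by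
  have hwm : ∀ (m : ZMod S.n) (s : ℝ), wedge (S.vtx m + s • S.dir m) (S.dir m) = 1 := by
    intro m s
    rw [wedge_add_left, wedge_smul_left, wedge_self, vtx, dir, wedge_toReal, S.distance_one]
    simp
  have he : 0 < s ∨ 0 < t → S.e m = S.e i := by
    rintro (h0 | h0)
    · exact (S.e_eq_of_interior h0 hs' (by rw [h]; exact hwm i t)).symm
    · exact S.e_eq_of_interior h0 ht' (by rw [← h]; exact hwm m s)
  have toInt : ∀ {x y : ℤ × ℤ}, toReal x = toReal y → x = y := by
    intro x y hxy
    simp only [toReal, Prod.mk.injEq, Int.cast_inj] at hxy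
    exact Prod.ext hxy.1 hxy.2
  by_cases h0 : 0 < s ∨ 0 < t
  · have he := he h0
    have hd : S.dir m = S.dir i := by rw [dir, he]; rfl
    rw [hd] at h
    have h1 : S.vtx m = S.vtx i + (t - s) • S.dir i := by
      rw [sub_smul, ← sub_eq_iff_eq_add', ← sub_eq_zero]
      rw [← sub_eq_zero] at h
      rw [← h]; abel
    have h2 : (t - s : ℝ) = (wedge (S.v i) (S.v m) : ℤ) := by
      rw [← wedge_toReal]
      change _ = wedge (S.vtx i) (S.vtx m)
      rw [h1, wedge_add_right, wedge_self, wedge_smul_right, vtx, dir, wedge_toReal,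
        S.distance_one]
      simp
    set r := wedge (S.v i) (S.v m)
    have h3 : S.v m = S.v i + r • S.e i := toInt (by
      rw [toReal_add, toReal_smul, ← h2]; exact h1)
    rcases lt_trichotomy r 0 with hr | hr | hr
    · exfalso
      refine S.not_vertex_in_edge i m (-r) (by omega) ?_ (by rw [h3, he, neg_smul]; abel)
      have : (-r : ℝ) < S.len m := by rw [← h2]; linarith
      exact_mod_cast this
    · rw [hr, zero_smul, add_zero] at h3
      exact S.v_injective h3
    · exfalso
      refine S.not_vertex_in_edge m i r hr ?_ h3
      have : (r : ℝ) < S.len i := by rw [← h2]; linarith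
      exact_mod_cast this
  · push Not at h0
    have hs0 : s = 0 := le_antisymm h0.1 hs
    have ht0 : t = 0 := le_antisymm h0.2 ht
    rw [hs0, ht0, zero_smul, zero_smul, add_zero, add_zero] at h
    exact S.v_injective (toInt h)

end DualComplex

/-! ### Flat coordinates on the unbounded cells -/

/-- The function on `ℤ` with first differences `f` that vanishes at `0`. -/
def cum (f : ℤ → ℤ) (i : ℤ) : ℤ := ∑ j ∈ Finset.Ico 0 i, f j - ∑ j ∈ Finset.Ico i 0, f j

theorem cum_succ (f : ℤ → ℤ) (i : ℤ) : cum f (i + 1) = cum f i + f i := by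
  unfold cum
  rcases le_or_gt 0 i with h | h
  · rw [Finset.Ico_eq_empty_of_le (by omega : (0 : ℤ) ≤ i + 1),
      Finset.Ico_eq_empty_of_le h,
      ← Finset.insert_Ico_right_eq_Ico_add_one h, Finset.sum_insert (by simp)]
    simp; ring
  · rw [Finset.Ico_eq_empty_of_le (by omega : i + 1 ≤ (0 : ℤ)),
      Finset.Ico_eq_empty_of_le h.le, ← Finset.insert_Ico_add_one_left_eq_Ico h,
      Finset.sum_insert (by simp)]
    simp

namespace DualComplex

variable (S : DualComplex)

/-- The vertices, indexed periodically by the integers. -/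
def vt (i : ℤ) : ℝ × ℝ := S.vtx (i : ZMod S.n)

/-- The edge directions, indexed periodically by the integers. -/
def dr (i : ℤ) : ℝ × ℝ := S.dir (i : ZMod S.n)

/-- The affine length of the boundary of `σ₀` up to the vertex `i`: the first flat coordinate
of this vertex. -/
def xs : ℤ → ℤ := cum fun j => S.len (j : ZMod S.n)

/-- The slope of the affine function `G i`, that is, of `F` on the cell `i`. -/
def sl : ℤ → ℤ := cum fun j => S.kink ((j + 1 : ℤ) : ZMod S.n)

/-- The value of `F` at the vertex `i`. -/
def ys : ℤ → ℤ := cum fun j => S.sl j * S.len (j : ZMod S.n)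

theorem xs_succ (i : ℤ) : S.xs (i + 1) = S.xs i + S.len (i : ZMod S.n) := cum_succ _ i

theorem sl_succ (i : ℤ) : S.sl (i + 1) = S.sl i + S.kink ((i + 1 : ℤ) : ZMod S.n) := cum_succ _ i

theorem ys_succ (i : ℤ) : S.ys (i + 1) = S.ys i + S.sl i * S.len (i : ZMod S.n) := cum_succ _ i

theorem xs_lt_succ (i : ℤ) : S.xs i < S.xs (i + 1) := by
  rw [xs_succ]
  have := S.len_pos (i : ZMod S.n)
  omega

theorem xs_strictMono : StrictMono S.xs := strictMono_int_of_lt_succ S.xs_lt_succ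

theorem sl_mono : Monotone S.sl := monotone_int_of_le_succ fun i => by
  rw [sl_succ]; linarith [S.kink_nonneg ((i + 1 : ℤ) : ZMod S.n)]

theorem vt_succ (i : ℤ) : S.vt (i + 1) = S.vt i + ((S.xs (i + 1) - S.xs i : ℤ) : ℝ) • S.dr i := by
  rw [xs_succ, add_sub_cancel_left, vt, vt, dr, vtx, vtx, dir, ← toReal_smul, ← toReal_add]
  push_cast
  rw [S.edge]

theorem dr_eq_succ (i : ℤ) :
    S.dr i = S.dr (i + 1) + ((S.sl (i + 1) - S.sl i : ℤ) : ℝ) • S.vt (i + 1) := by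
  rw [sl_succ, add_sub_cancel_left, dr, dr, vt, dir, dir, vtx, ← toReal_smul, ← toReal_add]
  push_cast
  rw [← S.e_pred, add_sub_cancel_right]

theorem wedge_vtx_dir (i : ZMod S.n) : wedge (S.vtx i) (S.dir i) = 1 := by
  rw [vtx, dir, wedge_toReal, S.distance_one, Int.cast_one]

theorem wedge_vtx_dir_le (i j : ZMod S.n) : wedge (S.vtx i) (S.dir j) ≤ 1 := by
  rw [vtx, dir, wedge_toReal]; exact_mod_cast S.convex i j

theorem wedge_vt_dr (i : ℤ) : wedge (S.vt i) (S.dr i) = 1 := S.wedge_vtx_dir _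

theorem wedge_vt_succ_dr (i : ℤ) : wedge (S.vt (i + 1)) (S.dr i) = 1 := by
  rw [vt_succ, wedge_add_left, wedge_smul_left, wedge_self, wedge_vt_dr]; ring

/-- The affine functions of which the convex function `F` is the maximum. -/
def G (i : ℤ) (X : ℝ) : ℝ := S.ys i + S.sl i * (X - S.xs i)

theorem G_succ (i : ℤ) (X : ℝ) :
    S.G (i + 1) X = S.G i X + ((S.sl (i + 1) - S.sl i : ℤ) : ℝ) * (X - S.xs (i + 1)) := by
  have h : (S.ys (i + 1) : ℝ) = S.ys i + S.sl i * (S.xs (i + 1) - S.xs i) := by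
    rw [ys_succ, xs_succ]; push_cast; ring
  unfold G
  rw [h]; push_cast; ring

theorem G_sub (i : ℤ) (X X' : ℝ) : S.G i X' = S.G i X + S.sl i * (X' - X) := by
  unfold G; ring

/-- The point with first flat coordinate `X` lies in the closed cell `i`. -/
def InCell (i : ℤ) (X : ℝ) : Prop := S.xs i ≤ X ∧ X ≤ S.xs (i + 1)

theorem G_le {j : ℤ} {X : ℝ} (h : S.InCell j X) (i : ℤ) : S.G i X ≤ S.G j X := by
  rcases le_total j i with hij | hij
  · induction i, hij using Int.leInduction with
    | base => exact le_rfl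
    | succ i hij ih =>
      rw [G_succ]
      have h1 : ((S.sl (i + 1) - S.sl i : ℤ) : ℝ) ≥ 0 := by
        exact_mod_cast sub_nonneg.2 (S.sl_mono (by omega : i ≤ i + 1))
      have h2 : (S.xs (j + 1) : ℝ) ≤ S.xs (i + 1) := by
        exact_mod_cast S.xs_strictMono.monotone (by omega : j + 1 ≤ i + 1)
      have := h.2
      nlinarith
  · induction i, hij using Int.leInductionDown with
    | base => exact le_rfl
    | pred i hij ih =>
      have h0 := S.G_succ (i - 1) X
      rw [sub_add_cancel] at h0
      have h1 : ((S.sl i - S.sl (i - 1) : ℤ) : ℝ) ≥ 0 := by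
        exact_mod_cast sub_nonneg.2 (S.sl_mono (by omega : i - 1 ≤ i))
      have h2 : (S.xs i : ℝ) ≤ S.xs j := by
        exact_mod_cast S.xs_strictMono.monotone hij
      have := h.1
      nlinarith

theorem exists_inCell (X : ℝ) : ∃ i, (S.xs i : ℝ) ≤ X ∧ X < S.xs (i + 1) := by
  have h0 : S.xs 0 = 0 := by simp [xs, cum]
  have hup : ∀ m : ℕ, (m : ℤ) ≤ S.xs m := by
    intro m
    induction m with
    | zero => simp [h0]
    | succ m ih => have := S.xs_lt_succ m; push_cast; omega
  have hdown : ∀ m : ℕ, S.xs (-m) ≤ -(m : ℤ) := by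
    intro m
    induction m with
    | zero => simp [h0]
    | succ m ih =>
      have := S.xs_lt_succ (-(m + 1 : ℕ) : ℤ)
      have h2 : (-((m + 1 : ℕ) : ℤ) + 1) = -(m : ℤ) := by push_cast; ring
      rw [h2] at this
      push_cast at *
      omega
  obtain ⟨m, hm⟩ := exists_nat_ge |X|
  have hX := abs_le.1 hm
  obtain ⟨i, hi, hmax⟩ := Int.exists_greatest_of_bdd (P := fun i => (S.xs i : ℝ) ≤ X)
    ⟨m, fun z hz => by
      by_contra! hc
      have h1 := S.xs_strictMono hc
      have h2 := hup m
      have h3 : ((m : ℤ) : ℝ) < S.xs z := by exact_mod_cast lt_of_le_of_lt h2 h1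
      push_cast at h3
      linarith⟩
    ⟨-(m : ℤ), by
      have h1 : ((S.xs (-m) : ℤ) : ℝ) ≤ ((-(m : ℤ) : ℤ) : ℝ) := by exact_mod_cast hdown m
      push_cast at h1
      linarith⟩
  refine ⟨i, hi, ?_⟩
  by_contra! hc
  have := hmax (i + 1) hc
  omega

/-- A cell that contains the point with first flat coordinate `X`. -/
def idx (X : ℝ) : ℤ := (S.exists_inCell X).choose

theorem inCell_idx (X : ℝ) : S.InCell (S.idx X) X :=
  ⟨(S.exists_inCell X).choose_spec.1, (S.exists_inCell X).choose_spec.2.le⟩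

theorem lt_idx_succ (X : ℝ) : X < S.xs (S.idx X + 1) := (S.exists_inCell X).choose_spec.2

/-- The convex piecewise affine function for which the region `0 ≤ Y + F X` of the plane of flat
coordinates is the developed image of the complement of the interior of `σ₀`, cut open and
continued periodically around `σ₀`. -/
def F (X : ℝ) : ℝ := S.G (S.idx X) X

theorem F_eq {i : ℤ} {X : ℝ} (h : S.InCell i X) : S.F X = S.G i X :=
  le_antisymm (S.G_le h _) (S.G_le (S.inCell_idx X) _)

theorem G_le_F (i : ℤ) (X : ℝ) : S.G i X ≤ S.F X := S.G_le (S.inCell_idx X) i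

/-- The supporting line of `F` at a point of the cell `i`. -/
theorem F_ge {i : ℤ} {X : ℝ} (h : S.InCell i X) (X' : ℝ) :
    S.F X + S.sl i * (X' - X) ≤ S.F X' := by
  rw [S.F_eq h, ← G_sub]
  exact S.G_le_F i X'

/-- The point on the line through the edge `i` with first flat coordinate `X`. -/
def bd (i : ℤ) (X : ℝ) : ℝ × ℝ := S.vt i + (X - S.xs i) • S.dr i

/-- The parametrization of the boundary of `σ₀` by affine length. -/
def bdry (X : ℝ) : ℝ × ℝ := S.bd (S.idx X) X

theorem bd_eq_pred (i : ℤ) (X : ℝ) :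
    S.bd i X = S.vt (i + 1) + (X - S.xs (i + 1)) • S.dr i := by
  rw [vt_succ, bd, add_assoc, ← add_smul]
  congr 2; push_cast; ring

theorem xs_cast_mono {i j : ℤ} (h : i ≤ j) : (S.xs i : ℝ) ≤ S.xs j := by
  exact_mod_cast S.xs_strictMono.monotone h

theorem xs_cast_lt {i j : ℤ} (h : i < j) : (S.xs i : ℝ) < S.xs j := by
  exact_mod_cast S.xs_strictMono h

theorem le_of_xs_lt {i j : ℤ} (h : (S.xs i : ℝ) < S.xs (j + 1)) : i ≤ j := by
  have : S.xs i < S.xs (j + 1) := by exact_mod_cast h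
  have := S.xs_strictMono.lt_iff_lt.1 this
  omega

theorem bdry_eq {i : ℤ} {X : ℝ} (h : S.InCell i X) : S.bdry X = S.bd i X := by
  have h1 := (S.inCell_idx X).1
  have h2 := S.lt_idx_succ X
  have h3 : i ≤ S.idx X := S.le_of_xs_lt (h.1.trans_lt h2)
  rcases h3.lt_or_eq with h4 | h4
  · have h5 : S.idx X = i + 1 := by
      refine le_antisymm ?_ h4
      by_contra! hc
      have := S.xs_cast_lt hc
      linarith [h.2]
    have h6 : X = S.xs (i + 1) := le_antisymm h.2 (by rw [← h5]; exact h1)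
    rw [bdry, h5, S.bd_eq_pred i, h6]
    simp [bd]
  · rw [bdry, ← h4]

/-- The developing map: the point of `B` with the flat coordinates `X`, `Y`, at height
`Y + F X` over `σ₀`. It is meaningful for `0 ≤ Y + F X`. -/
def dev (X Y : ℝ) : ℝ × ℝ := (1 + Y + S.F X) • S.bdry X

/-- The chart `i` in flat coordinates: an integral affine isomorphism. -/
def A (i : ℤ) (X Y : ℝ) : ℝ × ℝ := S.vt i + (X - S.xs i) • S.dr i + (Y + S.G i X) • S.vt i

/-- The linear part of `A i`. -/
def dA (i : ℤ) (a c : ℝ) : ℝ × ℝ := a • S.dr i + (c + S.sl i * a) • S.vt i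

theorem A_add (i : ℤ) (X Y a c τ : ℝ) :
    S.A i (X + τ * a) (Y + τ * c) = S.A i X Y + τ • S.dA i a c := by
  unfold A dA G
  ext <;> simp only [Prod.fst_add, Prod.snd_add, Prod.smul_fst, Prod.smul_snd, smul_eq_mul] <;> ring

theorem wedge_vt_dA (i : ℤ) (a c : ℝ) : wedge (S.vt i) (S.dA i a c) = a := by
  rw [dA, wedge_add_right, wedge_smul_right, wedge_smul_right, wedge_vt_dr, wedge_self]; ring

theorem wedge_dA_dr (i : ℤ) (a c : ℝ) : wedge (S.dA i a c) (S.dr i) = c + S.sl i * a := by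
  rw [dA, wedge_add_left, wedge_smul_left, wedge_smul_left, wedge_vt_dr, wedge_self]; ring

theorem dA_injective {i : ℤ} {a c a' c' : ℝ} (h : S.dA i a c = S.dA i a' c') : a = a' ∧ c = c' := by
  have h1 := congrArg (wedge (S.vt i)) h
  have h2 := congrArg (wedge · (S.dr i)) h
  simp only [wedge_vt_dA, wedge_dA_dr] at h1 h2
  subst h1
  exact ⟨rfl, by linarith⟩

theorem exists_dA_eq (i : ℤ) (u : ℝ × ℝ) : ∃ a c, u = S.dA i a c := by
  refine ⟨wedge (S.vt i) u, wedge u (S.dr i) - S.sl i * wedge (S.vt i) u, ?_⟩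
  rw [dA, sub_add_cancel]
  exact eq_of_wedge_eq_one (S.wedge_vt_dr i) u

theorem exists_dA_eq_int (i : ℤ) (m : ℤ × ℤ) : ∃ a c : ℤ, toReal m = S.dA i a c := by
  refine ⟨wedge (S.v i) m, wedge m (S.e i) - S.sl i * wedge (S.v i) m, ?_⟩
  have := eq_of_wedge_eq_one (S.wedge_vt_dr i) (toReal m)
  simp only [vt, dr, vtx, dir, wedge_toReal] at this
  rw [dA]
  push_cast
  rw [sub_add_cancel]
  exact this

theorem A_eq_A_add (i : ℤ) (X Y X' Y' : ℝ) :
    S.A i X' Y' = S.A i X Y + S.dA i (X' - X) (Y' - Y) := by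
  have := S.A_add i X Y (X' - X) (Y' - Y) 1
  rw [one_smul] at this
  rw [← this]; congr 1 <;> ring

theorem A_injective {i : ℤ} {X Y X' Y' : ℝ} (h : S.A i X Y = S.A i X' Y') : X = X' ∧ Y = Y' := by
  rw [S.A_eq_A_add i X' Y' X Y] at h
  have h1 : S.dA i (X - X') (Y - Y') = S.dA i 0 0 := by
    rw [add_eq_left.1 h]; simp [dA]
  obtain ⟨h2, h3⟩ := S.dA_injective h1
  constructor <;> linarith

theorem inCell_pred_or {i : ℤ} {X : ℝ} (h1 : S.xs (i - 1) ≤ X) (h2 : X ≤ S.xs (i + 1)) :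
    (S.InCell (i - 1) X ∧ X ≤ S.xs i) ∨ (S.InCell i X ∧ S.xs i ≤ X) := by
  rcases le_total X (S.xs i) with h | h
  · exact Or.inl ⟨⟨h1, by rwa [sub_add_cancel]⟩, h⟩
  · exact Or.inr ⟨⟨h, h2⟩, h⟩

theorem bdry_add_smul_vt {i : ℤ} {X : ℝ} (h1 : S.xs (i - 1) ≤ X) (h2 : X ≤ S.xs (i + 1)) (Y : ℝ) :
    S.bdry X + (Y + S.F X) • S.vt i = S.A i X Y := by
  rcases S.inCell_pred_or h1 h2 with ⟨h, -⟩ | ⟨h, -⟩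
  · rw [S.bdry_eq h, S.F_eq h, bd_eq_pred, sub_add_cancel, A]
    have h3 := S.dr_eq_succ (i - 1)
    have h4 := S.G_succ (i - 1) X
    rw [sub_add_cancel] at h3 h4
    rw [h3, h4]
    ext <;> simp only [Prod.fst_add, Prod.snd_add, Prod.smul_fst, Prod.smul_snd, smul_eq_mul] <;>
      ring
  · rw [S.bdry_eq h, S.F_eq h]; rfl

/-! ### The gauge and the charts in flat coordinates -/

theorem le_gauge (x : ℝ × ℝ) (j : ZMod S.n) : wedge x (S.dir j) ≤ S.gauge x :=
  Finset.le_sup' (fun j : ZMod S.n => wedge x (S.dir j)) (Finset.mem_univ j)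

theorem gauge_le {x : ℝ × ℝ} {g : ℝ} (h : ∀ j, wedge x (S.dir j) ≤ g) : S.gauge x ≤ g :=
  Finset.sup'_le _ _ fun j _ => h j

theorem gauge_eq {i : ZMod S.n} {g s : ℝ} (hg : 0 ≤ g) (h0 : 0 ≤ s) (h1 : s ≤ S.len i) :
    S.gauge (g • (S.vtx i + s • S.dir i)) = g := by
  refine le_antisymm (S.gauge_le fun j => ?_) ?_
  · rw [wedge_smul_left]
    refine mul_le_of_le_one_right hg ?_
    have h2 := S.wedge_vtx_dir_le i j
    have h3 := S.wedge_vtx_dir_le (i + 1) j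
    have h4 : S.vtx (i + 1) = S.vtx i + (S.len i : ℝ) • S.dir i := by
      rw [vtx, S.edge, toReal_add, toReal_smul]; simp [vtx, dir]
    rw [h4, wedge_add_left, wedge_smul_left] at h3
    rw [wedge_add_left, wedge_smul_left]
    rcases le_total 0 (wedge (S.dir i) (S.dir j)) with h5 | h5 <;> nlinarith
  · refine le_trans (le_of_eq ?_) (S.le_gauge _ i)
    rw [wedge_smul_left, wedge_add_left, wedge_smul_left, wedge_self, wedge_vtx_dir]
    ring

theorem gauge_smul_bd {i : ℤ} {X g : ℝ} (h : S.InCell i X) (hg : 0 ≤ g) :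
    S.gauge (g • S.bd i X) = g := by
  refine S.gauge_eq hg (sub_nonneg.2 h.1) ?_
  have := h.2
  rw [xs_succ] at this
  push_cast at this
  linarith

theorem gauge_dev {X Y : ℝ} (h : 0 ≤ Y + S.F X) : S.gauge (S.dev X Y) = 1 + (Y + S.F X) := by
  rw [dev, S.bdry_eq (S.inCell_idx X), S.gauge_smul_bd (S.inCell_idx X) (by linarith)]; ring

theorem chart_of_gauge_ge {x : ℝ × ℝ} (i : ZMod S.n) (h : 1 ≤ S.gauge x) :
    S.chart i x = (S.gauge x)⁻¹ • x + (S.gauge x - 1) • S.vtx i := by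
  unfold chart
  split_ifs with h1
  · rw [le_antisymm h1 h]; simp
  · rfl

theorem chart_of_gauge_le {x : ℝ × ℝ} (i : ZMod S.n) (h : S.gauge x ≤ 1) : S.chart i x = x :=
  if_pos h

theorem chart_dev {i : ℤ} {X Y : ℝ} (h1 : S.xs (i - 1) ≤ X) (h2 : X ≤ S.xs (i + 1))
    (hY : 0 ≤ Y + S.F X) : S.chart i (S.dev X Y) = S.A i X Y := by
  rw [S.chart_of_gauge_ge _ (by rw [S.gauge_dev hY]; linarith), S.gauge_dev hY,
    ← S.bdry_add_smul_vt h1 h2, dev, smul_smul, ← add_assoc, inv_mul_cancel₀ (by linarith),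
    one_smul]
  congr 2; ring

/-- The interior of the union of the two cones over the edges at `v i`. -/
def star (i : ZMod S.n) : Set (ℝ × ℝ) :=
  {x | (0 < wedge (S.vtx (i - 1)) x ∧ 0 ≤ wedge x (S.vtx i)) ∨
    (0 ≤ wedge (S.vtx i) x ∧ 0 < wedge x (S.vtx (i + 1)))}

theorem vtx_succ (i : ZMod S.n) : S.vtx (i + 1) = S.vtx i + (S.len i : ℝ) • S.dir i := by
  rw [vtx, S.edge, toReal_add, toReal_smul]; simp [vtx, dir]

theorem len_cast_pos (i : ZMod S.n) : (0 : ℝ) < S.len i := by exact_mod_cast S.len_pos i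

theorem wedge_vtx_vtx_succ (i : ZMod S.n) : wedge (S.vtx i) (S.vtx (i + 1)) = S.len i := by
  rw [vtx_succ, wedge_add_right, wedge_self, wedge_smul_right, wedge_vtx_dir]; ring

theorem continuous_wedge {α : Type*} [TopologicalSpace α] {f g : α → ℝ × ℝ} (hf : Continuous f)
    (hg : Continuous g) : Continuous fun x => wedge (f x) (g x) := by
  unfold wedge; fun_prop

theorem isOpen_star (i : ZMod S.n) : IsOpen (S.star i) := by
  have h1 : 0 < wedge (S.vtx (i - 1)) (S.vtx i) := by
    have := S.wedge_vtx_vtx_succ (i - 1)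
    rw [sub_add_cancel] at this
    rw [this]; exact S.len_cast_pos _
  have h2 : 0 < wedge (S.vtx i) (S.vtx (i + 1)) := by
    rw [wedge_vtx_vtx_succ]; exact S.len_cast_pos _
  have : S.star i = {x | 0 < wedge (S.vtx (i - 1)) x ∧ 0 < wedge x (S.vtx i)} ∪
      {x | 0 < wedge (S.vtx i) x ∧ 0 < wedge x (S.vtx (i + 1))} ∪
      {x | 0 < wedge (S.vtx (i - 1)) x ∧ 0 < wedge x (S.vtx (i + 1))} := by
    ext x
    -- a point on the line through `v i` is a multiple of `v i`
    have hx := wedge_smul_eq (S.vtx i) (S.dir i) x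
    rw [wedge_vtx_dir, one_smul] at hx
    have e1 := congrArg (wedge (S.vtx (i - 1))) hx
    have e2 := congrArg (wedge · (S.vtx (i + 1))) hx
    simp only [wedge_add_left, wedge_add_right, wedge_smul_left, wedge_smul_right] at e1 e2
    simp only [star, mem_ofPred_eq, mem_union]
    rw [wedge_swap x (S.vtx i)]
    generalize wedge (S.vtx (i - 1)) x = p at *
    generalize wedge x (S.vtx (i + 1)) = q at *
    generalize wedge (S.vtx i) x = r at *
    generalize wedge x (S.dir i) = t at *
    generalize wedge (S.vtx (i - 1)) (S.vtx i) = y at *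
    generalize wedge (S.vtx i) (S.vtx (i + 1)) = z at *
    have h3 : r = 0 → (0 < p ↔ 0 < t) := by
      rintro rfl
      rw [zero_mul, zero_add] at e1
      rw [e1]; exact mul_pos_iff_of_pos_right h1
    have h4 : r = 0 → (0 < q ↔ 0 < t) := by
      rintro rfl
      rw [zero_mul, zero_add] at e2
      rw [e2]; exact mul_pos_iff_of_pos_right h2
    constructor
    · rintro (⟨a, b⟩ | ⟨a, b⟩)
      · rcases b.lt_or_eq with b | b
        · exact Or.inl (Or.inl ⟨a, b⟩)
        · have : r = 0 := by linarith
          exact Or.inr ⟨a, (h4 this).2 ((h3 this).1 a)⟩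
      · rcases a.lt_or_eq with a | a
        · exact Or.inl (Or.inr ⟨a, b⟩)
        · exact Or.inr ⟨(h3 a.symm).2 ((h4 a.symm).1 b), b⟩
    · rintro ((⟨a, b⟩ | ⟨a, b⟩) | ⟨a, b⟩)
      · exact Or.inl ⟨a, b.le⟩
      · exact Or.inr ⟨a.le, b⟩
      · rcases le_total 0 r with hr | hr
        · exact Or.inr ⟨hr, b⟩
        · exact Or.inl ⟨a, by linarith⟩
  rw [this]
  have c : ∀ (v : ℝ × ℝ), IsOpen {x | 0 < wedge v x} := fun v =>
    isOpen_lt continuous_const (continuous_wedge continuous_const continuous_id)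
  have c' : ∀ (v : ℝ × ℝ), IsOpen {x | 0 < wedge x v} := fun v =>
    isOpen_lt continuous_const (continuous_wedge continuous_id continuous_const)
  exact (((c _).inter (c' _)).union ((c _).inter (c' _))).union ((c _).inter (c' _))

/-- The coordinates of a point of the cone over an edge. -/
theorem exists_of_mem_cone {i : ZMod S.n} {x : ℝ × ℝ} (h1 : 0 ≤ wedge (S.vtx i) x)
    (h2 : 0 ≤ wedge x (S.vtx (i + 1))) (h : 0 < wedge (S.vtx i) x + wedge x (S.vtx (i + 1))) :
    ∃ g s : ℝ, 0 < g ∧ 0 ≤ s ∧ s ≤ S.len i ∧ x = g • (S.vtx i + s • S.dir i) ∧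
      wedge (S.vtx i) x = g * s ∧ wedge x (S.vtx (i + 1)) = g * (S.len i - s) := by
  have hx := eq_of_wedge_eq_one (S.wedge_vtx_dir i) x
  have hl := S.len_cast_pos i
  obtain ⟨g, hg⟩ : ∃ g, g = wedge x (S.dir i) := ⟨_, rfl⟩
  obtain ⟨a, ha⟩ : ∃ a, a = wedge (S.vtx i) x := ⟨_, rfl⟩
  have e2 : wedge x (S.vtx (i + 1)) = g * S.len i - a := by
    rw [vtx_succ, wedge_add_right, wedge_smul_right, ← hg, wedge_swap, ← ha]; ring
  rw [← ha, e2] at h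
  rw [← ha] at h1
  rw [e2] at h2
  have hg0 : 0 < g := by
    by_contra! hc; nlinarith
  have hs : g * (a / g) = a := by field_simp
  refine ⟨g, a / g, hg0, by positivity, ?_, ?_, ?_, ?_⟩
  · rw [div_le_iff₀ hg0]; linarith
  · rw [smul_add, smul_smul, hs]
    conv_lhs => rw [hx, ← hg, ← ha, add_comm]
  · rw [hs, ha]
  · rw [e2, mul_sub, hs]

theorem wedge_bd (i : ℤ) (X X' : ℝ) : wedge (S.bd i X) (S.bd i X') = X' - X := by
  have : wedge (S.dr i) (S.vt i) = -1 := by rw [wedge_swap, wedge_vt_dr]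
  simp only [bd, wedge_add_left, wedge_add_right, wedge_smul_left, wedge_smul_right, wedge_self,
    wedge_vt_dr, this]
  ring

theorem bd_xs (i : ℤ) : S.bd i (S.xs i) = S.vt i := by simp [bd]

theorem bd_xs_succ (i : ℤ) : S.bd i (S.xs (i + 1)) = S.vt (i + 1) := by simp [bd_eq_pred]

/-- The point with first flat coordinate `X` lies in the interior of the union of the two cells
at the vertex `i`. -/
def Win (i : ℤ) (X : ℝ) : Prop := S.xs (i - 1) < X ∧ X < S.xs (i + 1)

theorem dev_mem_star {i : ℤ} {X Y : ℝ} (h : S.Win i X) (hY : 0 ≤ Y + S.F X) :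
    S.dev X Y ∈ S.star i := by
  have e1 : S.vtx (((i : ℤ) : ZMod S.n) - 1) = S.vt (i - 1) := by rw [vt]; push_cast; rfl
  have e2 : S.vtx (((i : ℤ) : ZMod S.n) + 1) = S.vt (i + 1) := by rw [vt]; push_cast; rfl
  have e3 : S.vtx ((i : ℤ) : ZMod S.n) = S.vt i := rfl
  have hp : 0 < 1 + Y + S.F X := by linarith
  simp only [star, mem_ofPred_eq, e1, e2, e3]
  rcases S.inCell_pred_or h.1.le h.2.le with ⟨hc, hX⟩ | ⟨hc, hX⟩
  · left
    rw [dev, S.bdry_eq hc, wedge_smul_right, wedge_smul_left, ← S.bd_xs (i - 1)]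
    have := S.bd_xs_succ (i - 1)
    rw [sub_add_cancel] at this
    rw [← this, wedge_bd, wedge_bd]
    exact ⟨mul_pos hp (sub_pos.2 h.1), mul_nonneg hp.le (sub_nonneg.2 hX)⟩
  · right
    rw [dev, S.bdry_eq hc, wedge_smul_right, wedge_smul_left, ← S.bd_xs_succ i, ← S.bd_xs i,
      wedge_bd, wedge_bd]
    exact ⟨mul_nonneg hp.le (sub_nonneg.2 hX), mul_pos hp (sub_pos.2 h.2)⟩

theorem exists_dev_of_mem_star {i : ℤ} {x : ℝ × ℝ} (hx : x ∈ S.star i) (hg : 1 ≤ S.gauge x) :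
    ∃ X Y, S.Win i X ∧ 0 ≤ Y + S.F X ∧ x = S.dev X Y := by
  -- a point of the closed cone over the edge `j` in polar form
  have key : ∀ (j : ℤ) (g s : ℝ), 0 < g → 0 ≤ s → s ≤ S.len (j : ZMod S.n) →
      x = g • (S.vtx (j : ZMod S.n) + s • S.dir (j : ZMod S.n)) →
      0 ≤ (g - 1 - S.F (S.xs j + s)) + S.F (S.xs j + s) ∧
        x = S.dev (S.xs j + s) (g - 1 - S.F (S.xs j + s)) := by
    intro j g s h0 h1 h2 h3
    have hc : S.InCell j (S.xs j + s) := ⟨by linarith, by rw [xs_succ]; push_cast; linarith⟩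
    have h4 := S.gauge_eq h0.le h1 h2
    rw [← h3] at h4
    refine ⟨by linarith, ?_⟩
    rw [dev, S.bdry_eq hc, h3, bd]
    congr 1
    · ring
    · rw [add_sub_cancel_left]; rfl
  rcases hx with ⟨h1, h2⟩ | ⟨h1, h2⟩
  · have e1 : ((i : ℤ) : ZMod S.n) - 1 = ((i - 1 : ℤ) : ZMod S.n) := by push_cast; rfl
    have e2 : ((i : ℤ) : ZMod S.n) = ((i - 1 : ℤ) : ZMod S.n) + 1 := by push_cast; ring
    rw [e1] at h1
    rw [e2] at h2
    obtain ⟨g, s, h3, h4, h5, h6, h7, -⟩ := S.exists_of_mem_cone h1.le h2 (by linarith)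
    obtain ⟨k1, k2⟩ := key (i - 1) g s h3 h4 h5 h6
    refine ⟨_, _, ⟨?_, ?_⟩, k1, k2⟩
    · rw [h7] at h1
      have := pos_of_mul_pos_right h1 h3.le
      linarith
    · have h8 := S.xs_succ (i - 1)
      have h9 := S.xs_cast_lt (lt_add_one i)
      rw [sub_add_cancel] at h8
      rw [h8] at h9
      push_cast at h9
      push_cast at h5 ⊢
      linarith
  · obtain ⟨g, s, h3, h4, h5, h6, -, h7⟩ := S.exists_of_mem_cone h1 h2.le (by linarith)
    obtain ⟨k1, k2⟩ := key i g s h3 h4 h5 h6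
    refine ⟨_, _, ⟨?_, ?_⟩, k1, k2⟩
    · have := S.xs_cast_lt (sub_one_lt i)
      linarith
    · rw [h7] at h2
      have := pos_of_mul_pos_right h2 h3.le
      rw [xs_succ]; push_cast; linarith

theorem bd_eq (i : ℤ) (X : ℝ) :
    S.bd i X = S.vtx (i : ZMod S.n) + (X - S.xs i) • S.dir (i : ZMod S.n) :=
  rfl

/-- Flat coordinates of the same point are in corresponding cells. -/
theorem cell_unique {m i : ℤ} {X X' Y Y' : ℝ} (hY : 0 ≤ Y + S.F X) (hY' : 0 ≤ Y' + S.F X')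
    (h : S.dev X Y = S.dev X' Y') (h1 : S.xs m ≤ X) (h2 : X < S.xs (m + 1)) (h3 : S.xs i ≤ X')
    (h4 : X' < S.xs (i + 1)) : (m : ZMod S.n) = i ∧ X - S.xs m = X' - S.xs i := by
  have hg := congrArg S.gauge h
  rw [S.gauge_dev hY, S.gauge_dev hY'] at hg
  rw [dev, dev, S.bdry_eq ⟨h1, h2.le⟩, S.bdry_eq ⟨h3, h4.le⟩] at h
  have h5 : S.bd m X = S.bd i X' := by
    rw [show 1 + Y + S.F X = 1 + Y' + S.F X' by linarith] at h
    exact smul_right_injective _ (by linarith : 1 + Y' + S.F X' ≠ 0) h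
  rw [xs_succ] at h2 h4
  push_cast at h2 h4
  have h6 : (m : ZMod S.n) = i := S.edge_unique (sub_nonneg.2 h1) (by linarith)
    (sub_nonneg.2 h3) (by linarith) h5
  refine ⟨h6, ?_⟩
  rw [bd_eq, bd_eq, h6] at h5
  have h7 := congrArg (wedge (S.vtx (i : ZMod S.n))) (add_left_cancel h5)
  rwa [wedge_smul_right, wedge_smul_right, wedge_vtx_dir, mul_one, mul_one] at h7

theorem exists_win_of_mem_star {i : ZMod S.n} {X Y : ℝ} (hY : 0 ≤ Y + S.F X)
    (h : S.dev X Y ∈ S.star i) : ∃ j : ℤ, (j : ZMod S.n) = i ∧ S.Win j X := by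
  obtain ⟨i', rfl⟩ := ZMod.intCast_surjective i
  obtain ⟨X', Y', hw, hY', he⟩ := S.exists_dev_of_mem_star h (by rw [S.gauge_dev hY]; linarith)
  obtain ⟨m, hm1, hm2⟩ := S.exists_inCell X
  obtain ⟨m', hm1', hm2'⟩ := S.exists_inCell X'
  obtain ⟨hmm, hX⟩ := S.cell_unique hY hY' he hm1 hm2 hm1' hm2'
  have a1 : m' ≤ i' := S.le_of_xs_lt (hm1'.trans_lt hw.2)
  have a2 : i' - 1 ≤ m' := S.le_of_xs_lt (hw.1.trans hm2')
  rcases a1.lt_or_eq with a3 | a3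
  · obtain rfl : m' = i' - 1 := by omega
    refine ⟨m + 1, by push_cast at hmm ⊢; rw [hmm]; ring, ?_, ?_⟩
    · rw [add_sub_cancel_right]
      have := hw.1
      linarith
    · exact hm2.trans (S.xs_cast_lt (lt_add_one _))
  · subst a3
    exact ⟨m, hmm, (S.xs_cast_lt (sub_one_lt m)).trans_le hm1, hm2⟩

/-- The first flat coordinate of the singularity on the edge `i`. -/
def sg (i : ℤ) : ℝ := S.xs i + S.pos (i : ZMod S.n) * S.len (i : ZMod S.n)

theorem xs_lt_sg (i : ℤ) : S.xs i < S.sg i := by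
  have := mul_pos (S.pos_mem (i : ZMod S.n)).1 (S.len_cast_pos i)
  unfold sg; linarith

theorem sg_lt_xs (i : ℤ) : S.sg i < S.xs (i + 1) := by
  have := mul_lt_of_lt_one_left (S.len_cast_pos i) (S.pos_mem (i : ZMod S.n)).2
  rw [sg, xs_succ]; push_cast; linarith

theorem sing_eq (i : ℤ) : S.sing (i : ZMod S.n) = S.bd i (S.sg i) := by
  rw [bd_eq, sg, add_sub_cancel_left]; rfl

theorem inCell_sg (i : ℤ) : S.InCell i (S.sg i) := ⟨(S.xs_lt_sg i).le, (S.sg_lt_xs i).le⟩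

theorem dev_neg_F (X : ℝ) : S.dev X (-S.F X) = S.bdry X := by
  rw [dev, neg_add_cancel_right, one_smul]

theorem dev_eq_bdry {X Y : ℝ} (h : Y + S.F X = 0) : S.dev X Y = S.bdry X := by
  rw [dev, add_assoc, h, add_zero, one_smul]

theorem sing_eq_dev (i : ℤ) : S.sing (i : ZMod S.n) = S.dev (S.sg i) (-S.F (S.sg i)) := by
  rw [dev_neg_F, S.bdry_eq (S.inCell_sg i), sing_eq]

theorem sing_mem_star (i : ZMod S.n) : S.sing i ∈ S.star i := by
  obtain ⟨i', rfl⟩ := ZMod.intCast_surjective i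
  rw [sing_eq_dev]
  refine S.dev_mem_star ⟨?_, S.sg_lt_xs i'⟩ (by linarith)
  exact (S.xs_cast_lt (sub_one_lt i')).trans (S.xs_lt_sg i')

theorem wedge_vt_pred (i : ℤ) (X : ℝ) : wedge (S.vt i) (S.bd (i - 1) X) = X - S.xs i := by
  have := S.bd_xs_succ (i - 1)
  rw [sub_add_cancel] at this
  rw [← this, wedge_bd]

/-- On the boundary of `σ₀` the chart `i` is used between the two singularities next to `v i`. -/
theorem mem_chartDomain_boundary {j : ℤ} {X Y : ℝ} (hw : S.Win j X) (hY : Y + S.F X = 0) :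
    S.dev X Y ∈ S.chartDomain j ↔ S.sg (j - 1) < X ∧ X < S.sg j := by
  have hg : S.gauge (S.dev X Y) = 1 := by rw [S.gauge_dev hY.ge, hY, add_zero]
  have e1 : S.sing (((j : ℤ) : ZMod S.n) - 1) = S.bd (j - 1) (S.sg (j - 1)) := by
    rw [← sing_eq]; push_cast; rfl
  have e3 : S.vtx ((j : ℤ) : ZMod S.n) = S.vt j := rfl
  simp only [chartDomain, mem_ofPred_eq, hg, lt_irrefl, false_and, false_or, true_and, e1, e3,
    sing_eq]
  rw [S.dev_eq_bdry hY, wedge_swap _ (S.vt j)]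
  have hs := S.xs_lt_sg j
  have hs' := S.sg_lt_xs (j - 1)
  rw [sub_add_cancel] at hs'
  rcases le_or_gt (S.xs j : ℝ) X with h | h
  · rw [S.bdry_eq ⟨h, hw.2.le⟩, wedge_bd]
    have : wedge (S.vt j) (S.bd j X) = X - S.xs j := by rw [← S.bd_xs, wedge_bd]
    rw [this]
    constructor
    · rintro (⟨h1, h2⟩ | ⟨h1, h2⟩)
      · constructor <;> linarith
      · constructor <;> linarith
    · rintro ⟨h1, h2⟩
      right; constructor <;> linarith
  · have hc : S.InCell (j - 1) X := ⟨hw.1.le, by rw [sub_add_cancel]; exact h.le⟩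
    rw [S.bdry_eq hc, wedge_bd, wedge_vt_pred]
    constructor
    · rintro (⟨h1, h2⟩ | ⟨h1, h2⟩)
      · constructor <;> linarith
      · exfalso; linarith
    · rintro ⟨h1, h2⟩
      left; constructor <;> linarith

theorem chartDomain_subset_star {i : ZMod S.n} {x : ℝ × ℝ} (h : x ∈ S.chartDomain i)
    (hg : 1 ≤ S.gauge x) : x ∈ S.star i := by
  rcases h with h | ⟨-, h⟩ | ⟨h1, h⟩
  · exact absurd h hg.not_gt
  · exact h
  · -- a linear condition that holds at `sing i` and `v i` holds in between
    have hi : ∀ j : ZMod S.n, S.sing j = (1 - S.pos j) • S.vtx j + S.pos j • S.vtx (j + 1) := by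
      intro j
      rw [sing, vtx_succ]
      module
    have hp := fun j => S.pos_mem j
    rcases h with ⟨h2, h3⟩ | ⟨h2, h3⟩
    · left
      refine ⟨?_, h3⟩
      rw [hi, sub_add_cancel, wedge_add_left, wedge_smul_left, wedge_smul_left,
        wedge_swap (S.vtx i)] at h2
      have := hp (i - 1)
      by_contra! hc
      nlinarith [this.1, this.2, mul_nonneg this.1.le h3]
    · right
      refine ⟨h2, ?_⟩
      rw [hi, wedge_add_right, wedge_smul_right, wedge_smul_right, wedge_swap _ (S.vtx i)] at h3
      have := hp i
      by_contra! hc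
      nlinarith [this.1, this.2, mul_nonneg (sub_nonneg.2 this.2.le) h2]

end DualComplex

namespace DualComplex

variable (S : DualComplex)

/-! ### Straight paths in flat coordinates -/

theorem win_idx (X : ℝ) : S.Win (S.idx X) X :=
  ⟨(S.xs_cast_lt (sub_one_lt _)).trans_le (S.inCell_idx X).1, S.lt_idx_succ X⟩

theorem isOpen_win (j : ℤ) : IsOpen {X | S.Win j X} :=
  (isOpen_lt continuous_const continuous_id).inter (isOpen_lt continuous_id continuous_const)

theorem F_eq_max {j : ℤ} {X : ℝ} (h : S.Win j X) : S.F X = max (S.G (j - 1) X) (S.G j X) := by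
  refine le_antisymm ?_ (max_le (S.G_le_F _ _) (S.G_le_F _ _))
  rcases S.inCell_pred_or h.1.le h.2.le with ⟨hc, -⟩ | ⟨hc, -⟩
  · rw [S.F_eq hc]; exact le_max_left _ _
  · rw [S.F_eq hc]; exact le_max_right _ _

theorem continuous_G (j : ℤ) : Continuous (S.G j) := by unfold G; fun_prop

theorem continuous_F : Continuous S.F := by
  rw [continuous_iff_continuousAt]
  intro X
  have h : ∀ᶠ X' in 𝓝 X, max (S.G (S.idx X - 1) X') (S.G (S.idx X) X') = S.F X' :=
    ((S.isOpen_win _).eventually_mem (S.win_idx X)).mono fun X' h => (S.F_eq_max h).symm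
  exact ((S.continuous_G _).max (S.continuous_G _)).continuousAt.congr h

theorem continuous_A (j : ℤ) : Continuous fun p : ℝ × ℝ => S.A j p.1 p.2 := by
  unfold A G; fun_prop

theorem continuous_bdry : Continuous S.bdry := by
  rw [continuous_iff_continuousAt]
  intro X
  have h : ∀ᶠ X' in 𝓝 X, S.A (S.idx X) X' 0 - (0 + S.F X') • S.vt (S.idx X) = S.bdry X' :=
    ((S.isOpen_win _).eventually_mem (S.win_idx X)).mono fun X' h => by
      rw [← S.bdry_add_smul_vt h.1.le h.2.le, add_sub_cancel_right]
  refine ContinuousAt.congr (Continuous.continuousAt ?_) h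
  exact ((S.continuous_A _).comp (continuous_id.prodMk continuous_const)).sub
    ((continuous_const.add S.continuous_F).smul continuous_const)

theorem continuous_dev : Continuous fun p : ℝ × ℝ => S.dev p.1 p.2 := by
  unfold dev
  exact ((continuous_const.add continuous_snd).add (S.continuous_F.comp continuous_fst)).smul
    (S.continuous_bdry.comp continuous_fst)

theorem continuous_gauge : Continuous S.gauge := by
  unfold gauge
  exact Continuous.finset_sup'_apply _ fun j _ => continuous_wedge continuous_id continuous_const

/-- The chart `j` is injective on its domain. -/
theorem eq_dev_of_chart_eq {j : ℤ} {x : ℝ × ℝ} {X Y : ℝ} (hx : 1 ≤ S.gauge x → x ∈ S.star j)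
    (hw : S.Win j X) (hY : 0 ≤ Y + S.F X) (h : S.chart j x = S.A j X Y) : x = S.dev X Y := by
  rcases le_or_gt 1 (S.gauge x) with hg | hg
  · obtain ⟨X', Y', hw', hY', rfl⟩ := S.exists_dev_of_mem_star (hx hg) hg
    rw [S.chart_dev hw'.1.le hw'.2.le hY'] at h
    obtain ⟨rfl, rfl⟩ := S.A_injective h
    rfl
  · exfalso
    rw [S.chart_of_gauge_le _ hg.le, ← S.bdry_add_smul_vt hw.1.le hw.2.le] at h
    have hbd : ∀ (i : ℤ) (X : ℝ), wedge (S.bd i X) (S.dr i) = 1 := fun i X => by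
      rw [bd, wedge_add_left, wedge_smul_left, wedge_self, wedge_vt_dr]; ring
    rcases S.inCell_pred_or hw.1.le hw.2.le with ⟨hc, -⟩ | ⟨hc, -⟩
    · have := S.le_gauge x ((j - 1 : ℤ) : ZMod S.n)
      change wedge x (S.dr (j - 1)) ≤ _ at this
      have h2 := S.wedge_vt_succ_dr (j - 1)
      rw [sub_add_cancel] at h2
      rw [h, S.bdry_eq hc, wedge_add_left, hbd, wedge_smul_left, h2, ← S.bdry_eq hc, ← h] at this
      linarith
    · have := S.le_gauge x ((j : ℤ) : ZMod S.n)
      change wedge x (S.dr j) ≤ _ at this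
      rw [h, S.bdry_eq hc, wedge_add_left, hbd, wedge_smul_left, wedge_vt_dr, ← S.bdry_eq hc,
        ← h] at this
      linarith

variable {S}

theorem HasVelocity.mem_star {γ : ℝ → ℝ × ℝ} {I : Set ℝ} {t : ℝ} {i : ZMod S.n} {c : ℝ × ℝ}
    (h : S.HasVelocity γ I t i c) (hg : 1 ≤ S.gauge (γ t)) : γ t ∈ S.star i := by
  rcases h.1 with h | ⟨h, -⟩
  · exact S.chartDomain_subset_star h hg
  · rw [h]; exact S.sing_mem_star i

theorem HasVelocity.mono {γ : ℝ → ℝ × ℝ} {I J : Set ℝ} {t : ℝ} {i : ZMod S.n} {c : ℝ × ℝ}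
    (h : S.HasVelocity γ I t i c) (hJ : J ⊆ I) : S.HasVelocity γ J t i c :=
  ⟨h.1, h.2.filter_mono (nhdsWithin_mono _ hJ)⟩

theorem continuous_line (X Y a c t : ℝ) :
    Continuous fun s : ℝ => (X + (s - t) * a, Y + (s - t) * c) := by fun_prop

theorem continuous_height (X Y a c t : ℝ) :
    Continuous fun s : ℝ => Y + (s - t) * c + S.F (X + (s - t) * a) :=
  (by fun_prop : Continuous fun s : ℝ => Y + (s - t) * c).add
    (S.continuous_F.comp (by fun_prop))

/-- Near a point outside the interior of `σ₀`, a straight path is affine in flat coordinates, as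
long as it does not enter the interior of `σ₀`. -/
theorem HasVelocity.germ {γ : ℝ → ℝ × ℝ} {I : Set ℝ} {t : ℝ} {j : ℤ} {u : ℝ × ℝ}
    {X Y a c : ℝ} (hv : S.HasVelocity γ I t j u) (hc : ContinuousWithinAt γ I t)
    (hw : S.Win j X) (hY : 0 ≤ Y + S.F X) (hx : γ t = S.dev X Y) (hu : u = S.dA j a c) :
    ∀ᶠ s in 𝓝[I] t, (1 ≤ S.gauge (γ s) ∨ 0 ≤ Y + (s - t) * c + S.F (X + (s - t) * a)) →
      γ s = S.dev (X + (s - t) * a) (Y + (s - t) * c) ∧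
        0 ≤ Y + (s - t) * c + S.F (X + (s - t) * a) := by
  have hg : 1 ≤ S.gauge (γ t) := by rw [hx, S.gauge_dev hY]; linarith
  have h1 : ∀ᶠ s in 𝓝[I] t, γ s ∈ S.star j :=
    hc.eventually ((S.isOpen_star j).eventually_mem (hv.mem_star hg))
  have h2 : ∀ᶠ s in 𝓝[I] t, S.Win j (X + (s - t) * a) := by
    have : Tendsto (fun s => X + (s - t) * a) (𝓝[I] t) (𝓝 X) := by
      have h3 : Continuous fun s => X + (s - t) * a := by fun_prop
      have := (h3.tendsto t).mono_left (nhdsWithin_le_nhds (s := I))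
      simpa using this
    exact this.eventually ((S.isOpen_win j).eventually_mem hw)
  filter_upwards [h1, h2, hv.2] with s h1 h2 h3 h4
  rw [hx, S.chart_dev hw.1.le hw.2.le hY, hu, ← A_add] at h3
  rcases h4 with h4 | h4
  · obtain ⟨X', Y', hw', hY', he⟩ := S.exists_dev_of_mem_star h1 h4
    rw [he, S.chart_dev hw'.1.le hw'.2.le hY'] at h3
    obtain ⟨rfl, rfl⟩ := S.A_injective h3
    exact ⟨he, hY'⟩
  · exact ⟨S.eq_dev_of_chart_eq (fun _ => h1) h2 h4 h3, h4⟩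

/-- A path that is straight in flat coordinates near `t` has the corresponding velocity. -/
theorem eq_dA_of_dev {γ : ℝ → ℝ × ℝ} {I : Set ℝ} {t : ℝ} {j : ℤ} {u : ℝ × ℝ}
    {X Y a c : ℝ} (hv : ∀ᶠ s in 𝓝[I] t, S.chart j (γ s) = S.chart j (γ t) + (s - t) • u)
    (hw : S.Win j X) (hY : 0 ≤ Y + S.F X) (hx : γ t = S.dev X Y)
    (h : ∃ᶠ s in 𝓝[I] t, s ≠ t ∧ γ s = S.dev (X + (s - t) * a) (Y + (s - t) * c) ∧
        0 ≤ Y + (s - t) * c + S.F (X + (s - t) * a)) :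
    u = S.dA j a c := by
  have h2 : ∀ᶠ s in 𝓝[I] t, S.Win j (X + (s - t) * a) := by
    have : Tendsto (fun s => X + (s - t) * a) (𝓝[I] t) (𝓝 X) := by
      have h3 : Continuous fun s => X + (s - t) * a := by fun_prop
      have := (h3.tendsto t).mono_left (nhdsWithin_le_nhds (s := I))
      simpa using this
    exact this.eventually ((S.isOpen_win j).eventually_mem hw)
  obtain ⟨s, ⟨hs, he, hp⟩, h2, h3⟩ := (h.and_eventually (h2.and hv)).exists
  rw [he, hx, S.chart_dev hw.1.le hw.2.le hY, S.chart_dev h2.1.le h2.2.le hp, A_add] at h3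
  exact (smul_right_injective _ (sub_ne_zero.2 hs) (add_left_cancel h3)).symm

theorem IsStraight.continuousWithinAt {γ : ℝ → ℝ × ℝ} {I : Set ℝ} {w : ℕ}
    (h : S.IsStraight γ I w) {t : ℝ} (ht : t ∈ I) : ContinuousWithinAt γ I t := h.1 t ht

theorem IsStraight.mono {γ : ℝ → ℝ × ℝ} {I J : Set ℝ} {w : ℕ}
    (h : S.IsStraight γ I w) (hJ : J ⊆ I) : S.IsStraight γ J w :=
  ⟨h.1.mono hJ, fun t ht => by
    obtain ⟨i, m, hm, hv⟩ := h.2 t (hJ ht)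
    exact ⟨i, m, hm, hv.mono hJ⟩⟩

/-- The vertex `j` of the flat picture that belongs to a chart in which the velocity at a point with
given flat coordinates is described. -/
theorem HasVelocity.exists_win {γ : ℝ → ℝ × ℝ} {I : Set ℝ} {t : ℝ} {i : ZMod S.n} {u : ℝ × ℝ}
    {X Y : ℝ} (hv : S.HasVelocity γ I t i u) (hY : 0 ≤ Y + S.F X) (hx : γ t = S.dev X Y) :
    ∃ j : ℤ, (j : ZMod S.n) = i ∧ S.Win j X := by
  have h := hv.mem_star (by rw [hx, S.gauge_dev hY]; linarith)
  rw [hx] at h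
  exact S.exists_win_of_mem_star hY h

/-- A straight path is affine in flat coordinates, as long as it stays outside the
interior of `σ₀`. -/
theorem IsStraight.lift {γ : ℝ → ℝ × ℝ} {I : Set ℝ} {w : ℕ} (hs : S.IsStraight γ I w)
    {t₀ t₁ : ℝ} (hI : Icc t₀ t₁ ⊆ I) {j : ℤ} {u : ℝ × ℝ} {X Y a c : ℝ}
    (hv : S.HasVelocity γ I t₀ j u) (hw : S.Win j X) (hY : 0 ≤ Y + S.F X) (hx : γ t₀ = S.dev X Y)
    (hu : u = S.dA j a c)
    (hpos : ∀ s ∈ Icc t₀ t₁, 1 ≤ S.gauge (γ s) ∨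
      0 ≤ Y + (s - t₀) * c + S.F (X + (s - t₀) * a)) :
    ∀ s ∈ Icc t₀ t₁, γ s = S.dev (X + (s - t₀) * a) (Y + (s - t₀) * c) ∧
        0 ≤ Y + (s - t₀) * c + S.F (X + (s - t₀) * a) := by
  by_contra hcon
  push Not at hcon
  obtain ⟨b, hb, hbP⟩ := hcon
  set P : ℝ → Prop := fun s => γ s = S.dev (X + (s - t₀) * a) (Y + (s - t₀) * c) ∧
        0 ≤ Y + (s - t₀) * c + S.F (X + (s - t₀) * a) with hP
  have h0 : P t₀ := by simp only [hP, sub_self, zero_mul, add_zero]; exact ⟨hx, hY⟩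
  set B := {s | s ∈ Icc t₀ t₁ ∧ ¬ P s} with hB
  have hbB : b ∈ B := ⟨hb, fun h => absurd h.2 (not_le.2 (hbP h.1))⟩
  have hBbdd : BddBelow B := ⟨t₀, fun s hs => hs.1.1⟩
  set x := sInf B with hxdef
  have hx0 : t₀ ≤ x := le_csInf ⟨b, hbB⟩ fun s hs => hs.1.1
  have hx1 : x ≤ t₁ := (csInf_le hBbdd hbB).trans hb.2
  have hxI : x ∈ I := hI ⟨hx0, hx1⟩
  have hlt : ∀ s, t₀ ≤ s → s < x → P s := by
    intro s h1 h2
    by_contra h3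
    exact absurd (csInf_le hBbdd ⟨⟨h1, h2.le.trans hx1⟩, h3⟩) (not_le.2 h2)
  have hdev : Continuous fun s : ℝ => S.dev (X + (s - t₀) * a) (Y + (s - t₀) * c) :=
    S.continuous_dev.comp (continuous_line X Y a c t₀)
  -- the property passes to the limit
  have hPx : P x := by
    rcases hx0.lt_or_eq with h | h
    · have hne : (𝓝[Ico t₀ x] x).NeBot := by
        rw [nhdsWithin_Ico_eq_nhdsLT h]; infer_instance
      have hmem : ∀ᶠ s in 𝓝[Ico t₀ x] x, P s :=
        eventually_nhdsWithin_of_forall fun s hs => hlt s hs.1 hs.2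
      constructor
      · have hsub : Ico t₀ x ⊆ I := fun s hs => hI ⟨hs.1, hs.2.le.trans hx1⟩
        refine tendsto_nhds_unique_of_eventuallyEq
          (((hs.continuousWithinAt hxI).mono hsub).tendsto)
          ((hdev.tendsto x).mono_left nhdsWithin_le_nhds) (hmem.mono fun s h => h.1)
      · exact ge_of_tendsto (((continuous_height X Y a c t₀).tendsto x).mono_left
          nhdsWithin_le_nhds) (hmem.mono fun s h => h.2)
    · rw [← h]; exact h0
  -- and it persists after `x`
  have hright : ∀ᶠ s in 𝓝[I] x, s ∈ Icc t₀ t₁ → P s := by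
    rcases hx0.lt_or_eq with h | h
    · obtain ⟨i', m, -, hv'⟩ := hs.2 x hxI
      obtain ⟨j', rfl, hw'⟩ := hv'.exists_win hPx.2 hPx.1
      obtain ⟨a', c', hu'⟩ := S.exists_dA_eq j' ((w : ℝ) • toReal m)
      have hac : (w : ℝ) • toReal m = S.dA j' a c := by
        refine eq_dA_of_dev hv'.2 hw' hPx.2 hPx.1 ?_
        have hne : (𝓝[Ico t₀ x] x).NeBot := by
          rw [nhdsWithin_Ico_eq_nhdsLT h]; infer_instance
        have hsub : Ico t₀ x ⊆ I := fun s hs => hI ⟨hs.1, hs.2.le.trans hx1⟩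
        have hev : ∀ᶠ s in 𝓝[Ico t₀ x] x, s ≠ x ∧ P s :=
          eventually_nhdsWithin_of_forall fun s hs => ⟨hs.2.ne, hlt s hs.1 hs.2⟩
        refine (hev.frequently.filter_mono (nhdsWithin_mono _ hsub)).mono fun s hs => ?_
        have e1 : X + (x - t₀) * a + (s - x) * a = X + (s - t₀) * a := by ring
        have e2 : Y + (x - t₀) * c + (s - x) * c = Y + (s - t₀) * c := by ring
        rw [e1, e2]
        exact hs
      have hg := hv'.germ (hs.continuousWithinAt hxI) hw' hPx.2 hPx.1 hac
      filter_upwards [hg] with s hs hsI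
      have e1 : X + (x - t₀) * a + (s - x) * a = X + (s - t₀) * a := by ring
      have e2 : Y + (x - t₀) * c + (s - x) * c = Y + (s - t₀) * c := by ring
      rw [e1, e2] at hs
      exact hs (hpos s hsI)
    · rw [← h]
      have hg := hv.germ (hs.continuousWithinAt (h ▸ hxI)) hw hY hx hu
      filter_upwards [hg] with s hs hsI using hs (hpos s hsI)
  obtain ⟨ε, hε, hball⟩ := Metric.mem_nhdsWithin_iff.1 hright
  obtain ⟨s, hsB, hsx⟩ := exists_lt_of_csInf_lt ⟨b, hbB⟩ (lt_add_of_pos_right x hε)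
  have hxs : x ≤ s := csInf_le hBbdd hsB
  refine hsB.2 (hball ⟨?_, hI hsB.1⟩ hsB.1)
  rw [Metric.mem_ball, Real.dist_eq, abs_of_nonneg (sub_nonneg.2 hxs)]
  linarith

end DualComplex

namespace DualComplex

variable (S : DualComplex)

/-! ### Initial walls and unbounded chambers -/

theorem sl_add_n (i : ℤ) : S.sl i + 1 ≤ S.sl (i + S.n) := by
  obtain ⟨j, hj⟩ := S.exists_kink_pos
  set m : ℤ := i + (j - (i : ZMod S.n) - 1).val with hm
  have hn : m + 1 ≤ i + S.n := by
    have := ZMod.val_lt (j - (i : ZMod S.n) - 1)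
    omega
  have hcast : ((m + 1 : ℤ) : ZMod S.n) = j := by
    rw [hm]; push_cast; rw [ZMod.natCast_zmod_val]; ring
  have h1 := S.sl_mono hn
  have h2 : S.sl i ≤ S.sl m := S.sl_mono (by omega)
  have h3 := S.sl_succ m
  rw [hcast] at h3
  omega

theorem sl_add_mul_n (i : ℤ) (N : ℕ) : S.sl i + N ≤ S.sl (i + N * S.n) := by
  induction N with
  | zero => simp
  | succ N ih =>
    have := S.sl_add_n (i + N * S.n)
    push_cast
    rw [add_mul, one_mul, ← add_assoc i]
    linarith

/-- The orders of the initial walls that reach the cell `j` in the direction `σ` are not sparse: the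
first one that is at least `b` exceeds `b` by at most `1 + g`, or by at most `2` if `g ∣ b`. -/
theorem exists_slope {g : ℤ} (hk : ∀ i, g ∣ S.kink i ∧ S.kink i ≤ 2 + g) (j : ℤ) {σ : ℤ}
    (hσ : σ = 1 ∨ σ = -1) {b : ℤ} (hb : 0 < b) :
    ∃ l, b ≤ σ * (S.sl j - S.sl l) ∧ σ * (S.sl j - S.sl l) ≤ b + 1 + g ∧
      (g ∣ b → σ * (S.sl j - S.sl l) ≤ b + 2) := by
  set f : ℕ → ℤ := fun N => σ * (S.sl j - S.sl (j - σ * N)) with hf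
  have hstep : ∀ N, ∃ i, f (N + 1) = f N + S.kink i := by
    intro N
    rcases hσ with rfl | rfl
    · have := S.sl_succ (j - 1 * (N + 1 : ℕ))
      refine ⟨((j - 1 * (N + 1 : ℕ) + 1 : ℤ) : ZMod S.n), ?_⟩
      · simp only [hf]
        rw [show j - 1 * ((N : ℕ) : ℤ) = j - 1 * ((N + 1 : ℕ) : ℤ) + 1 by push_cast; ring, this]
        ring
    · have := S.sl_succ (j - -1 * (N : ℕ))
      refine ⟨((j - -1 * (N : ℕ) + 1 : ℤ) : ZMod S.n), ?_⟩
      · simp only [hf]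
        rw [show j - -1 * ((N + 1 : ℕ) : ℤ) = j - -1 * ((N : ℕ) : ℤ) + 1 by push_cast; ring, this]
        ring
  have hf0 : f 0 = 0 := by simp [hf]
  have hdvd : ∀ N, g ∣ f N := by
    intro N
    induction N with
    | zero => rw [hf0]; exact dvd_zero g
    | succ N ih => obtain ⟨i, hi⟩ := hstep N; rw [hi]; exact dvd_add ih (hk i).1
  have hex : ∃ N, b ≤ f N := by
    refine ⟨b.toNat * S.n, ?_⟩
    simp only [hf]
    have hbn : (b.toNat : ℤ) = b := Int.toNat_of_nonneg hb.le
    rcases hσ with rfl | rfl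
    · have := S.sl_add_mul_n (j - b.toNat * S.n) b.toNat
      rw [sub_add_cancel] at this
      push_cast
      simp only [one_mul]
      omega
    · have := S.sl_add_mul_n j b.toNat
      push_cast
      rw [show j - -1 * ((b.toNat : ℤ) * S.n) = j + b.toNat * S.n by ring]
      omega
  classical
  obtain ⟨N, hN⟩ : ∃ N, Nat.find hex = N + 1 := by
    refine Nat.exists_eq_succ_of_ne_zero fun h => ?_
    have := Nat.find_spec hex
    rw [h, hf0] at this
    omega
  have h1 := Nat.find_spec hex
  have h2 : f N < b := not_le.1 (Nat.find_min hex (by omega))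
  rw [hN] at h1
  obtain ⟨i, hi⟩ := hstep N
  have h3 := (hk i).2
  refine ⟨j - σ * (N + 1 : ℕ), h1, ?_, fun hgb => ?_⟩
  · change f (N + 1) ≤ _
    omega
  · change f (N + 1) ≤ _
    have h4 : g ∣ b - f N := dvd_sub hgb (hdvd N)
    have := Int.le_of_dvd (by omega) h4
    omega

variable {S}

/-- An affine path in flat coordinates is straight. -/
theorem hasVelocity_dev {I : Set ℝ} {X Y a c : ℝ} {t : ℝ} {j : ℤ}
    (hI : ∀ s ∈ I, 0 ≤ Y + s * c + S.F (X + s * a)) (ht : t ∈ I) (hw : S.Win j (X + t * a))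
    (hmem : S.dev (X + t * a) (Y + t * c) ∈ S.chartDomain j ∨
      (S.dev (X + t * a) (Y + t * c) = S.sing j ∧ ∃ α : ℝ, S.dA j a c = α • S.dir j)) :
    S.HasVelocity (fun s => S.dev (X + s * a) (Y + s * c)) I t j (S.dA j a c) := by
  refine ⟨hmem, ?_⟩
  have h2 : ∀ᶠ s in 𝓝[I] t, S.Win j (X + s * a) := by
    have h3 : Continuous fun s => X + s * a := by fun_prop
    exact ((h3.tendsto t).mono_left (nhdsWithin_le_nhds (s := I))).eventually
      ((S.isOpen_win j).eventually_mem hw)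
  filter_upwards [h2, self_mem_nhdsWithin] with s hs hsI
  rw [S.chart_dev hs.1.le hs.2.le (hI s hsI), S.chart_dev hw.1.le hw.2.le (hI t ht), ← A_add]
  congr 1 <;> ring

theorem dev_mem_chartDomain {j : ℤ} {X Y : ℝ} (hw : S.Win j X) (hY : 0 < Y + S.F X) :
    S.dev X Y ∈ S.chartDomain j := by
  refine Or.inr (Or.inl ⟨?_, S.dev_mem_star hw hY.le⟩)
  rw [S.gauge_dev hY.le]; linarith

variable (S)

/-- The straight ray from the singularity on the edge `l` in the invariant direction `σ = ±1`. -/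
def initialRay (l : ℤ) (σ : ℤ) (t : ℝ) : ℝ × ℝ :=
  S.dev (S.sg l + t * σ) (-S.G l (S.sg l) + t * (-(S.sl l * σ)))

theorem initialRay_height (l σ : ℤ) (t : ℝ) :
    -S.G l (S.sg l) + t * (-(S.sl l * σ)) + S.F (S.sg l + t * σ) =
      S.F (S.sg l + t * σ) - S.G l (S.sg l + t * σ) := by
  rw [S.G_sub l (S.sg l) (S.sg l + t * σ)]; ring

theorem initialRay_height_nonneg (l σ : ℤ) (t : ℝ) :
    0 ≤ -S.G l (S.sg l) + t * (-(S.sl l * σ)) + S.F (S.sg l + t * σ) := by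
  rw [initialRay_height]; exact sub_nonneg.2 (S.G_le_F _ _)

theorem initialRay_zero (l σ : ℤ) : S.initialRay l σ 0 = S.sing (l : ZMod S.n) := by
  rw [initialRay, sing_eq_dev, S.F_eq (S.inCell_sg l)]; simp

theorem sl_eq_of_G_eq {j l : ℤ} {X : ℝ} (h1 : S.xs j < X) (h2 : X < S.xs (j + 1))
    (h : S.F X = S.G l X) : S.sl j = S.sl l := by
  have hc : S.InCell j X := ⟨h1.le, h2.le⟩
  have e : S.F X = S.G j X := S.F_eq hc
  have k1 := S.G_le (j := j) (X := S.xs j) ⟨le_rfl, h1.le.trans h2.le⟩ l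
  have k2 := S.G_le (j := j) (X := S.xs (j + 1)) ⟨h1.le.trans h2.le, le_rfl⟩ l
  rw [S.G_sub l X, S.G_sub j X, ← h, ← e] at k1 k2
  have : (S.sl j : ℝ) = S.sl l := by
    apply le_antisymm <;> by_contra! hc <;> nlinarith
  exact_mod_cast this

theorem initialRay_dA (j l σ : ℤ) : S.dA j σ (-(S.sl l * σ)) =
    toReal (σ • S.e (j : ZMod S.n) + (σ * (S.sl j - S.sl l)) • S.v (j : ZMod S.n)) := by
  rw [toReal_add, toReal_smul, toReal_smul, dA, dr, vt, dir, vtx]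
  congr 2
  push_cast; ring

theorem isCoprime_of_wedge {v m : ℤ × ℤ} {σ : ℤ} (hσ : σ = 1 ∨ σ = -1) (h : wedge v m = σ) :
    IsCoprime m.1 m.2 := by
  unfold wedge at h
  refine ⟨-σ * v.2, σ * v.1, ?_⟩
  have : σ * σ = 1 := by rcases hσ with rfl | rfl <;> norm_num
  linear_combination σ * h + this

theorem initialRay_isStraight (l : ℤ) {σ : ℤ} (hσ : σ = 1 ∨ σ = -1) :
    S.IsStraight (S.initialRay l σ) (Ici 0) 1 := by
  have hnn := S.initialRay_height_nonneg l σ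
  refine ⟨?_, fun t ht => ?_⟩
  · refine Continuous.continuousOn (S.continuous_dev.comp
      (by fun_prop : Continuous fun t : ℝ => (S.sg l + t * σ, _)))
  have key : ∀ j : ℤ, S.Win j (S.sg l + t * σ) →
      (S.initialRay l σ t ∈ S.chartDomain j ∨ (S.initialRay l σ t = S.sing j ∧
        ∃ α : ℝ, S.dA j σ (-(S.sl l * σ)) = α • S.dir j)) →
      ∃ (i : ZMod S.n) (m : ℤ × ℤ), IsCoprime m.1 m.2 ∧
        S.HasVelocity (S.initialRay l σ) (Ici 0) t i (((1 : ℕ) : ℝ) • toReal m) := by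
    intro j hw hmem
    refine ⟨j, σ • S.e (j : ZMod S.n) + (σ * (S.sl j - S.sl l)) • S.v (j : ZMod S.n), ?_, ?_⟩
    · refine isCoprime_of_wedge (v := S.v (j : ZMod S.n)) hσ ?_
      rw [wedge_add_right, wedge_smul_right, wedge_smul_right, wedge_self, S.distance_one]
      ring
    · rw [Nat.cast_one, one_smul, ← initialRay_dA]
      exact hasVelocity_dev (fun s _ => hnn s) ht hw hmem
  set X := S.sg l + t * σ with hX
  have hc := S.inCell_idx X
  set j := S.idx X with hj
  have hlt := S.lt_idx_succ X
  rcases (hnn t).lt_or_eq with h | h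
  · exact key j (S.win_idx X) (Or.inl (dev_mem_chartDomain (S.win_idx X) h))
  · have hm := S.mem_chartDomain_boundary (S.win_idx X) h.symm
    rcases lt_trichotomy X (S.sg j) with h1 | h1 | h1
    · refine key j (S.win_idx X) (Or.inl (hm.2 ⟨?_, h1⟩))
      have := S.sg_lt_xs (j - 1)
      rw [sub_add_cancel] at this
      exact this.trans_le hc.1
    · refine key j (S.win_idx X) (Or.inr ⟨?_, (σ : ℝ), ?_⟩)
      · change S.dev X _ = _
        rw [S.dev_eq_bdry h.symm, ← hX, h1, S.bdry_eq (S.inCell_sg j), sing_eq]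
      · rw [initialRay_height] at h
        have h3 : S.sl j = S.sl l := S.sl_eq_of_G_eq (X := X) (by rw [h1]; exact S.xs_lt_sg j) hlt
          (by linarith)
        rw [dA, h3]
        simp [dr]
    · have hw : S.Win (j + 1) X := ⟨by rw [add_sub_cancel_right]; exact (S.xs_lt_sg j).trans h1,
        hlt.trans (S.xs_cast_lt (lt_add_one _))⟩
      refine key (j + 1) hw (Or.inl ((S.mem_chartDomain_boundary hw h.symm).2 ⟨?_, ?_⟩))
      · rwa [add_sub_cancel_right]
      · exact hlt.trans (S.xs_lt_sg _)

theorem phi_dev {X Y : ℝ} (h : 0 ≤ Y + S.F X) : S.phi (S.dev X Y) = Y + S.F X := by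
  rw [phi, S.gauge_dev h, add_sub_cancel_left, max_eq_left h]

/-- Initial rays are walls, of an order that is a difference of slopes of `F`. -/
theorem mem_initialWalls {j l σ : ℤ} (hσ : σ = 1 ∨ σ = -1) {X : ℝ} (h1 : S.xs j < X)
    (h2 : X < S.xs (j + 1)) (hpos : 0 < σ * (X - S.sg l)) {k : ℕ}
    (hk : σ * (S.sl j - S.sl l) ≤ k) : S.dev X (-S.G l X) ∈ S.initialWalls k := by
  have hσ2 : (σ : ℝ) * σ = 1 := by rcases hσ with rfl | rfl <;> norm_num
  set t := σ * (X - S.sg l) with ht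
  have hX : S.sg l + t * σ = X := by rw [ht]; linear_combination (X - S.sg l) * hσ2
  refine ⟨(l : ZMod S.n), σ, S.initialRay l σ, t, (σ * (S.sl j - S.sl l) : ℤ), ?_,
    S.initialRay_zero l σ, S.initialRay_isStraight l hσ, ?_, hpos, ?_, ?_, by exact_mod_cast hk⟩
  · rcases hσ with rfl | rfl <;> simp
  · have h0 : S.Win l (S.sg l + 0 * σ) := by
      rw [zero_mul, add_zero]
      exact ⟨(S.xs_cast_lt (sub_one_lt l)).trans (S.xs_lt_sg l), S.sg_lt_xs l⟩
    have hd : S.dA l σ (-(S.sl l * σ)) = (σ : ℝ) • S.dir l := by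
      rw [dA, dr]; simp
    rw [← hd]
    exact hasVelocity_dev (fun s _ => S.initialRay_height_nonneg l σ s) self_mem_Ici h0
      (Or.inr ⟨S.initialRay_zero l σ, σ, hd⟩)
  · rw [initialRay, hX]
    congr 1
    rw [S.G_sub l (S.sg l) X, ← hX]; ring
  · have hev : ∀ᶠ s in 𝓝 t, S.xs j < S.sg l + s * σ ∧ S.sg l + s * σ < S.xs (j + 1) := by
      have hcont : Continuous fun s : ℝ => S.sg l + s * σ := by fun_prop
      have h3 := hcont.tendsto t
      rw [hX] at h3
      exact (h3.eventually (lt_mem_nhds h1)).and (h3.eventually (gt_mem_nhds h2))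
    have heq : (fun s => S.phi (S.initialRay l σ s)) =ᶠ[𝓝 t]
        fun s => (S.G j (S.sg l) - S.G l (S.sg l)) + s * (σ * (S.sl j - S.sl l)) := by
      filter_upwards [hev] with s hs
      rw [initialRay, S.phi_dev (S.initialRay_height_nonneg l σ s), initialRay_height,
        S.F_eq (i := j) ⟨hs.1.le, hs.2.le⟩, S.G_sub j (S.sg l), S.G_sub l (S.sg l)]
      ring
    refine HasDerivAt.congr_of_eventuallyEq ?_ heq
    have h4 := ((hasDerivAt_id t).mul_const ((σ : ℝ) * (S.sl j - S.sl l))).const_add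
      (S.G j (S.sg l) - S.G l (S.sg l))
    simpa using h4

theorem exists_of_mem_openCell {i : ZMod S.n} {X Y : ℝ} (hY : 0 ≤ Y + S.F X)
    (h : S.dev X Y ∈ S.openCell i) :
    ∃ m : ℤ, (m : ZMod S.n) = i ∧ S.xs m < X ∧ X < S.xs (m + 1) ∧ 0 < Y + S.F X := by
  obtain ⟨hg, h1, h2⟩ := h
  have hs : S.dev X Y ∈ S.star i := Or.inr ⟨h1.le, h2⟩
  rw [S.gauge_dev hY] at hg
  obtain ⟨m, rfl, hw⟩ := S.exists_win_of_mem_star hY hs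
  refine ⟨m, rfl, ?_, hw.2, by linarith⟩
  by_contra! hc
  have hc' : S.InCell (m - 1) X := ⟨hw.1.le, by rwa [sub_add_cancel]⟩
  change 0 < wedge (S.vt m) _ at h1
  rw [dev, S.bdry_eq hc', wedge_smul_right, wedge_vt_pred] at h1
  nlinarith

theorem exists_dev_of_mem_openCell {i : ZMod S.n} {x : ℝ × ℝ} (h : x ∈ S.openCell i) :
    ∃ X Y, 0 < Y + S.F X ∧ x = S.dev X Y := by
  obtain ⟨i', rfl⟩ := ZMod.intCast_surjective i
  obtain ⟨X, Y, -, hY, rfl⟩ := S.exists_dev_of_mem_star (i := i') (x := x)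
    (Or.inr ⟨h.2.1.le, h.2.2⟩) h.1.le
  obtain ⟨m, -, -, -, h⟩ := S.exists_of_mem_openCell hY h
  exact ⟨X, Y, h, rfl⟩

theorem InUnboundedChamber.exists_mem_openCell {S : DualComplex} {k : ℕ} {P : ℝ × ℝ}
    (h : S.InUnboundedChamber k P) : ∃ i, P ∈ S.openCell i := by
  obtain ⟨i, hi⟩ := h
  refine ⟨i, ?_⟩
  by_contra hP
  rw [connectedComponentIn_eq_empty (fun h => hP h.1)] at hi
  exact hi Bornology.isBounded_empty

/-- A point of an unbounded chamber does not lie on or below the initial wall that leaves the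
singularity on the edge `l` in the direction `σ`, if the order of this wall in the cell of the
point is at most `k`. -/
theorem InUnboundedChamber.false_of_le {S : DualComplex} {k : ℕ} {X Y : ℝ}
    (h : S.InUnboundedChamber k (S.dev X Y)) (hY : 0 ≤ Y + S.F X) {j l σ : ℤ}
    (hσ : σ = 1 ∨ σ = -1) (hj : S.InCell j X) (hl : 0 < σ * (S.sl j - S.sl l))
    (hk : σ * (S.sl j - S.sl l) ≤ k) (hle : Y ≤ -S.G l X) : False := by
  obtain ⟨i, hi⟩ := h
  set U := S.openCell i \ S.initialWalls k with hU
  have hPU : S.dev X Y ∈ U := by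
    by_contra hP
    rw [connectedComponentIn_eq_empty hP] at hi
    exact hi Bornology.isBounded_empty
  obtain ⟨m, rfl, hm1, hm2, hYpos⟩ := S.exists_of_mem_openCell hY hPU.1
  obtain rfl : m = j := by
    have h1 : m ≤ j := S.le_of_xs_lt (hm1.trans_le hj.2)
    have h2 : j ≤ m := S.le_of_xs_lt (hj.1.trans_lt hm2)
    omega
  -- the ray from the edge `l` crosses the whole cell
  have hray : ∀ X' : ℝ, S.xs m < X' → X' < S.xs (m + 1) → 0 < σ * (X' - S.sg l) := by
    intro X' h1 h2
    rcases hσ with rfl | rfl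
    · have hlm : l + 1 ≤ m := by
        by_contra! hc
        have := S.sl_mono (show m ≤ l by omega)
        omega
      have := S.xs_cast_mono hlm
      have := S.sg_lt_xs l
      push_cast; linarith
    · have hlm : m + 1 ≤ l := by
        by_contra! hc
        have := S.sl_mono (show l ≤ m by omega)
        omega
      have := S.xs_cast_mono hlm
      have := S.xs_lt_sg l
      push_cast; linarith
  set Xc : ℝ × ℝ → ℝ := fun z => S.xs m + wedge (S.vt m) z / S.gauge z with hXc
  set ψ : ℝ × ℝ → ℝ := fun z => S.gauge z - 1 - (S.G m (Xc z) - S.G l (Xc z)) with hψ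
  have hcoord : ∀ z ∈ S.openCell (m : ZMod S.n), S.xs m < Xc z ∧ Xc z < S.xs (m + 1) ∧
      1 < S.gauge z ∧ z = S.gauge z • S.bd m (Xc z) := by
    intro z hz
    have hg := hz.1
    obtain ⟨g, s, h1, h2, h3, h4, h5, h6⟩ := S.exists_of_mem_cone hz.2.1.le hz.2.2.le
      (add_pos hz.2.1 hz.2.2)
    have h7 : S.gauge z = g := by rw [h4, S.gauge_eq h1.le h2 h3]
    have h8 : Xc z = S.xs m + s := by
      simp only [hXc, h7]
      change _ + wedge (S.vtx (m : ZMod S.n)) z / g = _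
      rw [h5]; field_simp
    have h9 := hz.2.1
    have h10 := hz.2.2
    rw [h5] at h9
    rw [h6] at h10
    have h11 := pos_of_mul_pos_right h9 h1.le
    have h12 := pos_of_mul_pos_right h10 h1.le
    refine ⟨by rw [h8]; linarith, by rw [h8, xs_succ]; push_cast; linarith, hg, ?_⟩
    rw [h7, h8, bd_eq, add_sub_cancel_left]
    exact h4
  have hne : ∀ z ∈ U, ψ z ≠ 0 := by
    intro z hz h0
    obtain ⟨h1, h2, h3, h4⟩ := hcoord z hz.1
    refine hz.2 ?_
    have := S.mem_initialWalls hσ h1 h2 (hray _ h1 h2) hk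
    rw [dev, S.F_eq (i := m) ⟨h1.le, h2.le⟩, S.bdry_eq ⟨h1.le, h2.le⟩] at this
    rw [h4]
    convert this using 2
    simp only [hψ] at h0
    linarith
  have hcont : ContinuousOn ψ U := by
    have hcX : ContinuousOn Xc U := by
      refine continuousOn_const.add (ContinuousOn.div ?_ S.continuous_gauge.continuousOn ?_)
      · exact (continuous_wedge continuous_const continuous_id).continuousOn
      · intro z hz
        have := hz.1.1
        linarith
    exact (S.continuous_gauge.continuousOn.sub continuousOn_const).sub
      (((S.continuous_G m).comp_continuousOn hcX).sub ((S.continuous_G l).comp_continuousOn hcX))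
  have hsub : connectedComponentIn U (S.dev X Y) ⊆ U := connectedComponentIn_subset _ _
  have hψP : ψ (S.dev X Y) < 0 := by
    refine lt_of_le_of_ne ?_ (hne _ hPU)
    have h1 : Xc (S.dev X Y) = X := by
      simp only [hXc]
      rw [S.gauge_dev hY, dev, S.bdry_eq hj, wedge_smul_right]
      have : wedge (S.vt m) (S.bd m X) = X - S.xs m := by rw [← S.bd_xs, wedge_bd]
      rw [this]
      have hp : 1 + (Y + S.F X) ≠ 0 := by linarith
      rw [show 1 + Y + S.F X = 1 + (Y + S.F X) by ring, mul_div_cancel_left₀ _ hp]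
      ring
    simp only [hψ]
    rw [h1, S.gauge_dev hY, S.F_eq hj]
    linarith
  have hneg : ∀ z ∈ connectedComponentIn U (S.dev X Y), ψ z < 0 := by
    intro z hz
    by_contra! hc
    obtain ⟨y, hy, hy0⟩ := isPreconnected_connectedComponentIn.intermediate_value
      (mem_connectedComponentIn hPU) hz (hcont.mono hsub) ⟨hψP.le, hc⟩
    exact hne y (hsub hy) hy0
  refine hi (Bornology.IsBounded.subset (IsCompact.isBounded
    ((isCompact_Icc (a := (0 : ℝ)) (b := 1)).prod
      (isCompact_Icc (a := (S.xs m : ℝ)) (b := S.xs (m + 1))) |>.image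
      (f := fun p : ℝ × ℝ => (1 + p.1 * (S.G m p.2 - S.G l p.2)) • S.bd m p.2) ?_)) ?_)
  · unfold G bd; fun_prop
  · intro z hz
    obtain ⟨h1, h2, h3, h4⟩ := hcoord z (hsub hz).1
    have h5 := hneg z hz
    simp only [hψ] at h5
    set w := S.G m (Xc z) - S.G l (Xc z) with hw
    have hw0 : 0 < w := by linarith
    refine ⟨((S.gauge z - 1) / w, Xc z), ⟨⟨by apply div_nonneg <;> linarith, ?_⟩, h1.le, h2.le⟩, ?_⟩
    · rw [div_le_one hw0]; linarith
    · simp only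
      rw [← hw, div_mul_cancel₀ _ hw0.ne', add_sub_cancel, ← h4]

/-- `Below σ X Y b j`: the point `(X, Y)` lies on or below a ray that starts on the boundary of
`σ₀`, on the side `-σ` of the point, in the direction `(σ, b - σ * sl j)`, which is of order `b` in
the cell `j`. -/
def Below (σ : ℤ) (X Y b : ℝ) (j : ℤ) : Prop :=
  ∃ D : ℝ, 0 ≤ D ∧ Y + S.F (X - σ * D) ≤ (b - σ * S.sl j) * D

/-- A point of an unbounded chamber is not below a ray of small order, because there is an initial
wall above this ray the order of which is not much larger. -/
theorem InUnboundedChamber.not_below {S : DualComplex} {p q : ℕ} (hp : 0 < p) {X Y : ℝ}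
    (h : S.InUnboundedChamber (p + q) (S.dev X Y)) (hY : 0 ≤ Y + S.F X) {g : ℤ}
    (hk : ∀ i, g ∣ S.kink i ∧ S.kink i ≤ 2 + g) {j σ : ℤ} (hσ : σ = 1 ∨ σ = -1)
    (hj : S.InCell j X) {b : ℤ} (hb : 0 < b) (hbq : b ≤ q - g ∨ g ∣ b ∧ b ≤ q - 1) :
    ¬ S.Below σ X Y b j := by
  rintro ⟨D, hD, hle⟩
  obtain ⟨l, h1, h2, h3⟩ := S.exists_slope hk j hσ hb
  have h1' : (b : ℝ) ≤ σ * (S.sl j - S.sl l) := by exact_mod_cast h1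
  refine h.false_of_le hY hσ hj (hb.trans_le h1) (k := p + q) ?_ ?_ (l := l)
  · rcases hbq with h4 | ⟨h4, h5⟩
    · push_cast; omega
    · have := h3 h4; push_cast; omega
  · have h4 := S.G_le_F l (X - σ * D)
    rw [S.G_sub l X] at h4
    nlinarith

end DualComplex

namespace DualComplex

variable (S : DualComplex)

/-! ### Moments of straight paths -/

/-- The points outside the interior of `σ₀` on the countably many lines of integral direction
`(a, c)` and integral moment `X c - Y a`. These are the lines on which rigid tropical objects can
lie. -/
def integralLines : Set (ℝ × ℝ) :=
  {x | ∃ (X Y : ℝ) (a c z : ℤ), (a ≠ 0 ∨ c ≠ 0) ∧ 0 ≤ Y + S.F X ∧ x = S.dev X Y ∧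
    X * c - Y * a = z}

/-- Charts preserve moments up to integers. -/
theorem wedge_A_dA (j : ℤ) (X Y a c : ℝ) : wedge (S.A j X Y) (S.dA j a c) =
    a + S.ys j * a + S.xs j * c - (X * c - Y * a) := by
  have h : wedge (S.dr j) (S.vt j) = -1 := by rw [wedge_swap, wedge_vt_dr]
  simp only [A, dA, wedge_add_left, wedge_add_right, wedge_smul_left, wedge_smul_right, wedge_self,
    wedge_vt_dr, h, G]
  ring

theorem toReal_dA (j a c : ℤ) : S.dA j a c =
    toReal (a • S.e (j : ZMod S.n) + (c + S.sl j * a) • S.v (j : ZMod S.n)) := by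
  rw [toReal_add, toReal_smul, toReal_smul, dA, dr, vt, dir, vtx]
  push_cast; rfl

theorem isThin_integralLines : S.IsThin S.integralLines := by
  -- the line of all points `y` with `wedge y u = z`
  set line : (ℤ × ℤ) × ℤ → AffineSubspace ℝ (ℝ × ℝ) := fun p => AffineSubspace.mk'
    ((p.2 / ((p.1.1 : ℝ) ^ 2 + (p.1.2 : ℝ) ^ 2)) • ((p.1.2 : ℝ), -(p.1.1 : ℝ)))
    (Submodule.span ℝ {toReal p.1}) with hline
  refine ⟨line '' {p | p.1 ≠ 0}, (Set.to_countable _).image _, ?_, ?_⟩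
  · rintro _ ⟨p, hp, rfl⟩
    rw [hline, AffineSubspace.direction_mk']
    refine finrank_span_singleton fun h => hp ?_
    simp only [toReal, Prod.mk_eq_zero, Int.cast_eq_zero] at h
    exact Prod.ext h.1 h.2
  · rintro i x ⟨⟨X, Y, a, c, z, hne, hY, rfl, hz⟩, hx⟩
    have hs := S.chartDomain_subset_star hx (by rw [S.gauge_dev hY]; linarith)
    obtain ⟨j, rfl, hw⟩ := S.exists_win_of_mem_star hY hs
    rw [S.chart_dev hw.1.le hw.2.le hY]
    set u : ℤ × ℤ := a • S.e (j : ZMod S.n) + (c + S.sl j * a) • S.v (j : ZMod S.n) with hu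
    have hu0 : u ≠ 0 := by
      intro h0
      have h1 := S.toReal_dA j a c
      rw [← hu, h0] at h1
      have h2 : S.dA j a c = S.dA j 0 0 := by rw [h1]; simp [toReal, dA]
      obtain ⟨h3, h4⟩ := S.dA_injective h2
      rcases hne with h | h
      · exact h (by exact_mod_cast h3)
      · exact h (by exact_mod_cast h4)
    have hm := S.wedge_A_dA j X Y a c
    rw [hz, toReal_dA, ← hu] at hm
    refine ⟨_, ⟨(u, a + S.ys j * a + S.xs j * c - z), hu0, rfl⟩, ?_⟩
    rw [hline, AffineSubspace.mem_mk', Submodule.mem_span_singleton]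
    have hd : (0 : ℝ) < (u.1 : ℝ) ^ 2 + (u.2 : ℝ) ^ 2 := by
      have : (u.1 : ℝ) ≠ 0 ∨ (u.2 : ℝ) ≠ 0 := by
        by_contra! h
        exact hu0 (Prod.ext (by exact_mod_cast h.1) (by exact_mod_cast h.2))
      rcases this with h | h
      · have := pow_pos (abs_pos.2 h) 2
        rw [sq_abs] at this
        positivity
      · have := pow_pos (abs_pos.2 h) 2
        rw [sq_abs] at this
        positivity
    generalize S.A j X Y = y at hm
    refine ⟨(y.1 * u.1 + y.2 * u.2) / ((u.1 : ℝ) ^ 2 + (u.2 : ℝ) ^ 2), ?_⟩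
    push_cast
    rw [← hm]
    ext <;> simp only [toReal, wedge, vsub_eq_sub, Prod.fst_sub, Prod.snd_sub, Prod.smul_fst,
      Prod.smul_snd, smul_eq_mul] <;> field_simp <;> ring

variable {S}

theorem eventually_gauge_lt {γ : ℝ → ℝ × ℝ} {I : Set ℝ} {t : ℝ}
    (hc : ContinuousWithinAt γ I t) (h : S.gauge (γ t) < 1) :
    ∀ᶠ s in 𝓝[I] t, S.gauge (γ s) < 1 :=
  (S.continuous_gauge.continuousAt.comp_continuousWithinAt hc).eventually (gt_mem_nhds h)

/-- Two descriptions of a straight path near a point, in two charts, one with an integral velocity,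
give the same moment up to an integer. -/
theorem moment_congr {γ : ℝ → ℝ × ℝ} {I : Set ℝ} {t : ℝ} {i i' : ZMod S.n} {m : ℤ × ℤ}
    {u' : ℝ × ℝ} (hc : ContinuousWithinAt γ I t) [hne : (𝓝[I \ {t}] t).NeBot]
    (hs : 1 ≤ S.gauge (γ t) → γ t ∈ S.star i)
    (hv : ∀ᶠ s in 𝓝[I] t, S.chart i (γ s) = S.chart i (γ t) + (s - t) • toReal m)
    (hv' : S.HasVelocity γ I t i' u') :
    ∃ z : ℤ, wedge (S.chart i (γ t)) (toReal m) = wedge (S.chart i' (γ t)) u' + z := by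
  have hle : 𝓝[I \ {t}] t ≤ 𝓝[I] t := nhdsWithin_mono _ sdiff_subset
  by_cases hf : ∃ᶠ s in 𝓝[I \ {t}] t, 1 ≤ S.gauge (γ s)
  · have hg : 1 ≤ S.gauge (γ t) := by
      by_contra! h
      obtain ⟨s, h1, h2⟩ := (hf.and_eventually ((eventually_gauge_lt hc h).filter_mono hle)).exists
      linarith
    have hst := hs hg
    obtain ⟨i₀, rfl⟩ := ZMod.intCast_surjective i
    obtain ⟨X, Y, hw, hY, hx⟩ := S.exists_dev_of_mem_star hst hg
    obtain ⟨j, rfl, hw'⟩ := hv'.exists_win hY hx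
    obtain ⟨a, c, hu'⟩ := S.exists_dA_eq j u'
    have hgerm := hv'.germ hc hw' hY hx hu'
    have hu : toReal m = S.dA i₀ a c := by
      refine eq_dA_of_dev hv hw hY hx ?_
      have hmem : ∀ᶠ s in 𝓝[I \ {t}] t, s ∈ I \ {t} := self_mem_nhdsWithin
      refine Frequently.filter_mono ?_ hle
      refine (hf.and_eventually (hmem.and (hgerm.filter_mono hle))).mono ?_
      rintro s ⟨h1, h2, h3⟩
      exact ⟨h2.2, h3 (Or.inl h1)⟩
    obtain ⟨a', c', hac⟩ := S.exists_dA_eq_int i₀ m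
    obtain ⟨rfl, rfl⟩ := S.dA_injective (hu.symm.trans hac)
    rw [hx, S.chart_dev hw.1.le hw.2.le hY, S.chart_dev hw'.1.le hw'.2.le hY, hu, hu', wedge_A_dA,
      wedge_A_dA]
    refine ⟨S.ys i₀ * a' + S.xs i₀ * c' - (S.ys j * a' + S.xs j * c'), ?_⟩
    push_cast; ring
  · rw [not_frequently] at hf
    have hg : S.gauge (γ t) ≤ 1 := by
      refine le_of_tendsto ((S.continuous_gauge.continuousAt.comp_continuousWithinAt
        hc).tendsto.mono_left hle) (hf.mono fun s h => (not_le.1 h).le)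
    have hmem : ∀ᶠ s in 𝓝[I \ {t}] t, s ∈ I \ {t} := self_mem_nhdsWithin
    obtain ⟨s, h1, h2, h3, h4⟩ := (hf.and (hmem.and ((hv.filter_mono hle).and
      (hv'.2.filter_mono hle)))).exists
    have h1 := (not_le.1 h1).le
    rw [S.chart_of_gauge_le _ h1, S.chart_of_gauge_le _ hg] at h3 h4
    have hu : toReal m = u' :=
      smul_right_injective _ (sub_ne_zero.2 h2.2) (add_left_cancel (h3.symm.trans h4))
    refine ⟨0, ?_⟩
    rw [S.chart_of_gauge_le _ hg, S.chart_of_gauge_le _ hg, hu]; simp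

theorem toReal_natCast_smul (w : ℕ) (m : ℤ × ℤ) :
    (w : ℝ) • toReal m = toReal ((w : ℤ) • m) := by
  rw [toReal_smul]; simp

/-- The moment of a straight path is constant up to integers. -/
theorem IsStraight.moment_eq {γ : ℝ → ℝ × ℝ} {I : Set ℝ} {w : ℕ} (h : S.IsStraight γ I w)
    (hI : I.OrdConnected) (hn : I.Nontrivial) {s t : ℝ} (hs : s ∈ I) (ht : t ∈ I)
    {i i' : ZMod S.n} {u u' : ℝ × ℝ} (hv : S.HasVelocity γ I s i u)
    (hv' : S.HasVelocity γ I t i' u') :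
    ∃ z : ℤ, wedge (S.chart i (γ s)) u = wedge (S.chart i' (γ t)) u' + z := by
  have hpre := hI.isPreconnected
  have hacc : ∀ x ∈ I, (𝓝[I \ {x}] x).NeBot := fun x hx =>
    accPt_principal_iff_nhdsWithin.1 (hpre.preperfect_of_nontrivial hn x hx)
  refine hpre.induction₂ (fun s t => ∀ i u i' u', S.HasVelocity γ I s i u →
    S.HasVelocity γ I t i' u' → ∃ z : ℤ, wedge (S.chart i (γ s)) u =
      wedge (S.chart i' (γ t)) u' + z) ?_ ?_ ?_ hs ht i u i' u' hv hv'
  · intro x hx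
    obtain ⟨i₀, m, -, hv₀⟩ := h.2 x hx
    rw [toReal_natCast_smul] at hv₀
    have hst : ∀ᶠ y in 𝓝[I] x, 1 ≤ S.gauge (γ y) → γ y ∈ S.star i₀ := by
      rcases lt_or_ge (S.gauge (γ x)) 1 with hg | hg
      · exact (eventually_gauge_lt (h.continuousWithinAt hx) hg).mono
          fun y hy hy' => absurd hy' (not_le.2 hy)
      · exact ((h.continuousWithinAt hx).eventually
          ((S.isOpen_star i₀).eventually_mem (hv₀.mem_star hg))).mono fun y hy _ => hy
    have hcore : ∀ᶠ y in 𝓝[I] x, y ∈ I ∧ ∀ i' u', S.HasVelocity γ I y i' u' →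
        ∃ z : ℤ, wedge (S.chart i₀ (γ x)) (toReal ((w : ℤ) • m)) =
          wedge (S.chart i' (γ y)) u' + z := by
      filter_upwards [hst, hv₀.2, eventually_eventually_nhdsWithin.2 hv₀.2,
        self_mem_nhdsWithin] with y h1 h2 h3 hy
      refine ⟨hy, fun i' u' hv' => ?_⟩
      have := hacc y hy
      obtain ⟨z, hz⟩ := moment_congr (h.continuousWithinAt hy) h1 (h3.mono fun s hs => by
        rw [hs, h2, add_assoc, ← add_smul, show y - x + (s - y) = s - x by ring]) hv'
      refine ⟨z, ?_⟩
      rw [← hz, h2, wedge_add_left, wedge_smul_left, wedge_self, mul_zero, add_zero]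
    filter_upwards [hcore] with y hy i u i' u' hv hv'
    obtain ⟨z, hz⟩ := hy.2 i' u' hv'
    obtain ⟨z', hz'⟩ := (mem_of_mem_nhdsWithin hx hcore).2 i u hv
    refine ⟨z - z', ?_⟩
    push_cast
    linarith
  · intro x y z hx hy hz h1 h2 i u i' u' hv hv'
    obtain ⟨i₀, m, -, hv₀⟩ := h.2 y hy
    obtain ⟨a, ha⟩ := h1 i u i₀ _ hv hv₀
    obtain ⟨b, hb⟩ := h2 i₀ _ i' u' hv₀ hv'
    exact ⟨a + b, by push_cast; linarith⟩
  · intro x y hx hy h1 i u i' u' hv hv'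
    obtain ⟨a, ha⟩ := h1 i' u' i u hv' hv
    exact ⟨-a, by push_cast; linarith⟩

/-- Reversing a path reverses its velocities. -/
theorem HasVelocity.reverse {γ γ' : ℝ → ℝ × ℝ} {I I' : Set ℝ} {t : ℝ} {i : ZMod S.n}
    {u : ℝ × ℝ} (h : S.HasVelocity γ I t i u) (ht : t ∈ I) (hI : ∀ s ∈ I', -s ∈ I)
    (hγ : ∀ s ∈ I, γ' (-s) = γ s) : S.HasVelocity γ' I' (-t) i (-u) := by
  refine ⟨?_, ?_⟩
  · rw [hγ t ht]
    rcases h.1 with h1 | ⟨h1, a, h2⟩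
    · exact Or.inl h1
    · exact Or.inr ⟨h1, -a, by rw [h2, neg_smul]⟩
  · have hT : Tendsto (fun s : ℝ => -s) (𝓝[I'] (-t)) (𝓝[I] t) := by
      refine tendsto_nhdsWithin_iff.2 ⟨?_, eventually_nhdsWithin_of_forall hI⟩
      have := (continuous_neg (G := ℝ)).tendsto (-t)
      rw [neg_neg] at this
      exact this.mono_left nhdsWithin_le_nhds
    filter_upwards [hT.eventually h.2, self_mem_nhdsWithin] with s hs hsI
    have h1 := hγ _ (hI s hsI)
    rw [neg_neg] at h1
    rw [h1, hγ t ht, hs]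
    congr 1
    rw [smul_neg, ← neg_smul]; congr 1; ring

end DualComplex

namespace DualComplex

variable {S : DualComplex}

/-! ### Edges of tropical maps -/

namespace TropicalMap

variable (h : S.TropicalMap)

theorem mem_dom_symm {a b : Fin h.m} {t : ℝ} : -t ∈ h.dom b a ↔ t ∈ h.dom a b := by
  simp only [dom, mem_ofPred_eq, neg_le_neg_iff]
  constructor
  · rintro ⟨h1, h2⟩
    exact ⟨fun ha => h2 ha, fun hb => by linarith [h1 hb]⟩
  · rintro ⟨h1, h2⟩
    exact ⟨fun ha => by linarith [h2 ha], fun hb => h1 hb⟩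

theorem path_neg {a b : Fin h.m} (hab : h.G.Adj a b) {t : ℝ} (ht : t ∈ h.dom a b) :
    h.path b a (-t) = h.path a b t :=
  h.path_symm a b t hab ht.1 ht.2

theorem start_mem_dom {a b : Fin h.m} (hab : h.G.Adj a b) (ha : h.pos a ≠ none) :
    h.start a b ∈ h.dom a b :=
  ⟨fun _ => le_rfl, fun hb => (h.start_lt a b hab ha hb).le⟩

theorem neg_start_mem_dom {a b : Fin h.m} (hab : h.G.Adj a b) (hb : h.pos b ≠ none) :
    -h.start b a ∈ h.dom a b :=
  (h.mem_dom_symm (a := a) (b := b)).1 (by simpa using h.start_mem_dom hab.symm hb)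

theorem path_end {a b : Fin h.m} (hab : h.G.Adj a b) {x : ℝ × ℝ} (hb : h.pos b = some x) :
    h.path a b (-h.start b a) = x := by
  rw [h.path_neg hab.symm (h.start_mem_dom hab.symm (by simp [hb])), h.path_start b a x hab.symm hb]

theorem ordConnected_dom (a b : Fin h.m) : (h.dom a b).OrdConnected :=
  ⟨fun _ hx _ hy _ hz => ⟨fun ha => (hx.1 ha).trans hz.1, fun hb => hz.2.trans (hy.2 hb)⟩⟩

theorem exists_dom_near_start {a b : Fin h.m} (hab : h.G.Adj a b) (ha : h.pos a ≠ none) :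
    ∃ T, h.start a b < T ∧ Icc (h.start a b) T ⊆ h.dom a b := by
  by_cases hb : h.pos b = none
  · exact ⟨h.start a b + 1, by linarith, fun t ht => ⟨fun _ => ht.1, fun h => absurd hb h⟩⟩
  · exact ⟨-h.start b a, h.start_lt a b hab ha hb, (h.ordConnected_dom a b).out
      (h.start_mem_dom hab ha) (h.neg_start_mem_dom hab hb)⟩

theorem nontrivial_dom {a b : Fin h.m} (hab : h.G.Adj a b) : (h.dom a b).Nontrivial := by
  by_cases ha : h.pos a = none
  · by_cases hb : h.pos b = none
    · exact ⟨0, ⟨fun h => absurd ha h, fun h => absurd hb h⟩, 1,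
        ⟨fun h => absurd ha h, fun h => absurd hb h⟩, by simp⟩
    · exact ⟨-h.start b a, h.neg_start_mem_dom hab hb, -h.start b a - 1,
        ⟨fun h => absurd ha h, fun _ => by linarith⟩, by linarith⟩
  · obtain ⟨T, h1, h2⟩ := h.exists_dom_near_start hab ha
    exact ⟨_, h2 ⟨le_rfl, h1.le⟩, T, h2 ⟨h1.le, le_rfl⟩, h1.ne⟩

theorem isStraight_dom {a b : Fin h.m} (hab : h.G.Adj a b) :
    S.IsStraight (h.path a b) (h.dom a b) (h.weight a b) := h.straight a b hab

end TropicalMap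

/-! ### Directions of walls -/

variable (S)

/-- A direction `(a, c)` at the point `(X, Y)` in flat coordinates, as it occurs for a wall that
leaves the singularities: it does not decrease the height, and strictly increases it above the
boundary of `σ₀`; its order is divisible by `g`; its moment is integral; and the point is below a
ray of the same order that starts on the boundary of `σ₀`, on the side from which the wall comes. -/
def IsWallDir (g : ℤ) (X Y : ℝ) (a c : ℤ) : Prop :=
  (∀ j, S.InCell j X → 0 ≤ c + a * S.sl j ∧ (0 < Y + S.F X → 0 < c + a * S.sl j) ∧
    g ∣ c + a * S.sl j) ∧
  (∃ z : ℤ, X * c - Y * a = z) ∧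
  ∀ σ : ℤ, (σ = 1 ∨ σ = -1) → 0 < σ * a → ∀ j, S.InCell j X →
    S.Below σ X Y (c + a * S.sl j : ℤ) j

variable {S}

theorem Below.mono {σ : ℤ} {X Y Y' b b' : ℝ} {j : ℤ} (h : S.Below σ X Y b j) (hY : Y' ≤ Y)
    (hb : b ≤ b') : S.Below σ X Y' b' j := by
  obtain ⟨D, hD, hle⟩ := h
  exact ⟨D, hD, by nlinarith⟩

/-- Walls that meet at a point produce a wall. For the last property, one of them comes from the
same side as the sum, and its order is not larger. -/
theorem IsWallDir.add {g : ℤ} {X Y : ℝ} {a c a' c' : ℤ} (h : S.IsWallDir g X Y a c)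
    (h' : S.IsWallDir g X Y a' c') : S.IsWallDir g X Y (a + a') (c + c') := by
  refine ⟨fun j hj => ?_, ?_, fun σ hσ ha j hj => ?_⟩
  · obtain ⟨h1, h2, h3⟩ := h.1 j hj
    obtain ⟨h1', h2', h3'⟩ := h'.1 j hj
    rw [show c + c' + (a + a') * S.sl j = (c + a * S.sl j) + (c' + a' * S.sl j) by ring]
    exact ⟨add_nonneg h1 h1', fun hY => add_pos (h2 hY) (h2' hY), dvd_add h3 h3'⟩
  · obtain ⟨z, hz⟩ := h.2.1
    obtain ⟨z', hz'⟩ := h'.2.1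
    exact ⟨z + z', by push_cast; linear_combination hz + hz'⟩
  · have h1 := (h.1 j hj).1
    have h1' := (h'.1 j hj).1
    rcases lt_or_ge 0 (σ * a) with h0 | h0
    · exact (h.2.2 σ hσ h0 j hj).mono le_rfl (by exact_mod_cast (by linarith))
    · exact (h'.2.2 σ hσ (by linarith) j hj).mono le_rfl (by exact_mod_cast (by linarith))

theorem dvd_sl_sub {g : ℤ} (hk : ∀ i, g ∣ S.kink i) (i j : ℤ) : g ∣ S.sl j - S.sl i := by
  induction j using Int.inductionOn' (b := i) with
  | zero => simp
  | succ k _ ih =>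
    rw [S.sl_succ, add_sub_right_comm]
    exact dvd_add ih (hk _)
  | pred k _ ih =>
    have := S.sl_succ (k - 1)
    rw [sub_add_cancel] at this
    rw [show S.sl (k - 1) - S.sl i = (S.sl k - S.sl i) - S.kink ((k : ℤ) : ZMod S.n) by
      rw [this]; ring]
    exact dvd_sub ih (hk _)

/-- Orders increase along straight lines, by convexity of `φ`. -/
theorem order_mono {X a τ : ℝ} {j j' : ℤ} (hτ : 0 < τ) (hj : S.InCell j X)
    (hj' : S.InCell j' (X + τ * a)) : a * S.sl j ≤ a * S.sl j' := by
  have h1 := S.F_ge hj (X + τ * a)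
  have h2 := S.F_ge hj' X
  have h3 : τ * (a * S.sl j) ≤ τ * (a * S.sl j') := by nlinarith
  exact le_of_mul_le_mul_left h3 hτ

theorem height_le {X Y a c τ : ℝ} {j : ℤ} (hτ : 0 ≤ τ) (hj : S.InCell j X)
    (hl : 0 ≤ c + a * S.sl j) : Y + S.F X ≤ Y + τ * c + S.F (X + τ * a) := by
  have h1 := S.F_ge hj (X + τ * a)
  nlinarith [mul_nonneg hτ hl]

/-- Walls can be followed along straight lines. The starting point of the ray above the wall can
be kept: the distance to it grows by the displacement of `X`, and this suffices because
`1 ≤ |a|`. -/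
theorem IsWallDir.move {g : ℤ} (hk : ∀ i, g ∣ S.kink i) {X Y : ℝ} {a c : ℤ}
    (h : S.IsWallDir g X Y a c) {τ : ℝ} (hτ : 0 < τ) :
    S.IsWallDir g (X + τ * a) (Y + τ * c) a c := by
  have hj := S.inCell_idx X
  set j := S.idx X
  obtain ⟨h1, h2, h3⟩ := h.1 j hj
  refine ⟨fun j' hj' => ?_, ?_, fun σ hσ ha j' hj' => ?_⟩
  · have hm : (a * S.sl j : ℤ) ≤ a * S.sl j' := by exact_mod_cast order_mono hτ hj hj'
    refine ⟨by linarith, fun hY' => ?_, ?_⟩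
    · by_contra hcon
      have h4 : c + a * S.sl j' = 0 := by linarith
      have h5 : c + a * S.sl j = 0 := by linarith
      have h6 : ¬ 0 < Y + S.F X := fun h6 => absurd (h2 h6) (by rw [h5]; simp)
      have h4' : (c : ℝ) + a * S.sl j' = 0 := by exact_mod_cast h4
      have h7 := S.F_ge hj' X
      have h8 : τ * ((c : ℝ) + a * S.sl j') = 0 := by rw [h4', mul_zero]
      apply h6
      nlinarith
    · rw [show c + a * S.sl j' = (c + a * S.sl j) + a * (S.sl j' - S.sl j) by ring]
      exact dvd_add h3 ((dvd_sl_sub hk _ _).mul_left a)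
  · obtain ⟨z, hz⟩ := h.2.1
    exact ⟨z, by rw [← hz]; ring⟩
  · obtain ⟨D, hD, hle⟩ := h.2.2 σ hσ ha j hj
    have hm : (a * S.sl j : ℤ) ≤ a * S.sl j' := by exact_mod_cast order_mono hτ hj hj'
    have hσ2 : (σ : ℝ) * σ = 1 := by rcases hσ with rfl | rfl <;> norm_num
    have ha' : (1 : ℝ) ≤ σ * a := by exact_mod_cast ha
    have h1' : (0 : ℝ) ≤ c + a * S.sl j' := by exact_mod_cast h1.trans (by linarith)
    have hmono : (0 : ℝ) ≤ (a - σ) * (S.sl j' - S.sl j) := by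
      have h4 : (0 : ℝ) ≤ a * (S.sl j' - S.sl j) := by
        have : ((a * S.sl j : ℤ) : ℝ) ≤ (a * S.sl j' : ℤ) := by exact_mod_cast hm
        push_cast at this
        linarith
      have h5 : (0 : ℝ) ≤ σ * (S.sl j' - S.sl j) := by
        by_contra hneg
        push Not at hneg
        nlinarith
      have h6 : ((a : ℝ) - σ) * (S.sl j' - S.sl j) =
          (σ * a - 1) * (σ * (S.sl j' - S.sl j)) := by
        linear_combination (-(a : ℝ) * (S.sl j' - S.sl j)) * hσ2
      rw [h6]
      exact mul_nonneg (by linarith) h5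
    -- the wall moved by `σ * a * τ` to its side, so this has to be added to the distance
    refine ⟨D + σ * a * τ, by positivity, ?_⟩
    rw [show X + τ * a - σ * (D + σ * a * τ) = X - σ * D by
      linear_combination (-(a : ℝ) * τ) * hσ2]
    have h7 : 0 ≤ ((a : ℝ) - σ) * (S.sl j' - S.sl j) * D := mul_nonneg hmono hD
    have h8 : 0 ≤ τ * ((σ * a - 1) * ((c : ℝ) + a * S.sl j')) :=
      mul_nonneg hτ.le (mul_nonneg (by linarith) h1')
    have h9 : (σ : ℝ) * a * τ * (σ * S.sl j') = a * τ * S.sl j' := by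
      linear_combination ((a : ℝ) * τ * S.sl j') * hσ2
    push_cast at hle ⊢
    nlinarith

end DualComplex

namespace DualComplex

variable {S : DualComplex}

/-! ### Edges in flat coordinates -/

theorem toReal_ne_zero {m : ℤ × ℤ} (h : m ≠ 0) : toReal m ≠ 0 := by
  intro h0
  apply h
  have h1 := congrArg Prod.fst h0
  have h2 := congrArg Prod.snd h0
  simp only [toReal, Prod.fst_zero, Prod.snd_zero, Int.cast_eq_zero] at h1 h2
  exact Prod.ext h1 h2

theorem frequently_ne_of_Icc {I : Set ℝ} {t T : ℝ} (hT : t < T) (hI : Icc t T ⊆ I) {p : ℝ → Prop}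
    (hp : ∀ s ∈ Icc t T, p s) : ∃ᶠ s in 𝓝[I] t, s ≠ t ∧ p s := by
  have h1 : ∀ᶠ s in 𝓝[>] t, s ≠ t ∧ p s := by
    filter_upwards [Ioo_mem_nhdsGT hT] with s hs
    exact ⟨hs.1.ne', hp s ⟨hs.1.le, hs.2.le⟩⟩
  have h2 : 𝓝[Ioo t T] t ≤ 𝓝[I] t := nhdsWithin_mono _ (Ioo_subset_Icc_self.trans hI)
  rw [nhdsWithin_Ioo_eq_nhdsGT hT] at h2
  exact h1.frequently.filter_mono h2

/-- A straight path of positive weight has integral velocity in flat coordinates. -/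
theorem IsStraight.exists_velocity {γ : ℝ → ℝ × ℝ} {I : Set ℝ} {w : ℕ} (h : S.IsStraight γ I w)
    (hw : 0 < w) {t : ℝ} (ht : t ∈ I) {X Y : ℝ} (hY : 0 ≤ Y + S.F X) (hx : γ t = S.dev X Y) :
    ∃ j a c : ℤ, (a ≠ 0 ∨ c ≠ 0) ∧ S.Win j X ∧ S.HasVelocity γ I t j (S.dA j a c) := by
  obtain ⟨i, m, hm, hv⟩ := h.2 t ht
  obtain ⟨j, rfl, hj⟩ := hv.exists_win hY hx
  rw [toReal_natCast_smul] at hv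
  obtain ⟨a, c, hac⟩ := S.exists_dA_eq_int j ((w : ℤ) • m)
  refine ⟨j, a, c, ?_, hj, hac ▸ hv⟩
  by_contra hcon
  push Not at hcon
  rw [hcon.1, hcon.2] at hac
  have h0 : (w : ℤ) • m ≠ 0 := by
    refine smul_ne_zero (by exact_mod_cast hw.ne') ?_
    rintro rfl
    simp [isCoprime_zero_left] at hm
  exact toReal_ne_zero h0 (by rw [hac]; simp [dA])

theorem IsStraight.exists_dev {γ : ℝ → ℝ × ℝ} {I : Set ℝ} {w : ℕ} (h : S.IsStraight γ I w)
    {t : ℝ} (ht : t ∈ I) (hg : 1 ≤ S.gauge (γ t)) : ∃ X Y, 0 ≤ Y + S.F X ∧ γ t = S.dev X Y := by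
  obtain ⟨i, m, hm, hv⟩ := h.2 t ht
  obtain ⟨j, hj⟩ : ∃ j : ℤ, (j : ZMod S.n) = i := ⟨i.val, by simp⟩
  subst hj
  obtain ⟨X, Y, -, h1, h2⟩ := S.exists_dev_of_mem_star (hv.mem_star hg) hg
  exact ⟨X, Y, h1, h2⟩

theorem one_le_gauge_dev {X Y : ℝ} (hY : 0 ≤ Y + S.F X) : 1 ≤ S.gauge (S.dev X Y) := by
  rw [S.gauge_dev hY]; linarith

namespace TropicalMap

variable (h : S.TropicalMap)

/-- In flat coordinates near a point with first coordinate `X`, the path from `v` to `w` has initial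
velocity `(a, c)`. -/
def FlatVel (v w : Fin h.m) (X a c : ℝ) : Prop :=
  ∀ i u, S.HasVelocity (h.path v w) (h.dom v w) (h.start v w) i u →
    ∀ j : ℤ, (j : ZMod S.n) = i → S.Win j X → u = S.dA j a c

variable {h}

theorem flatVel_of_lift {v w : Fin h.m} {X Y a c T : ℝ}
    (hT : h.start v w < T) (hI : Icc (h.start v w) T ⊆ h.dom v w)
    (hl : ∀ s ∈ Icc (h.start v w) T, h.path v w s =
      S.dev (X + (s - h.start v w) * a) (Y + (s - h.start v w) * c) ∧
      0 ≤ Y + (s - h.start v w) * c + S.F (X + (s - h.start v w) * a)) :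
    h.FlatVel v w X a c := by
  have h0 := hl _ ⟨le_rfl, hT.le⟩
  simp only [sub_self, zero_mul, add_zero] at h0
  rintro i u hv j rfl hj
  exact S.eq_dA_of_dev hv.2 hj h0.2 h0.1 (frequently_ne_of_Icc hT hI hl)

/-- A path that starts without losing height is affine in flat coordinates. -/
theorem FlatVel.lift {v w : Fin h.m} (hvw : h.G.Adj v w) (hv : h.pos v ≠ none) {X Y a c : ℝ}
    (hY : 0 ≤ Y + S.F X) (hx : h.pos v = some (S.dev X Y)) (hf : h.FlatVel v w X a c) {j : ℤ}
    (hj : S.InCell j X) (hl : 0 ≤ c + a * S.sl j) {s : ℝ} (hs : s ∈ h.dom v w) :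
    h.path v w s = S.dev (X + (s - h.start v w) * a) (Y + (s - h.start v w) * c) ∧
      0 ≤ Y + (s - h.start v w) * c + S.F (X + (s - h.start v w) * a) := by
  have ht := h.start_mem_dom hvw hv
  have hx' := h.path_start v w _ hvw hx
  obtain ⟨i, a', c', -, hi, hvel⟩ :=
    (h.isStraight_dom hvw).exists_velocity (h.weight_pos v w hvw) ht hY hx'
  have hu := hf _ _ hvel i rfl hi
  refine (h.isStraight_dom hvw).lift ((h.ordConnected_dom v w).out ht hs) hvel hi hY hx' hu
    (fun r hr => Or.inr ?_) s ⟨hs.1 hv, le_rfl⟩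
  have := height_le (Y := Y) (c := c) (sub_nonneg.2 hr.1) hj hl
  linarith

theorem flatVel_reverse {v w : Fin h.m} (hvw : h.G.Adj v w) (hw : h.pos w ≠ none)
    {X Y a c t t₀ : ℝ} (ht : t ∈ h.dom v w) (htw : t < -h.start w v)
    (hl : ∀ s ∈ Icc t (-h.start w v), h.path v w s = S.dev (X + (s - t₀) * a) (Y + (s - t₀) * c) ∧
      0 ≤ Y + (s - t₀) * c + S.F (X + (s - t₀) * a)) :
    h.FlatVel w v (X + (-h.start w v - t₀) * a) (-a) (-c) := by
  have hsub := (h.ordConnected_dom v w).out ht (h.neg_start_mem_dom hvw hw)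
  refine flatVel_of_lift (T := -t) (Y := Y + (-h.start w v - t₀) * c) (by linarith)
    (fun s hs => ?_) (fun s hs => ?_)
  · rw [← h.mem_dom_symm]
    exact hsub ⟨by linarith [hs.2], by linarith [hs.1]⟩
  · have hs' : -s ∈ Icc t (-h.start w v) := ⟨by linarith [hs.2], by linarith [hs.1]⟩
    have h1 := hl _ hs'
    rw [← h.path_neg hvw (hsub hs'), neg_neg] at h1
    rw [show X + (-h.start w v - t₀) * a + (s - h.start w v) * -a = X + (-s - t₀) * a by ring,
      show Y + (-h.start w v - t₀) * c + (s - h.start w v) * -c = Y + (-s - t₀) * c by ring]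
    exact h1

/-- The end point and the final velocity of a path that is affine in flat coordinates. -/
theorem FlatVel.at_end {v w : Fin h.m} (hvw : h.G.Adj v w) (hv : h.pos v ≠ none)
    (hw : h.pos w ≠ none) {X Y a c : ℝ} (hY : 0 ≤ Y + S.F X) (hx : h.pos v = some (S.dev X Y))
    (hf : h.FlatVel v w X a c) {j : ℤ} (hj : S.InCell j X) (hl : 0 ≤ c + a * S.sl j) :
    ∃ τ : ℝ, 0 < τ ∧ h.pos w = some (S.dev (X + τ * a) (Y + τ * c)) ∧
      0 ≤ Y + τ * c + S.F (X + τ * a) ∧ h.FlatVel w v (X + τ * a) (-a) (-c) := by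
  have hlt := h.start_lt v w hvw hv hw
  have hs := h.start_mem_dom hvw hv
  have he := h.neg_start_mem_dom hvw hw
  have h1 := hf.lift hvw hv hY hx hj hl he
  obtain ⟨y, hy⟩ := Option.ne_none_iff_exists'.1 hw
  rw [h.path_end hvw hy] at h1
  refine ⟨-h.start w v - h.start v w, by linarith, by rw [hy, h1.1], h1.2, ?_⟩
  exact flatVel_reverse hvw hw hs hlt fun s hr =>
    hf.lift hvw hv hY hx hj hl ((h.ordConnected_dom v w).out hs he hr)

/-- An initial velocity in one chart determines the one in flat coordinates, if the path does not
lose height. -/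
theorem flatVel_of_velocity {v w : Fin h.m} (hvw : h.G.Adj v w) (hv : h.pos v ≠ none) {X Y a c : ℝ}
    (hY : 0 ≤ Y + S.F X) (hx : h.pos v = some (S.dev X Y)) {i : ℤ} (hi : S.Win i X)
    (hvel : S.HasVelocity (h.path v w) (h.dom v w) (h.start v w) i (S.dA i a c)) {j : ℤ}
    (hj : S.InCell j X) (hl : 0 ≤ c + a * S.sl j) : h.FlatVel v w X a c := by
  obtain ⟨T, hT, hsub⟩ := h.exists_dom_near_start hvw hv
  refine flatVel_of_lift hT hsub
    ((h.isStraight_dom hvw).lift hsub hvel hi hY (h.path_start v w _ hvw hx) rfl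
      (fun r hr => Or.inr ?_))
  have := height_le (Y := Y) (c := c) (sub_nonneg.2 hr.1) hj hl
  linarith

variable (h)

/-- The edge from `v` arrives at `w` like a wall that leaves the singularities: the point at `w` is
not in the interior of `σ₀`, and in all its flat coordinates the edge arrives in the direction
of a wall. -/
def IsWall (g : ℤ) (w v : Fin h.m) : Prop :=
  ∃ x, h.pos w = some x ∧ 1 ≤ S.gauge x ∧ ∀ X Y, 0 ≤ Y + S.F X → x = S.dev X Y →
    ∃ a c : ℤ, (a ≠ 0 ∨ c ≠ 0) ∧ S.IsWallDir g X Y a c ∧ h.FlatVel w v X (-a) (-c)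

variable {h}

/-- An edge that leaves a vertex in the direction of a wall arrives as a wall. -/
theorem isWall_of_flatVel {g : ℤ} (hk : ∀ i, g ∣ S.kink i) {v w : Fin h.m} (hvw : h.G.Adj v w)
    {x : ℝ × ℝ} (hv : h.pos v = some x) (hw : h.pos w ≠ none) (hx : 1 ≤ S.gauge x)
    (H : ∀ X Y, 0 ≤ Y + S.F X → x = S.dev X Y →
      ∃ a c : ℤ, S.IsWallDir g X Y a c ∧ h.FlatVel v w X a c) : h.IsWall g w v := by
  have hv' : h.pos v ≠ none := by simp [hv]
  have hs := h.start_mem_dom hvw hv'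
  have he := h.neg_start_mem_dom hvw hw
  have hlt := h.start_lt v w hvw hv' hw
  have hsub := (h.ordConnected_dom v w).out hs he
  have hst := h.isStraight_dom hvw
  obtain ⟨y, hy⟩ := Option.ne_none_iff_exists'.1 hw
  have hge : ∀ s ∈ h.dom v w, 1 ≤ S.gauge (h.path v w s) := by
    obtain ⟨X, Y, hY, hxy⟩ := hst.exists_dev hs (by rwa [h.path_start v w _ hvw hv])
    rw [h.path_start v w _ hvw hv] at hxy
    obtain ⟨a, c, hW, hf⟩ := H X Y hY hxy
    intro s hs
    have h1 := hf.lift hvw hv' hY (hxy ▸ hv) (S.inCell_idx X)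
      (by exact_mod_cast (hW.1 _ (S.inCell_idx X)).1) hs
    rw [h1.1]
    exact one_le_gauge_dev h1.2
  refine ⟨y, hy, by simpa only [h.path_end hvw hy] using hge _ he, fun X Y hY hxy => ?_⟩
  -- follow the edge backwards, from the given lift of its end point
  have hst' := h.isStraight_dom hvw.symm
  have hs' := h.start_mem_dom hvw.symm hw
  obtain ⟨j, a, c, h0, hj, hvel⟩ := hst'.exists_velocity (h.weight_pos w v hvw.symm) hs' hY
    ((h.path_start w v _ hvw.symm hy).trans hxy)
  have hsub' := (h.ordConnected_dom w v).out hs' (h.neg_start_mem_dom hvw.symm hv')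
  have hl := hst'.lift hsub' hvel hj hY ((h.path_start w v _ hvw.symm hy).trans hxy) rfl
    (fun s hs => Or.inl (by
      have h1 := (h.mem_dom_symm (a := v) (b := w) (t := -s)).1 (by rw [neg_neg]; exact hsub' hs)
      have h2 := h.path_neg hvw h1
      rw [neg_neg] at h2
      rw [h2]
      exact hge _ h1))
  have hlt' : h.start w v < -h.start v w := by linarith
  have hf1 : h.FlatVel w v X a c := flatVel_of_lift hlt' hsub' hl
  have hf2 := flatVel_reverse hvw.symm hv' hs' hlt' hl
  have hend := hl _ ⟨hlt'.le, le_rfl⟩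
  rw [h.path_end hvw.symm hv] at hend
  obtain ⟨a', c', hW, hf3⟩ := H _ _ hend.2 hend.1
  obtain ⟨i, b, d, -, hi, hvel'⟩ := hst.exists_velocity (h.weight_pos v w hvw) hs hend.2
    ((h.path_start v w _ hvw hv).trans hend.1)
  obtain ⟨e1, e2⟩ := S.dA_injective ((hf2 _ _ hvel' i rfl hi).symm.trans (hf3 _ _ hvel' i rfl hi))
  have e1' : a = -a' := by have : (a : ℝ) = -a' := by linarith
                           exact_mod_cast this
  have e2' : c = -c' := by have : (c : ℝ) = -c' := by linarith
                           exact_mod_cast this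
  have hm := hW.move hk (τ := -h.start v w - h.start w v) (by linarith)
  rw [← e1, ← e2] at hm
  refine ⟨a', c', by omega, ?_, ?_⟩
  · convert hm using 1 <;> ring
  · rw [← e1, ← e2, neg_neg, neg_neg]
    exact hf1

/-- The velocities at a balanced vertex add up to zero in flat coordinates. -/
theorem IsBalanced.flatVel {v w : Fin h.m} (hb : h.IsBalanced v) (hvw : h.G.Adj v w) {X Y : ℝ}
    (hv : h.pos v = some (S.dev X Y)) (hY : 0 ≤ Y + S.F X) {a c : Fin h.m → ℝ}
    (hac : ∀ k, h.G.Adj v k → k ≠ w → h.FlatVel v k X (a k) (c k))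
    (hac0 : ∀ k, ¬ (h.G.Adj v k ∧ k ≠ w) → a k = 0 ∧ c k = 0) {j : ℤ} (hj : S.InCell j X)
    (hl : 0 ≤ -∑ k, c k + -(∑ k, a k) * S.sl j) :
    h.FlatVel v w X (-∑ k, a k) (-∑ k, c k) := by
  obtain ⟨i, u, h1, h2, h3⟩ := hb
  obtain ⟨j', rfl, hj'⟩ := (h1 w hvw).exists_win hY (h.path_start v w _ hvw hv)
  have hu : ∀ k, k ≠ w → u k = S.dA j' (a k) (c k) := by
    intro k hk
    by_cases hvk : h.G.Adj v k
    · exact hac k hvk hk _ _ (h1 k hvk) j' rfl hj'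
    · obtain ⟨e1, e2⟩ := hac0 k fun h => hvk h.1
      rw [h2 k hvk, e1, e2]
      simp [dA]
  have hw0 := hac0 w fun h => h.2 rfl
  have huw : u w = S.dA j' (-∑ k, a k) (-∑ k, c k) := by
    rw [← Finset.add_sum_erase _ _ (Finset.mem_univ w)] at h3
    rw [← Finset.add_sum_erase _ a (Finset.mem_univ w), hw0.1, zero_add,
      ← Finset.add_sum_erase _ c (Finset.mem_univ w), hw0.2, zero_add,
      eq_neg_of_add_eq_zero_left h3,
      Finset.sum_congr rfl fun k hk => hu k (Finset.ne_of_mem_erase hk)]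
    simp only [dA, Finset.sum_add_distrib, ← Finset.sum_smul, ← Finset.mul_sum]
    module
  exact flatVel_of_velocity hvw (by simp [hv]) hY hv hj' (huw ▸ h1 w hvw) hj hl

end TropicalMap

end DualComplex

/-! ### Walls in a balanced tree -/

section tree

variable {V : Type*} {G : SimpleGraph V}

theorem parent_unique (hG : G.IsTree) {r v u u' : V} (hu : G.Adj v u) (hu' : G.Adj v u')
    (h : G.dist r v = G.dist r u + 1) (h' : G.dist r v = G.dist r u' + 1) : u = u' := by
  have key : ∀ {u : V} (hu : G.Adj u v), G.dist r v = G.dist r u + 1 →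
      ∃ p : G.Walk r v, p.IsPath ∧ p.penultimate = u := by
    intro u hu h
    obtain ⟨p, hp⟩ := hG.1.exists_walk_length_eq_dist r u
    refine ⟨p.concat hu, SimpleGraph.Walk.isPath_of_length_eq_dist _ ?_, by simp⟩
    rw [SimpleGraph.Walk.length_concat, hp, h]
  obtain ⟨p, hp, rfl⟩ := key hu.symm h
  obtain ⟨p', hp', rfl⟩ := key hu'.symm h'
  rw [(hG.existsUnique_path r v).unique hp hp']

theorem exists_parent (hG : G.Connected) {r v : V} (hv : v ≠ r) :
    ∃ u, G.Adj v u ∧ G.dist r v = G.dist r u + 1 := by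
  obtain ⟨p, hp⟩ := hG.exists_walk_length_eq_dist v r
  cases p with
  | nil => exact absurd rfl hv
  | cons hu p =>
    refine ⟨_, hu, ?_⟩
    rw [SimpleGraph.Walk.length_cons] at hp
    have h1 := SimpleGraph.dist_le p
    have h2 := hG.dist_triangle (u := v) (v := _) (w := r) |>.trans
      (Nat.add_le_add_right (SimpleGraph.dist_eq_one_iff_adj.2 hu).le _)
    rw [SimpleGraph.dist_comm (u := r), SimpleGraph.dist_comm (u := r)]
    omega

end tree

namespace DualComplex

variable {S : DualComplex}

theorem IsWallDir.sum {g : ℤ} {X Y : ℝ} {ι : Type*} {s : Finset ι} (hs : s.Nonempty) {a c : ι → ℤ}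
    (h : ∀ k ∈ s, S.IsWallDir g X Y (a k) (c k)) :
    S.IsWallDir g X Y (∑ k ∈ s, a k) (∑ k ∈ s, c k) := by
  induction hs using Finset.Nonempty.cons_induction with
  | singleton k => simpa using h k (by simp)
  | cons k s hk hs ih =>
    rw [Finset.sum_cons, Finset.sum_cons]
    exact (h k (by simp)).add (ih fun l hl => h l (Finset.mem_cons_of_mem hl))

theorem outRay_dev {X Y : ℝ} (hY : 0 ≤ Y + S.F X) (w : ℕ) (s : ℝ) :
    S.outRay (S.dev X Y) w s = S.dev X (Y + s * w) := by
  rw [outRay, S.gauge_dev hY, dev, dev, smul_smul]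
  congr 1
  field_simp
  ring

theorem eq_sg_of_sing_eq_dev {l : ZMod S.n} {X Y : ℝ} (hY : 0 ≤ Y + S.F X)
    (h : S.sing l = S.dev X Y) :
    ∃ m : ℤ, (m : ZMod S.n) = l ∧ X = S.sg m ∧ Y = -S.G m (S.sg m) := by
  obtain ⟨l, rfl⟩ : ∃ m : ℤ, (m : ZMod S.n) = l := ⟨l.val, by simp⟩
  rw [S.sing_eq_dev] at h
  have h0 : 0 ≤ -S.F (S.sg l) + S.F (S.sg l) := by simp
  obtain ⟨h1, h2⟩ := S.cell_unique h0 hY h (S.xs_lt_sg l).le (S.sg_lt_xs l) (S.inCell_idx X).1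
    (S.lt_idx_succ X)
  have hg := S.gauge_dev hY
  rw [← h, S.gauge_dev h0] at hg
  have hX : X = S.sg (S.idx X) := by
    unfold sg at h2 ⊢
    rw [h1] at h2
    linarith
  refine ⟨S.idx X, h1.symm, hX, ?_⟩
  rw [← hX]
  have : S.F X = S.G (S.idx X) X := rfl
  linarith

namespace TropicalMap

variable {h : S.TropicalMap}

/-- At the end point of a bounded leg, the leg goes in the monodromy invariant direction; hence it
keeps its height at first, and its moment is integral. -/
theorem exists_velocity_sing {v w : Fin h.m} (hvw : h.G.Adj v w) {l : ZMod S.n}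
    (hv : h.pos v = some (S.sing l)) {X Y : ℝ} (hY : 0 ≤ Y + S.F X) (hxy : S.sing l = S.dev X Y) :
    ∃ m i a c : ℤ, X = S.sg m ∧ Y + S.F X = 0 ∧ S.Win i X ∧
      S.HasVelocity (h.path v w) (h.dom v w) (h.start v w) i (S.dA i a c) ∧
      c + a * S.sl m = 0 ∧ ∃ z : ℤ, X * c - Y * a = z := by
  obtain ⟨m, rfl, hX, hYm⟩ := eq_sg_of_sing_eq_dev hY hxy
  have hH : Y + S.F X = 0 := by rw [hX, S.F_eq (S.inCell_sg m), hYm]; simp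
  have hst := (h.path_start v w _ hvw hv).trans hxy
  obtain ⟨i, a, c, h0, hi, hvel⟩ := (h.isStraight_dom hvw).exists_velocity
    (h.weight_pos v w hvw) (h.start_mem_dom hvw (by simp [hv])) hY hst
  have hmi : m = i ∨ m = i - 1 := by
    have h4 := S.le_of_xs_lt (i := m) (j := i) ((hX ▸ S.xs_lt_sg m).trans hi.2)
    have h5 := S.le_of_xs_lt (i := i - 1) (j := m) (hi.1.trans (hX ▸ S.sg_lt_xs m))
    omega
  have hα : ∃ α : ℝ, S.dA i a c = S.dA i α (-(S.sl m * α)) := by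
    rcases hvel.1 with h1 | ⟨h1, α, hα⟩
    · rw [hst, S.mem_chartDomain_boundary hi hH, hX] at h1
      rcases hmi with rfl | rfl
      · exact absurd h1.2 (lt_irrefl _)
      · exact absurd h1.1 (lt_irrefl _)
    · obtain ⟨m', e1, e2, -⟩ := eq_sg_of_sing_eq_dev hY (h1.symm.trans hst)
      have e3 : m' = m := by
        rw [hX] at e2
        exact le_antisymm (S.le_of_xs_lt ((e2 ▸ S.xs_lt_sg m').trans (S.sg_lt_xs m)))
          (S.le_of_xs_lt ((S.xs_lt_sg m).trans (e2 ▸ S.sg_lt_xs m')))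
      refine ⟨α, ?_⟩
      rw [hα, ← e1, e3]
      rcases hmi with rfl | rfl
      · simp [dA, dr]
      · have h4 := S.dr_eq_succ (i - 1)
        rw [sub_add_cancel] at h4
        have h5 := S.sl_succ (i - 1)
        rw [sub_add_cancel] at h5
        change α • S.dr (i - 1) = _
        rw [dA, h4, h5]
        push_cast
        module
  obtain ⟨α, hα⟩ := hα
  obtain ⟨rfl, e2⟩ := S.dA_injective hα
  refine ⟨m, i, a, c, hX, hH, hi, hvel, ?_, a * (S.ys m - S.sl m * S.xs m), ?_⟩
  · have e2' : c = -(S.sl m * a) := by exact_mod_cast e2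
    rw [e2']
    ring
  · rw [e2, hYm, hX, DualComplex.G]
    push_cast
    ring

/-- The edge at a bounded leg is a wall. -/
theorem isWall_of_sing {g : ℤ} (hk : ∀ i, g ∣ S.kink i) {v w : Fin h.m} (hvw : h.G.Adj v w)
    {l : ZMod S.n} (hv : h.pos v = some (S.sing l)) (hw : h.pos w ≠ none) : h.IsWall g w v := by
  have hv' : h.pos v ≠ none := by simp [hv]
  refine isWall_of_flatVel hk hvw hv hw ?_ fun X Y hY hxy => ?_
  · obtain ⟨m, rfl⟩ : ∃ m : ℤ, (m : ZMod S.n) = l := ⟨l.val, by simp⟩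
    rw [S.sing_eq_dev]
    exact one_le_gauge_dev (by simp)
  obtain ⟨m, i, a, c, hX, hH, hi, hvel, hc, hz⟩ := exists_velocity_sing hvw hv hY hxy
  have hcell : ∀ j, S.InCell j X → j = m := by
    intro j hj
    rw [hX] at hj
    exact le_antisymm (S.le_of_xs_lt (hj.1.trans_lt (S.sg_lt_xs m)))
      (S.le_of_xs_lt ((S.xs_lt_sg m).trans_le hj.2))
  refine ⟨a, c, ⟨fun j hj => ?_, hz, fun σ hσ ha j hj => ?_⟩, ?_⟩
  · rw [hcell j hj, hc, hH]
    exact ⟨le_rfl, fun h => absurd h (lt_irrefl _), dvd_zero g⟩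
  · exact ⟨0, le_rfl, by simp [hH]⟩
  · exact flatVel_of_velocity hvw hv' hY (hxy ▸ hv) hi hvel (hX ▸ S.inCell_sg m)
      (by exact_mod_cast hc.ge)

/-- The edge that leaves an inner vertex at which all other edges are walls is a wall. -/
theorem isWall_of_inner {g : ℤ} (hk : ∀ i, g ∣ S.kink i) {v w : Fin h.m} (hvw : h.G.Adj v w)
    (hv : h.IsInnerVertex v) (hw : h.pos w ≠ none)
    (H : ∀ k, h.G.Adj v k → k ≠ w → h.IsWall g v k) : h.IsWall g w v := by
  obtain ⟨k₀, hk₀, hk₀w⟩ : ∃ k, h.G.Adj v k ∧ k ≠ w := by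
    obtain ⟨k, hk1, hk2⟩ := Set.exists_mem_notMem_of_ncard_lt_ncard
      (s := {w}) (t := h.G.neighborSet v) (by rw [Set.ncard_singleton]; linarith [hv.1])
    exact ⟨k, hk1, hk2⟩
  obtain ⟨x, hx, hgx, -⟩ := H k₀ hk₀ hk₀w
  refine isWall_of_flatVel hk hvw hx hw hgx fun X Y hY hxy => ?_
  have hac : ∀ k, ∃ a c : ℤ, (h.G.Adj v k ∧ k ≠ w → S.IsWallDir g X Y a c ∧
      h.FlatVel v k X (-a) (-c)) ∧ (¬ (h.G.Adj v k ∧ k ≠ w) → a = 0 ∧ c = 0) := by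
    intro k
    by_cases hk : h.G.Adj v k ∧ k ≠ w
    · obtain ⟨x', hx', -, hW⟩ := H k hk.1 hk.2
      obtain rfl : x = x' := by simpa [hx] using hx'
      obtain ⟨a, c, -, h2⟩ := hW X Y hY hxy
      exact ⟨a, c, fun _ => h2, fun h => absurd hk h⟩
    · exact ⟨0, 0, fun h => absurd h hk, fun _ => ⟨rfl, rfl⟩⟩
  choose a c hW h0 using hac
  classical
  set s : Finset (Fin h.m) := {k | h.G.Adj v k ∧ k ≠ w} with hs
  have hsum := IsWallDir.sum (S := S) (g := g) (X := X) (Y := Y) (s := s)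
    ⟨k₀, by simp [hs, hk₀, hk₀w]⟩ (a := a) (c := c) fun k hk => (hW k (by simpa [hs] using hk)).1
  refine ⟨_, _, hsum, ?_⟩
  have e1 : ∑ k ∈ s, a k = ∑ k, a k := Finset.sum_subset (Finset.subset_univ _) fun k _ hk =>
    (h0 k (by simpa [hs] using hk)).1
  have e2 : ∑ k ∈ s, c k = ∑ k, c k := Finset.sum_subset (Finset.subset_univ _) fun k _ hk =>
    (h0 k (by simpa [hs] using hk)).2
  rw [e1, e2] at hsum ⊢
  have hf := IsBalanced.flatVel hv.2.2 hvw (X := X) (Y := Y) (by rw [hx, hxy]) hY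
    (a := fun k => -(a k : ℝ)) (c := fun k => -(c k : ℝ)) (fun k h1 h2 => (hW k ⟨h1, h2⟩).2)
    (fun k hk => by simp [h0 k hk]) (S.inCell_idx X)
    (by
      simp only [Finset.sum_neg_distrib, neg_neg]
      exact_mod_cast (hsum.1 _ (S.inCell_idx X)).1)
  simpa only [Finset.sum_neg_distrib, neg_neg, Int.cast_sum] using hf

/-- The effect of an inner vertex on the order: a path that arrives from `v₀` interacts with the
walls at the vertex `v`, and leaves to `v₁` with a larger order. -/
theorem exists_wallDir_of_inner {g : ℤ} {v v₀ v₁ : Fin h.m} (hv : h.IsInnerVertex v)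
    (h₁ : h.G.Adj v v₁) (h₀₁ : v₀ ≠ v₁)
    (H : ∀ k, h.G.Adj v k → k ≠ v₀ → k ≠ v₁ → h.IsWall g v k) {X Y a₀ c₀ : ℝ}
    (hx : h.pos v = some (S.dev X Y)) (hY : 0 ≤ Y + S.F X) (hf : h.FlatVel v v₀ X (-a₀) (-c₀))
    (h₀ : h.G.Adj v v₀) {j : ℤ} (hj : S.InCell j X) (hl : 0 ≤ c₀ + a₀ * S.sl j) :
    ∃ a c : ℤ, (a ≠ 0 ∨ c ≠ 0) ∧ S.IsWallDir g X Y a c ∧ ∃ a₁ c₁ : ℝ, h.FlatVel v v₁ X a₁ c₁ ∧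
      ∀ j, S.InCell j X → c₀ + a₀ * S.sl j + (c + a * S.sl j) ≤ c₁ + a₁ * S.sl j := by
  obtain ⟨k₀, hk₀, hk₀'⟩ : ∃ k, h.G.Adj v k ∧ k ∉ ({v₀, v₁} : Set (Fin h.m)) := by
    obtain ⟨k, hk1, hk2⟩ := Set.exists_mem_notMem_of_ncard_lt_ncard
      (s := {v₀, v₁}) (t := h.G.neighborSet v) (by rw [Set.ncard_pair h₀₁]; exact hv.1)
    exact ⟨k, hk1, hk2⟩
  simp only [mem_insert_iff, mem_singleton_iff, not_or] at hk₀'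
  have hac : ∀ k, ∃ a c : ℤ, (h.G.Adj v k ∧ k ≠ v₀ ∧ k ≠ v₁ → (a ≠ 0 ∨ c ≠ 0) ∧
      S.IsWallDir g X Y a c ∧ h.FlatVel v k X (-a) (-c)) ∧
      (¬ (h.G.Adj v k ∧ k ≠ v₀ ∧ k ≠ v₁) → a = 0 ∧ c = 0) := by
    intro k
    by_cases hk : h.G.Adj v k ∧ k ≠ v₀ ∧ k ≠ v₁
    · obtain ⟨x', hx', -, hW⟩ := H k hk.1 hk.2.1 hk.2.2
      obtain ⟨a, c, h2⟩ := hW X Y hY (by simpa [hx] using hx'.symm)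
      exact ⟨a, c, fun _ => h2, fun h => absurd hk h⟩
    · exact ⟨0, 0, fun h => absurd h hk, fun _ => ⟨rfl, rfl⟩⟩
  choose a c hW hac0 using hac
  have hnn : ∀ j, S.InCell j X → ∀ k, 0 ≤ (c k : ℝ) + a k * S.sl j := by
    intro j hj k
    by_cases hk : h.G.Adj v k ∧ k ≠ v₀ ∧ k ≠ v₁
    · exact_mod_cast ((hW k hk).2.1.1 j hj).1
    · simp [hac0 k hk]
  have hsum : ∀ j, S.InCell j X →
      (c k₀ : ℝ) + a k₀ * S.sl j ≤ ∑ k, (c k : ℝ) + (∑ k, (a k : ℝ)) * S.sl j := by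
    intro j hj
    rw [Finset.sum_mul, ← Finset.sum_add_distrib]
    exact Finset.single_le_sum (f := fun k => (c k : ℝ) + a k * S.sl j) (fun k _ => hnn j hj k)
      (Finset.mem_univ k₀)
  have hs : ∀ (x : ℝ) (f : Fin h.m → ℤ),
      -∑ k, ((if k = v₀ then -x else 0) + -(f k : ℝ)) = x + ∑ k, (f k : ℝ) := by
    intro x f
    rw [Finset.sum_add_distrib, Finset.sum_neg_distrib, Finset.sum_ite_eq' Finset.univ v₀]
    simp [add_comm]
  have hk₀3 := hW k₀ ⟨hk₀, hk₀'⟩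
  refine ⟨a k₀, c k₀, hk₀3.1, hk₀3.2.1, a₀ + ∑ k, (a k : ℝ), c₀ + ∑ k, (c k : ℝ), ?_,
    fun j hj => by have := hsum j hj; linarith⟩
  rw [← hs, ← hs]
  refine IsBalanced.flatVel hv.2.2 h₁ hx hY (fun k hk hk1 => ?_) (fun k hk => ?_) hj ?_
  · by_cases hk0 : k = v₀
    · subst hk0
      obtain ⟨e1, e2⟩ := hac0 k fun h => h.2.1 rfl
      simpa [e1, e2] using hf
    · simpa [hk0] using (hW k ⟨hk, hk0, hk1⟩).2.2
  · have hk0 : k ≠ v₀ := by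
      rintro rfl
      exact hk ⟨h₀, h₀₁⟩
    obtain ⟨e1, e2⟩ := hac0 k fun h => hk ⟨h.1, h.2.2⟩
    simp [hk0, e1, e2]
  · rw [hs, hs]
    have h1 := hsum j hj
    have h2 := hnn j hj k₀
    linarith

/-- An unbounded leg that is affine in flat coordinates from some time on goes in the
direction `m_out`. -/
theorem leg_direction {v e : Fin h.m} (hve : h.G.Adj v e) (he : h.pos e = none)
    {X Y a c t₀ T₀ : ℝ}
    (hl : ∀ t, T₀ ≤ t → h.path v e t = S.dev (X + (t - t₀) * a) (Y + (t - t₀) * c) ∧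
      0 ≤ Y + (t - t₀) * c + S.F (X + (t - t₀) * a)) : a = 0 ∧ c = h.weight v e := by
  obtain ⟨T, x, hT, hx, hray⟩ := h.unbounded v e hve he
  have hTx : h.path v e T = x := by simpa [outRay] using hray 0 le_rfl
  obtain ⟨X₀, Y₀, hY₀, hx₀⟩ := (h.isStraight_dom hve).exists_dev (t := T)
    ⟨hT, fun h => absurd he h⟩ (by rw [hTx]; exact hx.le)
  rw [hTx] at hx₀
  set w := h.weight v e
  set T₁ := max T T₀ with hT₁
  have h1 := hl T₁ (le_max_right _ _)
  set X₁ := X + (T₁ - t₀) * a with hX₁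
  set Y₁ := Y + (T₁ - t₀) * c with hY₁
  have hw : (0 : ℝ) ≤ w := Nat.cast_nonneg w
  have hTT : 0 ≤ T₁ - T := sub_nonneg.2 (le_max_left _ _)
  have h2 : ∀ s, 0 ≤ s → S.dev (X₁ + s * a) (Y₁ + s * c) = S.dev X₁ (Y₁ + s * w) ∧
      0 ≤ Y₁ + s * c + S.F (X₁ + s * a) := by
    intro s hs
    have h3 := hl (T₁ + s) (by linarith [le_max_right T T₀])
    have h4 := hray (T₁ - T + s) (by linarith)
    have h5 := hray (T₁ - T) hTT
    rw [hx₀, outRay_dev hY₀] at h4 h5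
    rw [add_sub_cancel, h1.1] at h5
    rw [show T + (T₁ - T + s) = T₁ + s by ring, h3.1,
      show Y₀ + (T₁ - T + s) * w = Y₀ + (T₁ - T) * w + s * w by ring,
      ← outRay_dev (by nlinarith [mul_nonneg hTT hw]), ← h5, outRay_dev h1.2] at h4
    rw [show X₁ + s * a = X + (T₁ + s - t₀) * a by rw [hX₁]; ring,
      show Y₁ + s * c = Y + (T₁ + s - t₀) * c by rw [hY₁]; ring]
    exact ⟨h4, h3.2⟩
  have hwin := S.win_idx X₁
  have h3 := S.eq_dA_of_dev (γ := fun s => S.dev X₁ (Y₁ + s * w)) (I := Ici 0) (t := 0)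
    (u := S.dA (S.idx X₁) 0 w) (a := a) (c := c) (X := X₁) (Y := Y₁) ?_ hwin h1.2 (by simp)
    (frequently_ne_of_Icc one_pos Icc_subset_Ici_self fun s hs => ?_)
  · obtain ⟨e1, e2⟩ := S.dA_injective h3
    exact ⟨e1.symm, e2.symm⟩
  · filter_upwards [self_mem_nhdsWithin] with s hs
    rw [S.chart_dev hwin.1.le hwin.2.le, S.chart_dev hwin.1.le hwin.2.le]
    · simp only [A, dA]
      module
    · simpa using h1.2
    · have : 0 ≤ s * w := mul_nonneg hs hw
      linarith [h1.2]
  · have := h2 s hs.1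
    rw [sub_zero]
    exact ⟨this.1.symm, this.2⟩

end TropicalMap

end DualComplex

/-! ### The path between the two unbounded ends -/

section tree

variable {V : Type*} {G : SimpleGraph V}

theorem exists_between_child (hG : G.Connected) {a b v : V} (hvb : v ≠ b)
    (hv : G.dist a v + G.dist v b = G.dist a b) :
    ∃ k, G.Adj v k ∧ G.dist a k = G.dist a v + 1 ∧ G.dist a k + G.dist k b = G.dist a b := by
  obtain ⟨k, hk, hd⟩ := exists_parent hG hvb
  rw [SimpleGraph.dist_comm (u := b), SimpleGraph.dist_comm (u := b)] at hd
  have h1 := hG.dist_triangle (u := a) (v := k) (w := b)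
  have h2 := hG.dist_triangle (u := a) (v := v) (w := k)
  rw [SimpleGraph.dist_eq_one_iff_adj.2 hk] at h2
  exact ⟨k, hk, by omega, by omega⟩

theorem between_child_unique (hG : G.IsTree) {a b v k k' : V} (hk : G.Adj v k) (hk' : G.Adj v k')
    (hd : G.dist a k = G.dist a v + 1) (hd' : G.dist a k' = G.dist a v + 1)
    (hb : G.dist a k + G.dist k b = G.dist a b) (hb' : G.dist a k' + G.dist k' b = G.dist a b) :
    k = k' := by
  have key : ∀ {k}, G.Adj v k → G.dist a k = G.dist a v + 1 →
      G.dist a k + G.dist k b = G.dist a b → G.dist b v = G.dist b k + 1 := by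
    intro k hk hd hb
    have h1 := hG.1.dist_triangle (u := v) (v := k) (w := b)
    have h2 := hG.1.dist_triangle (u := a) (v := v) (w := b)
    rw [SimpleGraph.dist_eq_one_iff_adj.2 hk] at h1
    rw [SimpleGraph.dist_comm (u := b), SimpleGraph.dist_comm (u := b)]
    omega
  exact parent_unique hG hk hk' (key hk hd hb) (key hk' hd' hb')

theorem between_of_child (hG : G.Connected) {a b v k : V} (hk : G.Adj v k)
    (hd : G.dist a k = G.dist a v + 1) (hb : G.dist a k + G.dist k b = G.dist a b) :
    G.dist a v + G.dist v b = G.dist a b := by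
  have h1 := hG.dist_triangle (u := v) (v := k) (w := b)
  have h2 := hG.dist_triangle (u := a) (v := v) (w := b)
  rw [SimpleGraph.dist_eq_one_iff_adj.2 hk] at h1
  omega

theorem unique_neighbor {v k k' : V} (h : (G.neighborSet v).ncard = 1) (hk : G.Adj v k)
    (hk' : G.Adj v k') : k = k' := by
  obtain ⟨x, hx⟩ := Set.ncard_eq_one.1 h
  have h1 : k ∈ G.neighborSet v := hk
  have h2 : k' ∈ G.neighborSet v := hk'
  rw [hx] at h1 h2
  exact h1.trans h2.symm

end tree

namespace DualComplex

variable {S : DualComplex}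

namespace TropicalMap

variable {h : S.TropicalMap}

/-- The tropical map is a tropical curve with exactly two unbounded legs: that with end `a`, of
weight `p`, and that with end `b`, of weight `q`. -/
structure HasEnds (h : S.TropicalMap) (a b : Fin h.m) (p q : ℕ) : Prop where
  isCurve : h.IsCurve
  ne : a ≠ b
  none_iff : ∀ c, h.pos c = none ↔ c = a ∨ c = b
  weight_left : h.LegWeight a p
  weight_right : h.LegWeight b q

namespace HasEnds

variable {a b : Fin h.m} {p q : ℕ}

theorem symm (H : h.HasEnds a b p q) : h.HasEnds b a q p :=
  ⟨H.isCurve, H.ne.symm, fun c => (H.none_iff c).trans or_comm, H.weight_right, H.weight_left⟩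

theorem ncard_left (H : h.HasEnds a b p q) : (h.G.neighborSet a).ncard = 1 := by
  rcases H.isCurve a with h1 | h1
  · exact h1.1
  · exact absurd ((H.none_iff a).2 (Or.inl rfl)) h1.2.1

theorem weight_eq (H : h.HasEnds a b p q) {v : Fin h.m} (hv : h.G.Adj v a) : h.weight v a = p := by
  obtain ⟨v', h1, h2⟩ := H.weight_left
  rwa [unique_neighbor H.ncard_left hv.symm h1.symm]

theorem pos_ne_none (H : h.HasEnds a b p q) {v : Fin h.m} (hva : v ≠ a) (hvb : v ≠ b) :
    h.pos v ≠ none := by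
  rw [Ne, H.none_iff, not_or]
  exact ⟨hva, hvb⟩

theorem isInnerVertex (H : h.HasEnds a b p q) {v k k' : Fin h.m} (hk : h.G.Adj v k)
    (hk' : h.G.Adj v k') (hkk : k ≠ k') : h.IsInnerVertex v :=
  (H.isCurve v).resolve_left fun h1 => hkk (unique_neighbor h1.1 hk hk')

/-- The edges off the path from `a` to `b` are walls: the branches of the tree behind them have
bounded legs only. -/
theorem isWall (H : h.HasEnds a b p q) {g : ℤ} (hk : ∀ i, g ∣ S.kink i) {v w : Fin h.m}
    (hvw : h.G.Adj v w) (hd : h.G.dist a w = h.G.dist a v + 1)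
    (hw : ¬ h.G.dist a w + h.G.dist w b = h.G.dist a b) (hva : v ≠ a) (hvb : v ≠ b) :
    h.IsWall g v w := by
  set M := Finset.univ.sup (h.G.dist a) with hM
  induction hn : M - h.G.dist a w using Nat.strong_induction_on generalizing v w with
  | _ n ih =>
    have hwa : w ≠ a := by
      rintro rfl
      rw [SimpleGraph.dist_self] at hd
      omega
    have hwb : w ≠ b := by
      rintro rfl
      rw [SimpleGraph.dist_self] at hw
      omega
    have hv0 := H.pos_ne_none hva hvb
    rcases H.isCurve w with h1 | h1
    · obtain ⟨l, hl⟩ := h1.2.resolve_left (H.pos_ne_none hwa hwb)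
      exact isWall_of_sing hk hvw.symm hl hv0
    · refine isWall_of_inner hk hvw.symm h1 hv0 fun k hwk hkv => ?_
      have hd' : h.G.dist a k = h.G.dist a w + 1 := by
        rcases h.tree.dist_eq_dist_add_one_of_adj a hwk with h2 | h2
        · exact absurd (parent_unique h.tree hwk hvw.symm h2 hd) hkv
        · exact h2
      have hle : h.G.dist a k ≤ M := Finset.le_sup (f := h.G.dist a) (Finset.mem_univ k)
      exact ih (M - h.G.dist a k) (by omega) hwk hd'
        (fun hb => hw (between_of_child h.tree.1 hwk hd' hb)) hwa hwb rfl

/-- The edges at an inner vertex on the path from `a` to `b` that are not on this path are walls. -/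
theorem isWall_of_between (H : h.HasEnds a b p q) {g : ℤ} (hk : ∀ i, g ∣ S.kink i)
    {v v₀ v₁ k : Fin h.m} (hva : v ≠ a) (hvb : v ≠ b) (h₀ : h.G.Adj v v₀)
    (hd₀ : h.G.dist a v = h.G.dist a v₀ + 1) (h₁ : h.G.Adj v v₁)
    (hd₁ : h.G.dist a v₁ = h.G.dist a v + 1)
    (hb₁ : h.G.dist a v₁ + h.G.dist v₁ b = h.G.dist a b) (hvk : h.G.Adj v k) (hk₀ : k ≠ v₀)
    (hk₁ : k ≠ v₁) : h.IsWall g v k := by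
  have hd : h.G.dist a k = h.G.dist a v + 1 := by
    rcases h.tree.dist_eq_dist_add_one_of_adj a hvk with h2 | h2
    · exact absurd (parent_unique h.tree hvk h₀ h2 hd₀) hk₀
    · exact h2
  exact H.isWall hk hvk hd (fun hb => hk₁ (between_child_unique h.tree hvk h₁ hd hd₁ hb hb₁))
    hva hvb

/-- On the path from `a` to `b`, the order is at most the weight `q` of the leg at `b`, since the
walls only increase it. -/
theorem order_le (H : h.HasEnds a b p q) {g : ℤ} (hk : ∀ i, g ∣ S.kink i) {v w : Fin h.m}
    (hvw : h.G.Adj v w) (hd : h.G.dist a w = h.G.dist a v + 1)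
    (hw : h.G.dist a w + h.G.dist w b = h.G.dist a b) (hva : v ≠ a) {X Y α κ : ℝ}
    (hx : h.pos v = some (S.dev X Y)) (hY : 0 ≤ Y + S.F X) (hf : h.FlatVel v w X α κ) {j : ℤ}
    (hj : S.InCell j X) : κ + α * S.sl j ≤ q := by
  induction hn : h.G.dist w b generalizing v w X Y α κ j with
  | zero =>
    obtain rfl := h.tree.1.dist_eq_zero_iff.1 hn
    by_contra hcon
    push Not at hcon
    have h0 : (0 : ℝ) ≤ κ + α * S.sl j := (Nat.cast_nonneg q).trans hcon.le
    have hwn := (H.none_iff w).2 (Or.inr rfl)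
    have hvn : h.pos v ≠ none := by simp [hx]
    obtain ⟨e1, e2⟩ := leg_direction hvw hwn (T₀ := h.start v w) fun t ht =>
      hf.lift hvw hvn hY hx hj h0 ⟨fun _ => ht, fun hc => absurd hwn hc⟩
    rw [H.symm.weight_eq hvw] at e2
    rw [e1, e2] at hcon
    linarith
  | succ n ih =>
    have hwa : w ≠ a := by
      rintro rfl
      rw [SimpleGraph.dist_self] at hd
      omega
    have hwb : w ≠ b := by
      rintro rfl
      rw [SimpleGraph.dist_self] at hn
      omega
    by_contra hcon
    push Not at hcon
    have h0 : (0 : ℝ) ≤ κ + α * S.sl j := (Nat.cast_nonneg q).trans hcon.le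
    have hvn : h.pos v ≠ none := by simp [hx]
    obtain ⟨τ, hτ, hx', hY', hf'⟩ := hf.at_end hvw hvn (H.pos_ne_none hwa hwb) hY hx hj h0
    obtain ⟨w₁, hw₁, hd₁, hb₁⟩ := exists_between_child h.tree.1 hwb hw
    have hne : v ≠ w₁ := by
      rintro rfl
      omega
    have hmono : α * S.sl j ≤ α * S.sl (S.idx (X + τ * α)) :=
      order_mono hτ hj (S.inCell_idx _)
    obtain ⟨a', c', -, hW, a₁, c₁, hf₁, hle⟩ := exists_wallDir_of_inner (g := g)
      (H.isInnerVertex hw₁ hvw.symm hne.symm) hw₁ hne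
      (fun k h1 h2 h3 => H.isWall_of_between hk hwa hwb hvw.symm hd hw₁ hd₁ hb₁ h1 h2 h3)
      hx' hY' hf' hvw.symm (S.inCell_idx _) (by linarith)
    have h2 := ih hw₁ hd₁ hb₁ hwa hx' hY' hf₁ (S.inCell_idx _) (by omega)
    have h3 := hle _ (S.inCell_idx _)
    have h4 : (0 : ℝ) ≤ c' + a' * S.sl (S.idx (X + τ * α)) := by
      exact_mod_cast (hW.1 _ (S.inCell_idx _)).1
    linarith

/-- At a general point in an unbounded chamber, the leg of weight `p` goes out in the direction
`m_out`: if it lost height there, it would have to interact later with walls, the orders of which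
add up to at most `q`, but these stay below the chamber. For a straight line without vertices,
either of its two ends may play the role of the leg of weight `p`. -/
theorem exists_outRay (H : h.HasEnds a b p q) (hp : 0 < p) {P : ℝ × ℝ}
    (hP : S.InUnboundedChamber (p + q) P) (hN : P ∉ S.integralLines) (ha : h.LegContains a P) :
    ∃ r r' v t, h.HasEnds r r' p q ∧ h.G.Adj v r ∧ t ∈ h.dom v r ∧
      (h.pos v ≠ none → h.start v r < t) ∧ h.path v r t = P ∧
      ∀ s, 0 ≤ s → h.path v r (t + s) = S.outRay P p s := by
  obtain ⟨g, hg, hk⟩ := S.exists_dvd_kink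
  have hk' := fun i => (hk i).1
  obtain ⟨V, hVa, t, ht, rfl⟩ := ha
  obtain ⟨i₀, hi₀⟩ := hP.exists_mem_openCell
  obtain ⟨X, Y, hY, hXY⟩ := S.exists_dev_of_mem_openCell hi₀
  have hNn : ∀ a c z : ℤ, (a ≠ 0 ∨ c ≠ 0) → X * c - Y * a ≠ z := fun a c z h0 h1 =>
    hN ⟨X, Y, a, c, z, h0, hY.le, hXY, h1⟩
  have hst := h.isStraight_dom hVa
  have hwt := H.weight_eq hVa
  have han := (H.none_iff a).2 (Or.inl rfl)
  obtain ⟨j₁, α, κ, -, hj₁, hvel⟩ := hst.exists_velocity (h.weight_pos V a hVa) ht hY.le hXY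
  have hj := S.inCell_idx X
  set j := S.idx X with hjdef
  have hda : h.G.dist a V = h.G.dist a a + 1 := by
    rw [SimpleGraph.dist_self, SimpleGraph.dist_eq_one_iff_adj.2 hVa.symm]
  have hbV : h.G.dist a V + h.G.dist V b = h.G.dist a b := by
    obtain ⟨k, h1, -, h3⟩ := exists_between_child h.tree.1 H.ne (v := a) (a := a) (b := b)
      (by rw [SimpleGraph.dist_self, zero_add])
    rwa [unique_neighbor H.ncard_left hVa.symm h1]
  have hVa' : V ≠ a := hVa.ne
  -- the data at an inner vertex at the end of the leg
  have hinner : V ≠ b → ∃ v₁, h.IsInnerVertex V ∧ h.G.Adj V v₁ ∧ a ≠ v₁ ∧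
      h.G.dist a v₁ = h.G.dist a V + 1 ∧ h.G.dist a v₁ + h.G.dist v₁ b = h.G.dist a b ∧
      ∀ k, h.G.Adj V k → k ≠ a → k ≠ v₁ → h.IsWall g V k := by
    intro hVb
    obtain ⟨v₁, h1, h2, h3⟩ := exists_between_child h.tree.1 hVb hbV
    have hne : a ≠ v₁ := by
      rintro rfl
      rw [SimpleGraph.dist_self] at h2
      omega
    exact ⟨v₁, H.isInnerVertex hVa h1 hne, h1, hne, h2, h3, fun k hk1 hk2 hk3 =>
      H.isWall_of_between hk' hVa' hVb hVa hda h1 h2 h3 hk1 hk2 hk3⟩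
  -- `P` is not a vertex, since walls have integral moment
  have hstart : h.pos V ≠ none → h.start V a < t := by
    intro hV
    refine (ht.1 hV).lt_of_ne fun heq => ?_
    have hVb : V ≠ b := by
      rintro rfl
      exact hV ((H.none_iff V).2 (Or.inr rfl))
    obtain ⟨v₁, h1, h2, h3, -, -, h6⟩ := hinner hVb
    obtain ⟨k, hk1, hk2⟩ := Set.exists_mem_notMem_of_ncard_lt_ncard
      (s := {a, v₁}) (t := h.G.neighborSet V) (by rw [Set.ncard_pair h3]; exact h1.1)
    simp only [mem_insert_iff, mem_singleton_iff, not_or] at hk2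
    obtain ⟨x, hx, -, hW⟩ := h6 k hk1 hk2.1 hk2.2
    have hxP : x = S.dev X Y := by rw [← hXY, ← heq, h.path_start V a x hVa hx]
    obtain ⟨a', c', h0, hW, -⟩ := hW X Y hY.le hxP
    obtain ⟨z, hz⟩ := hW.2.1
    exact hNn a' c' z h0 hz
  have hright : ∀ t', t ≤ t' → t' ∈ h.dom V a := fun t' ht' =>
    ⟨fun h1 => (ht.1 h1).trans ht', fun h1 => absurd han h1⟩
  have hlift : (∀ s, 0 ≤ s → 0 ≤ Y + s * κ + S.F (X + s * α)) → ∀ t', t ≤ t' →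
      h.path V a t' = S.dev (X + (t' - t) * α) (Y + (t' - t) * κ) ∧
        0 ≤ Y + (t' - t) * κ + S.F (X + (t' - t) * α) := fun hh t' ht' =>
    hst.lift ((h.ordConnected_dom V a).out ht (hright t' ht')) hvel hj₁ hY.le hXY rfl
      (fun s hs => Or.inr (hh _ (sub_nonneg.2 hs.1))) t' ⟨ht', le_rfl⟩
  rcases le_or_gt 0 (κ + α * S.sl j) with hl | hl
  · -- the leg gains height at `P`
    have hl' : (0 : ℝ) ≤ κ + α * S.sl j := by exact_mod_cast hl
    have hL := hlift fun s hs => by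
      have := height_le (Y := Y) hs hj hl'
      linarith
    obtain ⟨e1, e2⟩ := leg_direction hVa han hL
    refine ⟨a, b, V, t, H, hVa, ht, hstart, rfl, fun s hs => ?_⟩
    have := (hL (t + s) (by linarith)).1
    rw [this, hXY, outRay_dev hY.le, e1, e2, hwt]
    congr 1 <;> ring
  · -- the leg loses height at `P`: follow it backwards, to its vertex `V`
    have hl' : (κ : ℝ) + α * S.sl j < 0 := by exact_mod_cast hl
    have hback : ∀ s ∈ h.dom V a, s ≤ t → h.path V a s =
        S.dev (X + (s - t) * α) (Y + (s - t) * κ) ∧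
          0 ≤ Y + (s - t) * κ + S.F (X + (s - t) * α) := by
      intro s hs hst'
      have hrev := hvel.reverse ht (I' := h.dom a V) (γ' := h.path a V)
        (fun r hr => h.mem_dom_symm.1 (by rwa [neg_neg])) (fun r hr => h.path_neg hVa hr)
      have h1 := (h.isStraight_dom hVa.symm).lift (t₀ := -t) (t₁ := -s)
        ((h.ordConnected_dom a V).out (h.mem_dom_symm.2 ht) (h.mem_dom_symm.2 hs)) hrev hj₁ hY.le
        (by rw [h.path_neg hVa ht, hXY]) (a := -α) (c := -κ) (by simp only [dA]; module)
        (fun r hr => Or.inr (by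
          have := height_le (Y := Y) (a := -α) (c := -κ) (τ := r - -t) (by linarith [hr.1]) hj
            (by linarith)
          linarith)) (-s) ⟨by linarith, le_rfl⟩
      rw [h.path_neg hVa hs, show X + (-s - -t) * -(α : ℝ) = X + (s - t) * α by ring,
        show Y + (-s - -t) * -(κ : ℝ) = Y + (s - t) * κ by ring] at h1
      exact h1
    by_cases hVb : V = b
    · subst hVb
      have hVn := (H.none_iff V).2 (Or.inr rfl)
      have hdom : ∀ s, s ∈ h.dom V a := fun s =>
        ⟨fun h1 => absurd hVn h1, fun h1 => absurd han h1⟩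
      have hL : ∀ t', -t ≤ t' → h.path a V t' =
          S.dev (X + (t' - -t) * -α) (Y + (t' - -t) * -κ) ∧
            0 ≤ Y + (t' - -t) * -κ + S.F (X + (t' - -t) * -α) := by
        intro t' ht'
        have h1 := hback (-t') (hdom _) (by linarith)
        rw [← h.path_neg hVa (hdom _), neg_neg] at h1
        rw [show X + (t' - -t) * -(α : ℝ) = X + (-t' - t) * α by ring,
          show Y + (t' - -t) * -(κ : ℝ) = Y + (-t' - t) * κ by ring]
        exact h1
      obtain ⟨e1, e2⟩ := leg_direction hVa.symm hVn hL
      have hw := H.symm.weight_eq hVa.symm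
      have hpq : p = q := by rw [← hwt, ← hw, h.weight_symm a V hVa.symm]
      rw [hw, ← hpq] at e2
      refine ⟨V, a, a, -t, by have := H.symm; rwa [← hpq] at this ⊢, hVa.symm,
        h.mem_dom_symm.2 ht, fun h1 => absurd han h1, h.path_neg hVa ht, fun s hs => ?_⟩
      have := (hL (-t + s) (by linarith)).1
      rw [this, hXY, outRay_dev hY.le, e1, e2]
      congr 1 <;> ring
    exfalso
    obtain ⟨v₁, hVi, hv₁, hne, hd₁, hb₁, hwall⟩ := hinner hVb
    have hVn := H.pos_ne_none hVa' hVb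
    set t₀ := h.start V a with ht₀
    have htt := hstart hVn
    have hs₀ := h.start_mem_dom hVa hVn
    obtain ⟨x, hx⟩ := Option.ne_none_iff_exists'.1 hVn
    obtain ⟨hx', hY'⟩ := hback _ hs₀ htt.le
    rw [h.path_start V a x hVa hx] at hx'
    set X' := X + (t₀ - t) * α with hX'
    set Y' := Y + (t₀ - t) * κ with hYe'
    have hXX' : X' = X + (t - t₀) * -α := by rw [hX']; ring
    have hf : h.FlatVel V a X' (-(-α)) (-(-κ)) := by
      rw [neg_neg, neg_neg]
      refine flatVel_of_lift (Y := Y') htt ((h.ordConnected_dom V a).out hs₀ ht) fun s hs => ?_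
      rw [hX', hYe', ← ht₀, show X + (t₀ - t) * α + (s - t₀) * α = X + (s - t) * α by ring,
        show Y + (t₀ - t) * κ + (s - t₀) * κ = Y + (s - t) * κ by ring]
      exact hback s ((h.ordConnected_dom V a).out hs₀ ht hs) hs.2
    have hj' := S.inCell_idx X'
    set j' := S.idx X'
    have hmono : -(α : ℝ) * S.sl j ≤ -α * S.sl j' :=
      order_mono (sub_pos.2 htt) hj (hXX' ▸ hj')
    have hH' : 0 < Y' + S.F X' := by
      have := height_le (Y := Y) (a := -α) (c := -κ) (sub_pos.2 htt).le hj (by linarith)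
      rw [← hXX'] at this
      rw [hYe']
      linarith
    obtain ⟨a', c', h0, hW, a₁, c₁, hf₁, hle⟩ := exists_wallDir_of_inner hVi hv₁ hne hwall
      (hx' ▸ hx) hY' hf hVa hj' (by linarith)
    have hord : -κ + -α * S.sl j' + (c' + a' * S.sl j') ≤ q := by
      have h1 := (hle j' hj').trans
        (H.order_le hk' hv₁ hd₁ hb₁ hVa' (hx' ▸ hx) hY' hf₁ hj')
      exact_mod_cast h1
    obtain ⟨-, hpos, hdvd⟩ := hW.1 j' hj'
    have hpos := hpos hH'
    have hgle : g ≤ c' + a' * S.sl j' := Int.le_of_dvd hpos hdvd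
    have hmono' : -α * S.sl j ≤ -α * S.sl j' := by exact_mod_cast hmono
    by_cases hα : α = 0
    · -- the walls at `V` come from the side, and `P` is below `V`
      have hXe : X' = X := by rw [hX', hα]; simp
      have hjj : j' = j := by rw [hjdef, ← hXe]
      rw [hjj] at hord hpos hdvd
      rw [hα] at hl hord
      by_cases ha' : a' = 0
      · obtain ⟨z, hz⟩ := hW.2.1
        rw [hXe, ha'] at hz
        exact hNn a' c' z h0 (by rw [ha']; simpa using hz)
      · obtain ⟨σ, hσ, hσa⟩ : ∃ σ : ℤ, (σ = 1 ∨ σ = -1) ∧ 0 < σ * a' := by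
          rcases lt_or_gt_of_ne ha' with h1 | h1
          · exact ⟨-1, Or.inr rfl, by linarith⟩
          · exact ⟨1, Or.inl rfl, by linarith⟩
        have hB := hW.2.2 σ hσ hσa j (hXe ▸ hj)
        rw [hXe] at hB
        refine (hXY ▸ hP).not_below hp hY.le hk hσ hj hpos (Or.inr ⟨hdvd, by linarith⟩)
          (hB.mono ?_ le_rfl)
        have hκ : (κ : ℝ) < 0 := by rw [hα] at hl'; simpa using hl'
        rw [hYe']
        nlinarith
    · -- the leg comes back to `σ₀`, on one side of `P`
      obtain ⟨s, hs, hneg⟩ : ∃ s : ℝ, 0 ≤ s ∧ Y + s * κ + S.F (X + s * α) < 0 := by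
        by_contra hcon
        push Not at hcon
        exact hα (by exact_mod_cast (leg_direction hVa han (hlift hcon)).1)
      obtain ⟨σ, hσ, hσa⟩ : ∃ σ : ℤ, (σ = 1 ∨ σ = -1) ∧ 0 < σ * -α := by
        rcases lt_or_gt_of_ne hα with h1 | h1
        · exact ⟨1, Or.inl rfl, by linarith⟩
        · exact ⟨-1, Or.inr rfl, by linarith⟩
      have hσ2 : (σ : ℝ) * σ = 1 := by rcases hσ with rfl | rfl <;> norm_num
      have hσa' : (1 : ℝ) ≤ σ * -α := by exact_mod_cast hσa
      refine (hXY ▸ hP).not_below hp hY.le hk hσ hj (b := -κ + -α * S.sl j) (by linarith)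
        (Or.inl (by linarith)) ⟨σ * -α * s, by positivity, ?_⟩
      rw [show X - σ * (σ * -α * s) = X + s * α by linear_combination (α * s) * hσ2]
      have h8 : 0 ≤ s * ((σ * -α - 1) * (-(κ : ℝ) + -α * S.sl j)) :=
        mul_nonneg hs (mul_nonneg (by linarith) (by linarith))
      have h9 : (σ : ℝ) * S.sl j * (σ * -α * s) = -α * s * S.sl j := by
        linear_combination (-α * s * S.sl j) * hσ2
      push_cast
      nlinarith

end HasEnds

end TropicalMap

end DualComplex

namespace DualComplex

variable {S : DualComplex}

namespace TropicalMap

variable {h : S.TropicalMap}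

/-! ### Two legs through the same point -/

/-- The moment of an oriented edge is well-defined modulo integers, and changes its sign with the
orientation. -/
theorem exists_moment (h : S.TropicalMap) : ∃ M : Fin h.m → Fin h.m → ℝ,
    (∀ a b, M b a = -M a b) ∧ (∀ a b, ¬ h.G.Adj a b → M a b = 0) ∧
    ∀ a b, h.G.Adj a b → ∀ s ∈ h.dom a b, ∀ i u,
      S.HasVelocity (h.path a b) (h.dom a b) s i u →
      ∃ z : ℤ, wedge (S.chart i (h.path a b s)) u = M a b + z := by
  have h1 : ∀ a b, ∃ μ : ℝ, (¬ h.G.Adj a b → μ = 0) ∧ (h.G.Adj a b → ∀ s ∈ h.dom a b, ∀ i u,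
      S.HasVelocity (h.path a b) (h.dom a b) s i u →
      ∃ z : ℤ, wedge (S.chart i (h.path a b s)) u = μ + z) := by
    intro a b
    by_cases hab : h.G.Adj a b
    · obtain ⟨t, ht⟩ := (h.nontrivial_dom hab).nonempty
      have hst := h.isStraight_dom hab
      obtain ⟨i', m, -, hv'⟩ := hst.2 t ht
      exact ⟨_, fun h => absurd hab h, fun _ s hs i u hv =>
        hst.moment_eq (h.ordConnected_dom a b) (h.nontrivial_dom hab) hs ht hv hv'⟩
    · exact ⟨0, fun _ => rfl, fun h => absurd h hab⟩
  choose μ hμ0 hμ using h1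
  have hanti : ∀ a b, h.G.Adj a b → ∀ s ∈ h.dom a b, ∀ i u,
      S.HasVelocity (h.path a b) (h.dom a b) s i u →
      ∃ z : ℤ, wedge (S.chart i (h.path a b s)) u = -μ b a + z := by
    intro a b hab s hs i u hv
    have hr := hv.reverse hs (I' := h.dom b a) (γ' := h.path b a)
      (fun r hr => h.mem_dom_symm.1 (by rwa [neg_neg])) (fun r hr => h.path_neg hab hr)
    obtain ⟨z, hz⟩ := hμ b a hab.symm _ (h.mem_dom_symm.2 hs) _ _ hr
    rw [h.path_neg hab hs, wedge_neg_right] at hz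
    exact ⟨-z, by push_cast; linarith⟩
  refine ⟨fun a b => if a < b then μ a b else -μ b a, fun a b => ?_, fun a b hab => ?_,
    fun a b hab s hs i u hv => ?_⟩
  · rcases lt_trichotomy a b with h1 | rfl | h1
    · simp [h1, h1.not_gt]
    · simp [hμ0 a a (h.G.loopless.irrefl a)]
    · simp [h1, h1.not_gt]
  · simp [hμ0 a b hab, hμ0 b a fun h => hab h.symm]
  · by_cases h1 : a < b
    · simpa only [h1, if_true] using hμ a b hab s hs i u hv
    · simpa only [h1, if_false] using hanti a b hab s hs i u hv

theorem IsInnerVertex.sum_moment {a : Fin h.m} (ha : h.IsInnerVertex a)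
    {M : Fin h.m → Fin h.m → ℝ} (hM0 : ∀ a b, ¬ h.G.Adj a b → M a b = 0)
    (hM : ∀ a b, h.G.Adj a b → ∀ s ∈ h.dom a b, ∀ i u,
      S.HasVelocity (h.path a b) (h.dom a b) s i u →
      ∃ z : ℤ, wedge (S.chart i (h.path a b s)) u = M a b + z) :
    ∃ z : ℤ, ∑ b, M a b = z := by
  obtain ⟨x, hx⟩ := Option.ne_none_iff_exists'.1 ha.2.1
  obtain ⟨i, u, h1, h2, h3⟩ := ha.2.2
  have hz : ∀ b, ∃ z : ℤ, wedge (S.chart i x) (u b) = M a b + z := by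
    intro b
    by_cases hab : h.G.Adj a b
    · have := hM a b hab _ (h.start_mem_dom hab ha.2.1) _ _ (h1 b hab)
      rwa [h.path_start a b x hab hx] at this
    · exact ⟨0, by rw [h2 b hab, hM0 a b hab, wedge_zero_right]; simp⟩
  choose z hz using hz
  have hlin : ∑ b, wedge (S.chart i x) (u b) = wedge (S.chart i x) (∑ b, u b) := by
    simp only [wedge, Prod.fst_sum, Prod.snd_sum, Finset.mul_sum, Finset.sum_sub_distrib]
  rw [h3, wedge_zero_right, Finset.sum_congr rfl fun b _ => hz b, Finset.sum_add_distrib] at hlin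
  exact ⟨-∑ b, z b, by push_cast; linarith⟩

theorem sum_eq_of_unique_neighbor {a b : Fin h.m} (ha : (h.G.neighborSet a).ncard = 1)
    (hab : h.G.Adj a b) {M : Fin h.m → Fin h.m → ℝ} (hM0 : ∀ a b, ¬ h.G.Adj a b → M a b = 0) :
    ∑ k, M a k = M a b :=
  Finset.sum_eq_single b (fun k _ hk => hM0 a k fun hak => hk (unique_neighbor ha hak hab))
    fun hb => absurd (Finset.mem_univ b) hb

theorem sing_moment {a b : Fin h.m} (hab : h.G.Adj a b) {l : ZMod S.n}
    (ha : h.pos a = some (S.sing l)) {M : Fin h.m → Fin h.m → ℝ}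
    (hM : ∀ a b, h.G.Adj a b → ∀ s ∈ h.dom a b, ∀ i u,
      S.HasVelocity (h.path a b) (h.dom a b) s i u →
      ∃ z : ℤ, wedge (S.chart i (h.path a b s)) u = M a b + z) : ∃ z : ℤ, M a b = z := by
  obtain ⟨X, Y, hY, hxy⟩ : ∃ X Y, 0 ≤ Y + S.F X ∧ S.sing l = S.dev X Y := by
    obtain ⟨m, rfl⟩ : ∃ m : ℤ, (m : ZMod S.n) = l := ⟨l.val, by simp⟩
    exact ⟨_, _, by simp, S.sing_eq_dev m⟩
  obtain ⟨m, i, a', c', hX, hH, hi, hvel, -, z, hz⟩ := exists_velocity_sing hab ha hY hxy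
  obtain ⟨z', hz'⟩ := hM a b hab _ (h.start_mem_dom hab (by simp [ha])) _ _ hvel
  rw [h.path_start a b _ hab ha, hxy, S.chart_dev hi.1.le hi.2.le hY, S.wedge_A_dA, hz] at hz'
  exact ⟨a' + S.ys i * a' + S.xs i * c' - z - z', by push_cast; linarith⟩

/-- The velocity of a leg that passes a point in the direction `m_out`. -/
theorem exists_velocity_outRay {v r : Fin h.m} (hvr : h.G.Adj v r) {X Y : ℝ} (hY : 0 < Y + S.F X)
    {p : ℕ} {t : ℝ} (hr : h.pos r = none) (ht : t ∈ h.dom v r)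
    (hray : ∀ s, 0 ≤ s → h.path v r (t + s) = S.outRay (S.dev X Y) p s) :
    ∃ j : ℤ, S.Win j X ∧ S.HasVelocity (h.path v r) (h.dom v r) t j (S.dA j 0 p) := by
  have hx : h.path v r t = S.dev X Y := by simpa [outRay] using hray 0 le_rfl
  obtain ⟨j, a, c, -, hj, hvel⟩ := (h.isStraight_dom hvr).exists_velocity (h.weight_pos v r hvr) ht
    hY.le hx
  have hl : ∀ s ∈ Icc t (t + 1), h.path v r s = S.dev (X + (s - t) * 0) (Y + (s - t) * p) ∧
      0 ≤ Y + (s - t) * p + S.F (X + (s - t) * 0) := by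
    intro s hs
    have h2 := hray (s - t) (sub_nonneg.2 hs.1)
    rw [add_sub_cancel, outRay_dev hY.le] at h2
    rw [mul_zero, add_zero]
    have := mul_nonneg (sub_nonneg.2 hs.1) (Nat.cast_nonneg (α := ℝ) p)
    exact ⟨h2, by linarith⟩
  have h1 : S.dA j a c = S.dA j 0 p := S.eq_dA_of_dev hvel.2 hj hY.le hx
    (frequently_ne_of_Icc (I := h.dom v r) (by linarith)
      (fun s hs => ⟨fun h1 => (ht.1 h1).trans hs.1, fun h1 => absurd hr h1⟩) hl)
  exact ⟨j, hj, h1 ▸ hvel⟩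

/-- The moment of a leg that passes a point in the direction `m_out`. -/
theorem outRay_moment {v r : Fin h.m} (hvr : h.G.Adj v r) {X Y : ℝ} (hY : 0 < Y + S.F X) {p : ℕ}
    {t : ℝ} (hr : h.pos r = none) (ht : t ∈ h.dom v r)
    (hray : ∀ s, 0 ≤ s → h.path v r (t + s) = S.outRay (S.dev X Y) p s)
    {M : Fin h.m → Fin h.m → ℝ}
    (hM : ∀ a b, h.G.Adj a b → ∀ s ∈ h.dom a b, ∀ i u,
      S.HasVelocity (h.path a b) (h.dom a b) s i u →
      ∃ z : ℤ, wedge (S.chart i (h.path a b s)) u = M a b + z) :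
    ∃ z : ℤ, M v r = -(p * X) + z := by
  have hx : h.path v r t = S.dev X Y := by simpa [outRay] using hray 0 le_rfl
  obtain ⟨j, hj, hvel⟩ := exists_velocity_outRay hvr hY hr ht hray
  obtain ⟨z, hz⟩ := hM v r hvr t ht _ _ hvel
  rw [hx, S.chart_dev hj.1.le hj.2.le hY.le, S.wedge_A_dA] at hz
  exact ⟨S.xs j * p - z, by push_cast; linarith⟩

/-- If both unbounded legs pass the same point in the direction `m_out`, with the same weight `p`,
then twice their moment is integral, since all moments add up to zero. -/
theorem HasEnds.mem_integralLines {r r' v v' : Fin h.m} {p p₁ p₂ : ℕ} (H : h.HasEnds r r' p₁ p₂)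
    (hp : 0 < p) {X Y : ℝ} (hY : 0 < Y + S.F X) {t t' : ℝ} (hv : h.G.Adj v r)
    (ht : t ∈ h.dom v r)
    (hray : ∀ s, 0 ≤ s → h.path v r (t + s) = S.outRay (S.dev X Y) p s) (hv' : h.G.Adj v' r')
    (ht' : t' ∈ h.dom v' r')
    (hray' : ∀ s, 0 ≤ s → h.path v' r' (t' + s) = S.outRay (S.dev X Y) p s) :
    S.dev X Y ∈ S.integralLines := by
  obtain ⟨M, hanti, hM0, hM⟩ := h.exists_moment
  obtain ⟨z₁, hz₁⟩ := outRay_moment hv hY ((H.none_iff r).2 (Or.inl rfl)) ht hray hM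
  obtain ⟨z₂, hz₂⟩ := outRay_moment hv' hY ((H.none_iff r').2 (Or.inr rfl)) ht' hray' hM
  have hsum : ∑ a, ∑ b, M a b = 0 := by
    have h1 : ∑ a, ∑ b, M a b = -∑ a, ∑ b, M a b := by
      conv_lhs => rw [Finset.sum_comm]
      simp only [← Finset.sum_neg_distrib]
      exact Finset.sum_congr rfl fun a _ => Finset.sum_congr rfl fun b _ => hanti a b
    linarith
  have hint : ∀ a, ∃ z : ℤ, a ≠ r → a ≠ r' → ∑ b, M a b = z := by
    intro a
    by_cases h1 : a = r ∨ a = r'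
    · exact ⟨0, fun h2 h3 => absurd h1 (by simp [h2, h3])⟩
    · rw [not_or] at h1
      rcases H.isCurve a with h2 | h2
      · obtain ⟨b, hb⟩ : ∃ b, h.G.Adj a b := by
          obtain ⟨b, hb⟩ := Set.ncard_eq_one.1 h2.1
          exact ⟨b, by rw [← SimpleGraph.mem_neighborSet, hb]; rfl⟩
        obtain ⟨l, hl⟩ := h2.2.resolve_left (H.pos_ne_none h1.1 h1.2)
        obtain ⟨z, hz⟩ := sing_moment hb hl hM
        exact ⟨z, fun _ _ => by rw [sum_eq_of_unique_neighbor h2.1 hb hM0, hz]⟩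
      · obtain ⟨z, hz⟩ := h2.sum_moment hM0 hM
        exact ⟨z, fun _ _ => hz⟩
  choose z hz using hint
  rw [← Finset.add_sum_erase _ _ (Finset.mem_univ r), ← Finset.add_sum_erase (Finset.univ.erase r) _
    (Finset.mem_erase.2 ⟨H.ne.symm, Finset.mem_univ r'⟩),
    Finset.sum_congr rfl fun a ha => hz a (Finset.ne_of_mem_erase (Finset.mem_of_mem_erase ha))
      (Finset.ne_of_mem_erase ha),
    sum_eq_of_unique_neighbor H.ncard_left hv.symm hM0,
    sum_eq_of_unique_neighbor H.symm.ncard_left hv'.symm hM0, hanti v r, hanti v' r', hz₁, hz₂]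
    at hsum
  refine ⟨X, Y, 0, 2 * p, z₁ + z₂ - ∑ a ∈ (Finset.univ.erase r).erase r', z a, Or.inr (by
    exact_mod_cast (by omega)), hY.le, rfl, ?_⟩
  push_cast
  linarith

end TropicalMap

end DualComplex

namespace DualComplex

variable {S : DualComplex}

/-! ### Prolonging paths and replacing edges -/

theorem HasVelocity.congr {γ γ' : ℝ → ℝ × ℝ} {I I' : Set ℝ} {t : ℝ} {i : ZMod S.n} {c : ℝ × ℝ}
    (h : S.HasVelocity γ I t i c) (ht : γ' t = γ t)
    (h' : ∀ᶠ s in 𝓝[I'] t, s ∈ I ∧ γ' s = γ s) : S.HasVelocity γ' I' t i c := by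
  have hle : 𝓝[I'] t ≤ 𝓝[I] t :=
    le_inf nhdsWithin_le_nhds (le_principal_iff.2 (h'.mono fun s hs => hs.1))
  refine ⟨by rw [ht]; exact h.1, ?_⟩
  filter_upwards [h', hle h.2] with s hs hs'
  rw [hs.2, ht, hs']

theorem IsStraight.reverse {γ : ℝ → ℝ × ℝ} {I I' : Set ℝ} {w : ℕ} (h : S.IsStraight γ I w)
    (hI : ∀ s ∈ I', -s ∈ I) : S.IsStraight (fun s => γ (-s)) I' w := by
  refine ⟨h.1.comp continuous_neg.continuousOn hI, fun t ht => ?_⟩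
  obtain ⟨i, m, hm, hv⟩ := h.2 _ (hI t ht)
  have hr := hv.reverse (γ' := fun s => γ (-s)) (hI t ht) hI fun s _ => by rw [neg_neg]
  rw [neg_neg] at hr
  refine ⟨i, -m, hm.neg_neg, ?_⟩
  have : (w : ℝ) • toReal (-m) = -((w : ℝ) • toReal m) := by
    simp only [toReal, Prod.fst_neg, Prod.snd_neg, Int.cast_neg, ← smul_neg]
    rfl
  rwa [this]

theorem isCoprime_v (i : ZMod S.n) : IsCoprime (S.v i).1 (S.v i).2 := by
  refine ⟨(S.e i).2, -(S.e i).1, ?_⟩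
  have := S.distance_one i
  unfold wedge at this
  linarith

theorem eq_of_smul_eq_of_isCoprime {w p : ℕ} {m v : ℤ × ℤ}
    (hm : IsCoprime m.1 m.2) (hv : IsCoprime v.1 v.2)
    (h : (w : ℤ) • m = (p : ℤ) • v) : w = p := by
  obtain ⟨x, y, hxy⟩ := hm
  obtain ⟨x', y', hxy'⟩ := hv
  have h1 := congrArg Prod.fst h
  have h2 := congrArg Prod.snd h
  simp only [Prod.smul_fst, Prod.smul_snd, smul_eq_mul] at h1 h2
  have hw : (p : ℤ) ∣ w :=
    ⟨x * v.1 + y * v.2, by linear_combination (-w : ℤ) * hxy + x * h1 + y * h2⟩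
  have hp : (w : ℤ) ∣ p :=
    ⟨x' * m.1 + y' * m.2, by linear_combination (-p : ℤ) * hxy' - x' * h1 - y' * h2⟩
  exact Nat.dvd_antisymm (Int.natCast_dvd_natCast.1 hp) (Int.natCast_dvd_natCast.1 hw)

/-- A vertical line in flat coordinates is straight. -/
theorem isStraight_vertical {X Y t₀ : ℝ} {p : ℕ} {I : Set ℝ}
    (hI : ∀ s ∈ I, 0 < Y + (s - t₀) * p + S.F X) :
    S.IsStraight (fun s => S.dev X (Y + (s - t₀) * p)) I p := by
  refine ⟨(S.continuous_dev.comp (g := fun p : ℝ × ℝ => S.dev p.1 p.2)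
    (f := fun s : ℝ => (X, Y + (s - t₀) * p)) (by fun_prop)).continuousOn, fun t ht => ?_⟩
  refine ⟨(S.idx X : ℤ), S.v (S.idx X : ℤ), isCoprime_v _, ?_⟩
  have hw := S.win_idx X
  have hv := hasVelocity_dev (I := I) (X := X) (Y := Y - t₀ * p) (a := 0) (c := p) (t := t)
    (j := S.idx X) (fun s hs => by have := hI s hs; rw [mul_zero, add_zero]; linarith) ht
    (by rwa [mul_zero, add_zero])
    (Or.inl (dev_mem_chartDomain (by rwa [mul_zero, add_zero]) (by
      have := hI t ht; rw [mul_zero, add_zero]; linarith)))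
  simp only [mul_zero, add_zero] at hv
  convert hv using 1
  · ext s : 1
    congr 1
    ring
  · simp [dA, vt, vtx]

/-- A straight path that arrives at a point of positive height in the direction `m_out` can be
prolonged by a ray. -/
theorem IsStraight.prolong {γ : ℝ → ℝ × ℝ} {I : Set ℝ} {p : ℕ} (h : S.IsStraight γ I p) {X Y T : ℝ}
    (hY : 0 < Y + S.F X) (hT : T ∈ I) (hx : γ T = S.dev X Y) {j : ℤ}
    (hj : S.Win j X) (hv : S.HasVelocity γ I T j (S.dA j 0 p)) {I' : Set ℝ}
    (hI' : ∀ s ∈ I', s ≤ T → s ∈ I) :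
    S.IsStraight (fun s => if s ≤ T then γ s else S.outRay (S.dev X Y) p (s - T)) I' p := by
  set γ' := fun s => if s ≤ T then γ s else S.outRay (S.dev X Y) p (s - T) with hγ'
  set δ := fun s => S.dev X (Y + (s - T) * p) with hδ
  have hright : ∀ s, T ≤ s → γ' s = δ s := by
    intro s hs
    rcases hs.lt_or_eq with h1 | rfl
    · simp only [hγ', h1.not_ge, if_false, hδ, outRay_dev hY.le]
    · simp [hγ', hδ, hx]
  have hpos : ∀ᶠ s in 𝓝 T, 0 < Y + (s - T) * p + S.F X := by
    have h1 : Continuous fun s : ℝ => Y + (s - T) * p + S.F X := by fun_prop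
    exact (h1.tendsto T).eventually (lt_mem_nhds (by simpa using hY))
  have hgerm := hv.germ (h.continuousWithinAt hT) hj hY.le hx rfl
  simp only [mul_zero, add_zero] at hgerm
  have hleft : ∀ᶠ s in 𝓝[I] T, γ s = δ s := by
    filter_upwards [hgerm, nhdsWithin_le_nhds hpos] with s h1 h2
    exact (h1 (Or.inr h2.le)).1
  -- near the point of prolongation and beyond it, the new path is vertical
  have hloc : ∀ t, T ≤ t → ∀ᶠ s in 𝓝[I'] t, γ' s = δ s ∧ 0 < Y + (s - T) * p + S.F X := by
    intro t ht
    rcases ht.lt_or_eq with h1 | rfl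
    · filter_upwards [nhdsWithin_le_nhds (lt_mem_nhds h1)] with s hs
      refine ⟨hright s hs.le, ?_⟩
      have : 0 ≤ (s - T) * p := mul_nonneg (sub_pos.2 hs).le (Nat.cast_nonneg p)
      linarith
    · rw [eventually_nhdsWithin_iff] at hleft ⊢
      filter_upwards [hleft, hpos] with s h1 h2 hs
      refine ⟨?_, h2⟩
      rcases le_or_gt s T with h3 | h3
      · rw [← h1 (hI' s hs h3)]
        simp [hγ', h3]
      · exact hright s h3.le
  have hS := isStraight_vertical (S := S) (X := X) (Y := Y) (t₀ := T) (p := p)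
    (I := {s | 0 < Y + (s - T) * p + S.F X}) fun s hs => hs
  have hmem : ∀ t, T ≤ t → t ∈ {s | 0 < Y + (s - T) * p + S.F X} := by
    intro t ht
    have : 0 ≤ (t - T) * p := mul_nonneg (sub_nonneg.2 ht) (Nat.cast_nonneg p)
    simp only [mem_ofPred_eq]
    linarith
  have hlt : ∀ t ∈ I', t < T → ∀ᶠ s in 𝓝[I'] t, s ∈ I ∧ γ' s = γ s := by
    intro t ht htT
    filter_upwards [nhdsWithin_le_nhds (gt_mem_nhds htT), self_mem_nhdsWithin] with s h1 h2
    exact ⟨hI' s h2 h1.le, by simp [hγ', h1.le]⟩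
  refine ⟨fun t ht => ?_, fun t ht => ?_⟩
  · rcases lt_or_ge t T with h1 | h1
    · have hle : 𝓝[I'] t ≤ 𝓝[I] t := le_inf nhdsWithin_le_nhds
        (le_principal_iff.2 ((hlt t ht h1).mono fun s hs => hs.1))
      have h2 := (h.continuousWithinAt (hI' t ht h1.le)).tendsto.mono_left hle
      rw [← (show γ' t = γ t by simp [hγ', h1.le])] at h2
      exact h2.congr' ((hlt t ht h1).mono fun s hs => hs.2.symm)
    · have h2 : ContinuousWithinAt δ I' t :=
        (S.continuous_dev.comp (g := fun p : ℝ × ℝ => S.dev p.1 p.2)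
          (f := fun s : ℝ => (X, Y + (s - T) * p)) (by fun_prop)).continuousWithinAt
      exact h2.congr_of_eventuallyEq ((hloc t h1).mono fun s hs => hs.1) (hright t h1)
  · rcases lt_or_ge t T with h1 | h1
    · obtain ⟨i, m, hm, hvel⟩ := h.2 t (hI' t ht h1.le)
      exact ⟨i, m, hm, hvel.congr (by simp [hγ', h1.le]) (hlt t ht h1)⟩
    · obtain ⟨i, m, hm, hvel⟩ := hS.2 t (hmem t h1)
      exact ⟨i, m, hm, hvel.congr (hright t h1) ((hloc t h1).mono fun s hs => ⟨hs.2, hs.1⟩)⟩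

namespace TropicalMap

/-- Data for a replacement of the edge between a vertex `v` and a univalent vertex `r`, which does
not change it near `v`: the new position `pos` of `r`, the new path `path` from `v` to `r`, and the
new starting time `start` of the reversed path. -/
structure NewEdge (h : S.TropicalMap) (v r : Fin h.m) where
  pos : Option (ℝ × ℝ)
  start : ℝ
  path : ℝ → ℝ × ℝ
  adj : h.G.Adj v r
  leaf : (h.G.neighborSet r).ncard = 1
  start_lt : h.pos v ≠ none → pos ≠ none → h.start v r < -start
  path_start : ∀ x, h.pos v = some x → path (h.start v r) = x
  path_end : ∀ x, pos = some x → path (-start) = x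
  straight : S.IsStraight path
    {t | (h.pos v ≠ none → h.start v r ≤ t) ∧ (pos ≠ none → t ≤ -start)} (h.weight v r)
  unbounded : pos = none → ∃ (T : ℝ) (x : ℝ × ℝ), (h.pos v ≠ none → h.start v r ≤ T) ∧
    1 < S.gauge x ∧ ∀ s, 0 ≤ s → path (T + s) = S.outRay x (h.weight v r) s
  unbounded' : h.pos v = none → ∃ (T : ℝ) (x : ℝ × ℝ), (pos ≠ none → start ≤ T) ∧
    1 < S.gauge x ∧ ∀ s, 0 ≤ s → path (-(T + s)) = S.outRay x (h.weight v r) s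
  near : h.pos v ≠ none →
    ∀ᶠ s in 𝓝[{t | (h.pos v ≠ none → h.start v r ≤ t) ∧ (pos ≠ none → t ≤ -start)}] (h.start v r),
      s ∈ h.dom v r ∧ path s = h.path v r s

namespace NewEdge

variable {h : S.TropicalMap} {v r : Fin h.m} (E : h.NewEdge v r)

/-- The tropical map with the edge between `v` and `r` replaced. -/
def map : S.TropicalMap where
  m := h.m
  G := h.G
  tree := h.tree
  pos a := if a = r then E.pos else h.pos a
  weight := h.weight
  start a b := if a = r then E.start else h.start a b
  path a b := if a = r then fun s => E.path (-s) else if b = r then E.path else h.path a b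
  weight_pos := h.weight_pos
  weight_symm := h.weight_symm
  start_lt a b hab := by
    have hne := E.adj.ne
    by_cases ha : a = r
    · subst ha
      obtain rfl := unique_neighbor E.leaf E.adj.symm hab
      simp only [if_true, hne, if_false]
      exact fun h1 h2 => by linarith [E.start_lt h2 h1]
    · by_cases hb : b = r
      · subst hb
        obtain rfl := unique_neighbor E.leaf E.adj.symm hab.symm
        simp only [if_true, hne, if_false]
        exact E.start_lt
      · simp only [ha, hb, if_false]
        exact h.start_lt a b hab
  path_start a b x hab := by
    by_cases ha : a = r
    · subst ha
      simp only [if_true]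
      exact E.path_end x
    · by_cases hb : b = r
      · subst hb
        obtain rfl := unique_neighbor E.leaf E.adj.symm hab.symm
        simp only [ha, if_false, if_true]
        exact E.path_start x
      · simp only [ha, hb, if_false]
        exact h.path_start a b x hab
  path_symm a b t hab := by
    by_cases ha : a = r
    · subst ha
      simp [hab.ne.symm]
    · by_cases hb : b = r
      · subst hb
        simp [ha]
      · simp only [ha, hb, if_false]
        exact h.path_symm a b t hab
  straight a b hab := by
    have hne := E.adj.ne
    by_cases ha : a = r
    · subst ha
      obtain rfl := unique_neighbor E.leaf E.adj.symm hab
      simp only [if_true, hne, if_false]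
      rw [h.weight_symm v a hab.symm]
      refine E.straight.reverse fun s hs => ⟨fun h1 => by linarith [hs.2 h1],
        fun h1 => by linarith [hs.1 h1]⟩
    · by_cases hb : b = r
      · subst hb
        obtain rfl := unique_neighbor E.leaf E.adj.symm hab.symm
        simp only [if_true, hne, if_false]
        exact E.straight
      · simp only [ha, hb, if_false]
        exact h.straight a b hab
  unbounded a b hab := by
    have hne := E.adj.ne
    by_cases ha : a = r
    · subst ha
      obtain rfl := unique_neighbor E.leaf E.adj.symm hab
      simp only [if_true, hne, if_false]
      rw [h.weight_symm v a hab.symm]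
      exact E.unbounded'
    · by_cases hb : b = r
      · subst hb
        obtain rfl := unique_neighbor E.leaf E.adj.symm hab.symm
        simp only [if_true, hne, if_false]
        exact E.unbounded
      · simp only [ha, hb, if_false]
        exact h.unbounded a b hab

theorem map_pos_of_ne {a : Fin h.m} (ha : a ≠ r) : E.map.pos a = h.pos a := if_neg ha

theorem map_pos_self : E.map.pos r = E.pos := if_pos rfl

theorem map_start_self (b : Fin h.m) : E.map.start r b = E.start := if_pos rfl

theorem map_path_right : E.map.path v r = E.path := by
  simp [map, E.adj.ne]

theorem map_path_left (b : Fin h.m) : E.map.path r b = fun s => E.path (-s) := by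
  simp [map]

theorem map_path_of_ne {a b : Fin h.m} (ha : a ≠ r) (hb : b ≠ r) :
    E.map.path a b = h.path a b := by
  simp [map, ha, hb]

theorem map_dom_of_ne {a b : Fin h.m} (ha : a ≠ r) (hb : b ≠ r) : E.map.dom a b = h.dom a b := by
  simp [map, dom, ha, hb]

theorem map_dom_right : E.map.dom v r =
    {t | (h.pos v ≠ none → h.start v r ≤ t) ∧ (E.pos ≠ none → t ≤ -E.start)} := by
  simp [map, dom, E.adj.ne]

theorem sameEdge {a b : Fin h.m} (ha : a ≠ r) (hb : b ≠ r) : h.SameEdge a b E.map a b :=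
  ⟨0, fun t => by rw [E.map_dom_of_ne ha hb, E.map_path_of_ne ha hb, add_zero]; simp⟩

theorem isLegEnd_or {a : Fin h.m} (ha : a ≠ r) (H : h.IsLegEnd a ∨ h.IsInnerVertex a) :
    E.map.IsLegEnd a ∨ E.map.IsInnerVertex a := by
  refine H.imp (fun H => ⟨H.1, by rw [E.map_pos_of_ne ha]; exact H.2⟩) fun H => ?_
  obtain ⟨i, u, h1, h2, h3⟩ := H.2.2
  have key : ∀ b : Fin h.m, h.G.Adj a b →
      S.HasVelocity (E.map.path a b) (E.map.dom a b) (h.start a b) i (u b) := ?_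
  · refine ⟨H.1, by rw [E.map_pos_of_ne ha]; exact H.2.1, i, u, fun b hab => ?_, h2, h3⟩
    rw [show E.map.start a b = h.start a b from if_neg ha]
    exact key b hab
  intro b hab
  by_cases hb : b = r
  · subst hb
    obtain rfl := unique_neighbor E.leaf E.adj.symm hab.symm
    rw [E.map_path_right, E.map_dom_right]
    obtain ⟨x, hx⟩ := Option.ne_none_iff_exists'.1 H.2.1
    exact (h1 b E.adj).congr (by rw [E.path_start x hx, h.path_start v b x E.adj hx])
      (E.near H.2.1)
  · rw [E.map_path_of_ne ha hb, E.map_dom_of_ne ha hb]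
    exact h1 b hab

end NewEdge

end TropicalMap

end DualComplex

namespace DualComplex

variable {S : DualComplex}

/-! ### Completing disks and cutting curves -/

theorem outRay_zero (x : ℝ × ℝ) (w : ℕ) : S.outRay x w 0 = x := by simp [outRay]

theorem isCompletedTo_of_eq {p q : ℕ} {P : ℝ × ℝ} (d : S.Disk p q P) (h : S.Curve p q P)
    (f : d.map.G ≃g h.map.G) {v : Fin d.map.m} (hv : d.map.G.Adj v d.root)
    (h1 : h.map.pos (f d.root) = none) (h2 : ∀ a, a ≠ d.root → h.map.pos (f a) = d.map.pos a)
    (h3 : ∀ a b, a ≠ d.root → b ≠ d.root → d.map.SameEdge a b h.map (f a) (f b))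
    (h4 : ∀ t, t ∈ h.map.dom (f v) (f d.root) ↔
      t ∈ d.map.dom v d.root ∨ -d.map.start d.root v ≤ t)
    (h5 : ∀ t ∈ d.map.dom v d.root, h.map.path (f v) (f d.root) t = d.map.path v d.root t)
    (h6 : ∀ s, 0 ≤ s →
      h.map.path (f v) (f d.root) (-d.map.start d.root v + s) = S.outRay P p s) :
    d.IsCompletedTo h := by
  refine ⟨f, h1, h2, fun a b _ => h3 a b, fun a ha => ⟨0, ?_⟩⟩
  obtain rfl := unique_neighbor d.isDisk.1 hv.symm ha.symm
  simpa only [add_zero] using ⟨h4, h5, h6⟩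

namespace Disk

variable {p q : ℕ} {X Y : ℝ}

/-- The final edge of a disk arrives in the direction `m_out`, and has weight `p`. -/
theorem exists_velocity (d : S.Disk p q (S.dev X Y)) (hY : 0 < Y + S.F X) :
    ∃ v, d.map.G.Adj v d.root ∧ d.map.weight v d.root = p ∧ ∃ j : ℤ, S.Win j X ∧
      S.HasVelocity (d.map.path v d.root) (d.map.dom v d.root) (-d.map.start d.root v) j
        (S.dA j 0 p) := by
  obtain ⟨v, hv, i, hvel⟩ := d.velocity
  have hr : d.map.pos d.root ≠ none := by simp [d.isDisk.2.1]
  have hs := d.map.start_mem_dom hv hr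
  have hrev := hvel.reverse hs (I' := d.map.dom v d.root) (γ' := d.map.path v d.root)
    (fun s hs => d.map.mem_dom_symm.1 (by rwa [neg_neg])) (fun s hs => d.map.path_neg hv hs)
  have hx : d.map.path v d.root (-d.map.start d.root v) = S.dev X Y :=
    d.map.path_end hv.symm d.isDisk.2.1
  obtain ⟨j, rfl, hj⟩ := hrev.exists_win hY.le hx
  have hvt : -(-(p : ℝ) • S.vtx (j : ZMod S.n)) = S.dA j 0 p := by simp [dA, vt]
  rw [hvt] at hrev
  refine ⟨v, hv.symm, ?_, j, hj, hrev⟩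
  have hst := d.map.isStraight_dom hv.symm
  have he := d.map.mem_dom_symm.2 hs
  obtain ⟨i', m, hm, hvel'⟩ := hst.2 _ he
  obtain ⟨j', rfl, hj'⟩ := hvel'.exists_win hY.le hx
  have hgerm := hrev.germ (hst.continuousWithinAt he) hj hY.le hx rfl
  have hne : (𝓝[d.map.dom v d.root \ {-d.map.start d.root v}] (-d.map.start d.root v)).NeBot :=
    accPt_principal_iff_nhdsWithin.1
      ((d.map.ordConnected_dom _ _).isPreconnected.preperfect_of_nontrivial
        (d.map.nontrivial_dom hv.symm) _ he)
  have hpos : ∀ᶠ s in 𝓝[d.map.dom v d.root] (-d.map.start d.root v),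
      0 ≤ Y + (s - -d.map.start d.root v) * p + S.F (X + (s - -d.map.start d.root v) * 0) := by
    refine nhdsWithin_le_nhds (((continuous_height (S := S) X Y 0 p _).tendsto _).eventually
      (Ici_mem_nhds ?_))
    simpa using hY
  have hlift := (hgerm.and hpos).mono fun s hs => hs.1 (Or.inr hs.2)
  have hself : ∀ᶠ s in 𝓝[d.map.dom v d.root \ {-d.map.start d.root v}] (-d.map.start d.root v),
      s ≠ -d.map.start d.root v :=
    eventually_nhdsWithin_of_forall fun s hs => hs.2
  have heq := S.eq_dA_of_dev hvel'.2 hj' hY.le hx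
    ((hself.and (hlift.filter_mono (nhdsWithin_mono _ sdiff_subset))).frequently.filter_mono
      (nhdsWithin_mono _ sdiff_subset))
  refine eq_of_smul_eq_of_isCoprime hm (S.isCoprime_v j') ?_
  have h2 : (d.map.weight v d.root : ℝ) • toReal m = (p : ℝ) • toReal (S.v j') := by
    rw [heq]
    simp [dA, vt, vtx]
  have h3 := congrArg Prod.fst h2
  have h4 := congrArg Prod.snd h2
  simp only [toReal, Prod.smul_fst, Prod.smul_snd, smul_eq_mul] at h3 h4
  exact Prod.ext (by exact_mod_cast h3) (by exact_mod_cast h4)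

/-- A disk can be completed to a curve. -/
theorem exists_isCompletedTo (d : S.Disk p q (S.dev X Y)) (hY : 0 < Y + S.F X) :
    ∃ h : S.Curve p q (S.dev X Y), d.IsCompletedTo h := by
  obtain ⟨v, hv, hw, j, hj, hvel⟩ := d.exists_velocity hY
  have hr : d.map.pos d.root ≠ none := by simp [d.isDisk.2.1]
  have he := d.map.neg_start_mem_dom hv hr
  have hst := d.map.isStraight_dom hv
  have hx : d.map.path v d.root (-d.map.start d.root v) = S.dev X Y :=
    d.map.path_end hv d.isDisk.2.1
  have hg : 1 < S.gauge (S.dev X Y) := by rw [S.gauge_dev hY.le]; linarith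
  set t₁ := -d.map.start d.root v with ht₁
  set γ := fun s => if s ≤ t₁ then d.map.path v d.root s else S.outRay (S.dev X Y) p (s - t₁)
    with hγ
  have hγle : ∀ s, s ≤ t₁ → γ s = d.map.path v d.root s := fun s hs => if_pos hs
  have hray : ∀ s, 0 ≤ s → γ (t₁ + s) = S.outRay (S.dev X Y) p s := by
    intro s hs
    rcases hs.lt_or_eq with h1 | rfl
    · simp [hγ, h1.not_ge]
    · rw [add_zero, hγle _ le_rfl, hx, outRay_zero]
  have hdom : ∀ s, (d.map.pos v ≠ none → d.map.start v d.root ≤ s) → s ≤ t₁ →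
      s ∈ d.map.dom v d.root := fun s h1 h2 => ⟨h1, fun _ => h2⟩
  let E : d.map.NewEdge v d.root :=
    { pos := none
      start := 0
      path := γ
      adj := hv
      leaf := d.isDisk.1
      start_lt := fun _ h => absurd rfl h
      path_start := fun x hx => by
        have hvn : d.map.pos v ≠ none := by simp [hx]
        rw [hγle _ (d.map.start_lt v d.root hv hvn hr).le, d.map.path_start v d.root x hv hx]
      path_end := fun x hx => by simp at hx
      straight := by
        rw [hw]
        rw [hw] at hst
        exact hst.prolong hY he hx hj hvel fun s hs => hdom s hs.1
      unbounded := fun _ => ⟨t₁, S.dev X Y, he.1, hg, fun s hs => by rw [hray s hs, hw]⟩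
      unbounded' := fun hvn => by
        obtain ⟨T, x, h1, h2, h3⟩ := d.map.unbounded d.root v hv.symm hvn
        refine ⟨T, x, fun h => absurd rfl h, h2, fun s hs => ?_⟩
        have h4 : T + s ∈ d.map.dom d.root v := ⟨fun h => by linarith [h1 h], fun h => absurd hvn h⟩
        rw [hγle _ (by linarith [h1 hr]), d.map.path_neg hv.symm h4, h3 s hs,
          d.map.weight_symm v d.root hv]
      near := fun hvn => by
        filter_upwards [self_mem_nhdsWithin,
          nhdsWithin_le_nhds (gt_mem_nhds (d.map.start_lt v d.root hv hvn hr))] with s h1 h2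
        exact ⟨hdom s h1.1 (le_of_lt h2), hγle s (le_of_lt h2)⟩ }
  obtain ⟨b, hb, hbq⟩ := d.leg
  have hrb : d.root ≠ b := fun h => hr ((hb _).2 h)
  have hnone : ∀ c : Fin d.map.m, E.map.pos c = none ↔ c = d.root ∨ c = b := by
    intro c
    by_cases hc : c = d.root
    · rw [hc, E.map_pos_self]
      exact ⟨fun _ => Or.inl rfl, fun _ => rfl⟩
    · rw [E.map_pos_of_ne hc, hb]
      simp [hc]
  have hdomE : E.map.dom v d.root = {t | d.map.pos v ≠ none → d.map.start v d.root ≤ t} := by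
    rw [E.map_dom_right]
    simp [E]
  refine ⟨⟨E.map, fun a => ?_, d.root, b, hrb, hnone, ⟨v, hv, hw⟩, hbq, v, hv, t₁, ?_, ?_⟩, ?_⟩
  · by_cases ha : a = d.root
    · exact Or.inl ⟨by rw [ha]; exact d.isDisk.1, Or.inl (by rw [ha, E.map_pos_self])⟩
    · exact E.isLegEnd_or ha (d.isDisk.2.2 a ha)
  · rw [hdomE]
    exact he.1
  · rw [E.map_path_right]
    exact (hγle _ le_rfl).trans hx
  · refine isCompletedTo_of_eq d _ (SimpleGraph.Iso.refl (G := d.map.G)) hv ?_ ?_ ?_ ?_ ?_ ?_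
    · exact E.map_pos_self
    · exact fun a ha => E.map_pos_of_ne ha
    · exact fun a b ha hb => E.sameEdge ha hb
    · intro t
      refine Iff.trans (b := t ∈ E.map.dom v d.root) Iff.rfl ?_
      rw [hdomE]
      constructor
      · intro h1
        rcases le_total t t₁ with h2 | h2
        · exact Or.inl (hdom t h1 h2)
        · exact Or.inr h2
      · rintro (h1 | h1)
        · exact h1.1
        · exact fun h2 => (he.1 h2).trans h1
    · intro t ht
      change E.map.path v d.root t = _
      rw [E.map_path_right]
      exact hγle t (ht.2 hr)
    · intro s hs
      change E.map.path v d.root _ = _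
      rw [E.map_path_right]
      exact hray s hs

end Disk

/-- At a general point in an unbounded chamber, a curve is the completion of a disk: the one that is
obtained by cutting the leg of weight `p` at this point. -/
theorem Curve.exists_isCompletedTo {p q : ℕ} {X Y : ℝ} (h : S.Curve p q (S.dev X Y)) (hp : 0 < p)
    (hY : 0 < Y + S.F X) (hP : S.InUnboundedChamber (p + q) (S.dev X Y))
    (hN : S.dev X Y ∉ S.integralLines) :
    ∃ d : S.Disk p q (S.dev X Y), d.IsCompletedTo h := by
  obtain ⟨a, b, hab, hnone, hap, hbq, hac⟩ := h.legs
  obtain ⟨r, r', v, t, H, hv, ht, hst, hx, hray⟩ :=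
    TropicalMap.HasEnds.exists_outRay ⟨h.isCurve, hab, hnone, hap, hbq⟩ hp hP hN hac
  have hr := (H.none_iff r).2 (Or.inl rfl)
  obtain ⟨j, hj, hvel⟩ := TropicalMap.exists_velocity_outRay hv hY hr ht hray
  have hdom : ∀ s, (h.map.pos v ≠ none → h.map.start v r ≤ s) → s ∈ h.map.dom v r := fun s hs =>
    ⟨hs, fun h1 => absurd hr h1⟩
  let E : h.map.NewEdge v r :=
    { pos := some (S.dev X Y)
      start := -t
      path := h.map.path v r
      adj := hv
      leaf := H.ncard_left
      start_lt := fun h1 _ => by rw [neg_neg]; exact hst h1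
      path_start := fun x hx => h.map.path_start v r x hv hx
      path_end := fun x hx' => by rw [neg_neg, hx]; exact Option.some_injective _ hx'
      straight := (h.map.isStraight_dom hv).mono fun s hs => hdom s hs.1
      unbounded := fun h => by simp at h
      unbounded' := fun hvn => by
        obtain ⟨T, x, h1, h2, h3⟩ := h.map.unbounded r v hv.symm hvn
        have hdom' : ∀ s, s ∈ h.map.dom r v := fun s =>
          ⟨fun h => absurd hr h, fun h => absurd hvn h⟩
        have hT : h.map.path r v T = x := by
          have := h3 0 le_rfl
          rwa [add_zero, outRay_zero] at this
        obtain ⟨X₀, Y₀, hY₀, hx₀⟩ := (h.map.isStraight_dom hv.symm).exists_dev (hdom' T)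
          (by rw [hT]; exact h2.le)
        rw [hT] at hx₀
        have hle : 0 ≤ (max T (-t) - T) * h.map.weight r v :=
          mul_nonneg (sub_nonneg.2 (le_max_left _ _)) (Nat.cast_nonneg _)
        have hY₁ : 0 ≤ Y₀ + (max T (-t) - T) * h.map.weight r v + S.F X₀ := by linarith
        refine ⟨max T (-t), S.outRay x (h.map.weight r v) (max T (-t) - T),
          fun _ => le_max_right _ _, ?_, fun s hs => ?_⟩
        · rw [hx₀, S.gauge_dev hY₀] at h2
          rw [hx₀, outRay_dev hY₀, S.gauge_dev hY₁]
          linarith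
        · have h4 := h3 (max T (-t) - T + s) (by linarith [le_max_left T (-t)])
          rw [hx₀, outRay_dev hY₀, show T + (max T (-t) - T + s) = max T (-t) + s by ring] at h4
          rw [h.map.path_neg hv.symm (hdom' _), h4, hx₀, outRay_dev hY₀,
            h.map.weight_symm r v hv.symm, outRay_dev hY₁]
          congr 1
          ring
      near := fun hvn => by
        filter_upwards [self_mem_nhdsWithin] with s hs
        exact ⟨hdom s hs.1, rfl⟩ }
  have hdomE : E.map.dom v r =
      {s | (h.map.pos v ≠ none → h.map.start v r ≤ s) ∧ s ≤ t} := by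
    rw [E.map_dom_right]
    simp [E]
  have hle : h.map.pos v ≠ none → h.map.start v r ≤ t := ht.1
  have hcurve : E.map.IsDisk r (S.dev X Y) :=
    ⟨H.ncard_left, E.map_pos_self, fun a ha => E.isLegEnd_or ha (h.isCurve a)⟩
  have hleg : ∃ b, (∀ a, E.map.pos a = none ↔ a = b) ∧ E.map.LegWeight b q := by
    have key : ∀ a : Fin h.map.m, E.map.pos a = none ↔ a = r' := ?_
    · exact ⟨r', key, H.weight_right⟩
    intro a
    by_cases ha : a = r
    · rw [ha, E.map_pos_self]
      exact ⟨fun h1 => absurd h1 (Option.some_ne_none _), fun h1 => absurd h1 H.ne⟩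
    · rw [E.map_pos_of_ne ha, H.none_iff]
      simp [ha]
  have hvelE : S.HasVelocity (E.map.path r v) (E.map.dom r v) (E.map.start r v) j
      (-(p : ℝ) • S.vtx j) := by
    have h1 := hvel.reverse ht (I' := E.map.dom r v) (γ' := E.map.path r v) (fun s hs => by
      have h2 := E.map.mem_dom_symm.2 hs
      rw [hdomE] at h2
      exact hdom _ h2.1) (fun s _ => by
        rw [E.map_path_left]
        change h.map.path v r (- -s) = _
        rw [neg_neg])
    rw [E.map_start_self]
    have hvt : -(p : ℝ) • S.vtx (j : ZMod S.n) = -S.dA j 0 p := by simp [dA, vt]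
    rw [hvt]
    exact h1
  refine ⟨⟨E.map, r, hcurve, hleg, v, hv.symm, j, hvelE⟩, ?_⟩
  refine isCompletedTo_of_eq _ h (SimpleGraph.Iso.refl (G := h.map.G)) (v := v) hv hr
    (fun a ha => (E.map_pos_of_ne ha).symm) (fun a b ha hb => E.sameEdge ha hb |>.symm) ?_ ?_ ?_
  · intro s
    change s ∈ h.map.dom v r ↔ s ∈ E.map.dom v r ∨ -E.map.start r v ≤ s
    rw [hdomE, E.map_start_self, neg_neg]
    constructor
    · intro h1
      rcases le_total s t with h2 | h2
      · exact Or.inl ⟨h1.1, h2⟩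
      · exact Or.inr h2
    · rintro (h1 | h1)
      · exact hdom s h1.1
      · exact hdom s fun h2 => (hle h2).trans h1
  · intro s _
    change h.map.path v r s = E.map.path v r s
    rw [E.map_path_right]
  · intro s hs
    change h.map.path v r (-E.map.start r v + s) = _
    rw [E.map_start_self, neg_neg]
    exact hray s hs

end DualComplex

namespace DualComplex

variable {S : DualComplex}

/-! ### Completions up to isomorphism -/

namespace TropicalMap

variable {h h' : S.TropicalMap}

theorem SameEdge.reverse {a b : Fin h.m} {a' b' : Fin h'.m} (H : h.SameEdge a b h' a' b')
    (hab : h.G.Adj a b) (hab' : h'.G.Adj a' b') : h.SameEdge b a h' b' a' := by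
  obtain ⟨c, hc⟩ := H
  refine ⟨-c, fun t => ?_⟩
  have h1 := hc (-t)
  have h2 : h'.dom b' a' (t + -c) ↔ h'.dom a' b' (-t + c) := by
    have := h'.mem_dom_symm (a := a') (b := b') (t := -t + c)
    rwa [show -(-t + c) = t + -c by ring] at this
  have h3 : t ∈ h.dom b a ↔ -t ∈ h.dom a b := (h.mem_dom_symm (a := b) (b := a)).symm
  refine ⟨h2.trans (h1.1.trans h3.symm), fun ht => ?_⟩
  have h4 := h1.2 (h3.1 ht)
  have h5 := h'.path_neg hab' (h1.1.2 (h3.1 ht))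
  rw [h.path_neg hab.symm ht, ← h5] at h4
  rw [← h4]
  congr 1
  ring

/-- Identifications of edges match their end points. -/
theorem SameEdge.neg_start_eq {a b : Fin h.m} {a' b' : Fin h'.m} (hab : h.G.Adj a b)
    (hab' : h'.G.Adj a' b') (hb : h.pos b ≠ none) (hb' : h'.pos b' ≠ none) {c : ℝ}
    (hc : ∀ t, (t + c ∈ h'.dom a' b' ↔ t ∈ h.dom a b)) :
    -h'.start b' a' = -h.start b a + c := by
  have h1 := (hc _).2 (h.neg_start_mem_dom hab hb)
  have h2 := h'.neg_start_mem_dom hab' hb'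
  have h3 := (hc (-h'.start b' a' - c)).1 (by rwa [sub_add_cancel])
  linarith [h1.2 hb', h3.2 hb]

end TropicalMap

namespace Disk

open TropicalMap

variable {p q : ℕ} {P : ℝ × ℝ} {d d' : S.Disk p q P} {h h' : S.Curve p q P}

theorem pos_root_ne_none (d : S.Disk p q P) : d.map.pos d.root ≠ none := by
  simp [d.isDisk.2.1]

theorem exists_adj_root (d : S.Disk p q P) : ∃ v, d.map.G.Adj v d.root :=
  d.velocity.imp fun _ h => h.1.symm

theorem IsCompletedTo.of_equiv_right (H : d.IsCompletedTo h) (e : h ≈ h') :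
    d.IsCompletedTo h' := by
  obtain ⟨f, h1, h2, h3, h4⟩ := H
  obtain ⟨g, g1, g2⟩ := e
  refine ⟨f.trans g, (g1 _).trans h1, fun a ha => (g1 _).trans (h2 a ha),
    fun a b hab ha hb => (h3 a b hab ha hb).trans (g2 _ _ (f.map_rel_iff.2 hab)), fun a ha => ?_⟩
  obtain ⟨c, c1, c2, c3⟩ := h4 a ha
  obtain ⟨k, hk⟩ := g2 _ _ (f.map_rel_iff.2 ha)
  refine ⟨c + k, fun t => ?_, fun t ht => ?_, fun s hs => ?_⟩
  · rw [← add_assoc]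
    exact (hk _).1.trans (c1 t)
  · rw [← add_assoc]
    exact ((hk _).2 ((c1 t).2 (Or.inl ht))).trans (c2 t ht)
  · rw [← add_assoc]
    exact ((hk _).2 ((c1 _).2 (Or.inr (by linarith)))).trans (c3 s hs)

theorem IsCompletedTo.of_equiv_left (H : d.IsCompletedTo h) (e : d' ≈ d) :
    d'.IsCompletedTo h := by
  obtain ⟨f, h1, h2, h3, h4⟩ := H
  obtain ⟨g, ⟨g1, g2⟩, gr⟩ := e
  have gne : ∀ {a}, a ≠ d'.root → g a ≠ d.root := fun ha hg =>
    ha (g.injective (hg.trans gr.symm))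
  refine ⟨g.trans f, ?_, fun a ha => ?_, fun a b hab ha hb => ?_, fun a ha => ?_⟩
  · change h.map.pos (f (g d'.root)) = none
    rw [gr, h1]
  · exact (h2 _ (gne ha)).trans (g1 a)
  · exact (g2 a b hab).trans (h3 _ _ (g.map_rel_iff.2 hab) (gne ha) (gne hb))
  · have ha' : d.map.G.Adj (g a) d.root := by
      rw [← gr]
      exact g.map_rel_iff.2 ha
    obtain ⟨c, c1, c2, c3⟩ := h4 _ ha'
    obtain ⟨k, hk⟩ := g2 _ _ ha
    rw [gr] at hk
    have he := SameEdge.neg_start_eq ha ha' d'.pos_root_ne_none d.pos_root_ne_none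
      fun t => (hk t).1
    change ∃ c : ℝ, (∀ t, t + c ∈ h.map.dom (f (g a)) (f (g d'.root)) ↔ _) ∧ (∀ t ∈ _,
      h.map.path (f (g a)) (f (g d'.root)) (t + c) = _) ∧ ∀ s, 0 ≤ s →
      h.map.path (f (g a)) (f (g d'.root)) _ = _
    rw [gr]
    refine ⟨k + c, fun t => ?_, fun t ht => ?_, fun s hs => ?_⟩
    · rw [← add_assoc]
      refine (c1 (t + k)).trans (or_congr (hk t).1 ?_)
      rw [he, add_le_add_iff_right]
    · rw [← add_assoc]
      exact (c2 _ ((hk t).1.2 ht)).trans ((hk t).2 ht)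
    · rw [← c3 s hs, he]
      congr 1
      ring

/-- The completion is unique. -/
theorem IsCompletedTo.equiv (H : d.IsCompletedTo h) (H' : d.IsCompletedTo h') : h ≈ h' := by
  obtain ⟨f, h1, h2, h3, h4⟩ := H
  obtain ⟨f', h1', h2', h3', h4'⟩ := H'
  have key : ∀ a b, d.map.G.Adj a b → a ≠ d.root →
      h.map.SameEdge (f a) (f b) h'.map (f' a) (f' b) := by
    intro a b hab ha
    by_cases hb : b = d.root
    · subst hb
      obtain ⟨c, c1, c2, c3⟩ := h4 a hab
      obtain ⟨k, k1, k2, k3⟩ := h4' a hab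
      refine ⟨k - c, fun t => ?_⟩
      have e1 : t + (k - c) = (t - c) + k := by ring
      have e2 : t = (t - c) + c := by ring
      rw [e1]
      have e3 : t ∈ h.map.dom (f a) (f d.root) ↔ t - c + c ∈ h.map.dom (f a) (f d.root) := by
        rw [← e2]
      refine ⟨(k1 _).trans ((c1 _).symm.trans e3.symm), fun ht => ?_⟩
      have e4 : h.map.path (f a) (f d.root) t = h.map.path (f a) (f d.root) (t - c + c) := by
        rw [← e2]
      rw [e4]
      rcases (c1 _).1 (e3.1 ht) with h5 | h5
      · rw [k2 _ h5, c2 _ h5]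
      · have h6 : t - c = -d.map.start d.root a + (t - c - -d.map.start d.root a) := by ring
        rw [h6, k3 _ (by linarith), c3 _ (by linarith)]
    · exact (h3 a b hab ha hb).symm.trans (h3' a b hab ha hb)
  have key' : ∀ a b, d.map.G.Adj a b → h.map.SameEdge (f a) (f b) h'.map (f' a) (f' b) := by
    intro a b hab
    by_cases ha : a = d.root
    · have hb : b ≠ d.root := fun hb => hab.ne (ha.trans hb.symm)
      exact (key b a hab.symm hb).reverse (f.map_rel_iff.2 hab.symm) (f'.map_rel_iff.2 hab.symm)
    · exact key a b hab ha
  refine ⟨f.symm.trans f', fun x => ?_, fun x y hxy => ?_⟩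
  · obtain ⟨a, rfl⟩ := f.surjective x
    change h'.map.pos (f' (f.symm (f a))) = _
    rw [RelIso.symm_apply_apply]
    by_cases ha : a = d.root
    · rw [ha, h1, h1']
    · rw [h2 a ha, h2' a ha]
  · obtain ⟨a, rfl⟩ := f.surjective x
    obtain ⟨b, rfl⟩ := f.surjective y
    change h.map.SameEdge (f a) (f b) h'.map (f' (f.symm (f a))) (f' (f.symm (f b)))
    rw [RelIso.symm_apply_apply, RelIso.symm_apply_apply]
    exact key' a b (f.map_rel_iff.1 hxy)

/-- Disks with the same completion are isomorphic, if the point is general. If the two disks cut the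
same leg, they cut it at the same point, since the height increases along the leg. They cannot
cut different legs, since then both unbounded legs would pass the point in the
direction `m_out`. -/
theorem equiv_of_isCompletedTo {X Y : ℝ} {d d' : S.Disk p q (S.dev X Y)}
    {h : S.Curve p q (S.dev X Y)} (hp : 0 < p) (hY : 0 < Y + S.F X)
    (hN : S.dev X Y ∉ S.integralLines) (H : d.IsCompletedTo h) (H' : d'.IsCompletedTo h) :
    d ≈ d' := by
  obtain ⟨f, h1, h2, h3, h4⟩ := H
  obtain ⟨f', h1', h2', h3', h4'⟩ := H'
  have hroot : f d.root = f' d'.root := by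
    by_contra hne
    obtain ⟨a, b, hab, hnone, hap, hbq, -⟩ := h.legs
    have hE : h.map.HasEnds a b p q := ⟨h.isCurve, hab, hnone, hap, hbq⟩
    obtain ⟨p₁, p₂, hE'⟩ : ∃ p₁ p₂, h.map.HasEnds (f d.root) (f' d'.root) p₁ p₂ := by
      have e1 := (hnone _).1 h1
      have e2 := (hnone _).1 h1'
      rcases e1 with e1 | e1 <;> rcases e2 with e2 | e2
      · exact absurd (e1.trans e2.symm) hne
      · rw [e1, e2]; exact ⟨_, _, hE⟩
      · rw [e1, e2]; exact ⟨_, _, hE.symm⟩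
      · exact absurd (e1.trans e2.symm) hne
    obtain ⟨v, hv⟩ := d.exists_adj_root
    obtain ⟨v', hv'⟩ := d'.exists_adj_root
    obtain ⟨c, c1, c2, c3⟩ := h4 v hv
    obtain ⟨k, k1, k2, k3⟩ := h4' v' hv'
    refine hN (hE'.mem_integralLines hp hY (t := -d.map.start d.root v + c)
      (t' := -d'.map.start d'.root v' + k) (f.map_rel_iff.2 hv) ((c1 _).2 (Or.inr le_rfl))
      (fun s hs => ?_) (f'.map_rel_iff.2 hv') ((k1 _).2 (Or.inr le_rfl)) (fun s hs => ?_))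
    · rw [← c3 s hs]
      congr 1
      ring
    · rw [← k3 s hs]
      congr 1
      ring
  set g := f.trans f'.symm with hg
  have hgf : ∀ a, f' (g a) = f a := fun a => f'.apply_symm_apply (f a)
  have hgr : g d.root = d'.root := f'.injective (by rw [hgf, hroot])
  have hgne : ∀ {a}, a ≠ d.root → g a ≠ d'.root := fun ha hga =>
    ha (g.injective (hga.trans hgr.symm))
  have key : ∀ a b, d.map.G.Adj a b → a ≠ d.root → d.map.SameEdge a b d'.map (g a) (g b) := by
    intro a b hab ha
    have hab' : d'.map.G.Adj (g a) (g b) := g.map_rel_iff.2 hab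
    by_cases hb : b = d.root
    · subst hb
      rw [hgr] at hab' ⊢
      obtain ⟨c, c1, c2, c3⟩ := h4 a hab
      obtain ⟨k, k1, k2, k3⟩ := h4' _ hab'
      rw [hgf, ← hroot] at k1 k2 k3
      have hr := d.pos_root_ne_none
      have hr' := d'.pos_root_ne_none
      have he := d.map.neg_start_mem_dom hab hr
      have he' := d'.map.neg_start_mem_dom hab' hr'
      set t₁ := -d.map.start d.root a with ht₁
      set t₁' := -d'.map.start d'.root (g a) with ht₁'
      -- the point where the leg is cut
      have hlt : ∀ s s', 0 ≤ s → 0 ≤ s' → S.outRay (S.dev X Y) p s = S.outRay (S.dev X Y) p s' →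
          s = s' := by
        intro s s' hs hs' heq
        have e1 : 0 ≤ s * p := mul_nonneg hs (Nat.cast_nonneg p)
        have e2 : 0 ≤ s' * p := mul_nonneg hs' (Nat.cast_nonneg p)
        have e3 := congrArg S.gauge heq
        rw [outRay_dev hY.le, outRay_dev hY.le, S.gauge_dev (by linarith),
          S.gauge_dev (by linarith)] at e3
        have e4 : (0 : ℝ) < p := by exact_mod_cast hp
        exact mul_right_cancel₀ e4.ne' (by linarith)
      have hT : t₁ + c = t₁' + k := by
        rcases le_total (t₁ + c) (t₁' + k) with h5 | h5
        · have e1 := c3 (t₁' + k - (t₁ + c)) (by linarith)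
          have e2 := k3 0 le_rfl
          rw [show t₁ + (t₁' + k - (t₁ + c)) + c = t₁' + 0 + k by ring, e2] at e1
          linarith [hlt _ _ le_rfl (by linarith) e1]
        · have e1 := k3 (t₁ + c - (t₁' + k)) (by linarith)
          have e2 := c3 0 le_rfl
          rw [show t₁' + (t₁ + c - (t₁' + k)) + k = t₁ + 0 + c by ring, e2] at e1
          linarith [hlt _ _ le_rfl (by linarith) e1]
      have hd : ∀ t, t ∈ d.map.dom a d.root ↔ t + c ∈ h.map.dom (f a) (f d.root) ∧ t ≤ t₁ := by
        intro t
        rw [c1]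
        refine ⟨fun ht => ⟨Or.inl ht, ht.2 hr⟩, fun ht => ht.1.elim id fun h5 => ?_⟩
        rwa [le_antisymm ht.2 h5]
      have hd' : ∀ t, t ∈ d'.map.dom (g a) d'.root ↔
          t + k ∈ h.map.dom (f a) (f d.root) ∧ t ≤ t₁' := by
        intro t
        rw [k1]
        refine ⟨fun ht => ⟨Or.inl ht, ht.2 hr'⟩, fun ht => ht.1.elim id fun h5 => ?_⟩
        rwa [le_antisymm ht.2 h5]
      refine ⟨c - k, fun t => ?_⟩
      have hiff : t + (c - k) ∈ d'.map.dom (g a) d'.root ↔ t ∈ d.map.dom a d.root := by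
        rw [hd, hd', show t + (c - k) + k = t + c by ring]
        refine and_congr Iff.rfl ⟨fun _ => by linarith, fun _ => by linarith⟩
      refine ⟨hiff, fun ht => ?_⟩
      rw [← k2 _ (hiff.2 ht), ← c2 t ht]
      congr 1
      ring
    · have h5 := h3' _ _ hab' (hgne ha) (hgne hb)
      rw [hgf, hgf] at h5
      exact (h3 a b hab ha hb).trans h5.symm
  refine ⟨g, ⟨fun a => ?_, fun a b hab => ?_⟩, hgr⟩
  · by_cases ha : a = d.root
    · rw [ha, hgr, d.isDisk.2.1, d'.isDisk.2.1]
    · rw [← h2 a ha, ← hgf, h2' _ (hgne ha)]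
  · by_cases ha : a = d.root
    · have hb : b ≠ d.root := fun hb => hab.ne (ha.trans hb.symm)
      exact (key b a hab.symm hb).reverse hab.symm (g.map_rel_iff.2 hab.symm)
    · exact key a b hab ha

end Disk

end DualComplex

end DelPezzo

end

/-! ### The bijection -/

theorem mainTheorem9 (S : DelPezzo.DualComplex) (p q : ℕ) (hp : 0 < p) (hq : 0 < q) :
    ∃ N : Set (ℝ × ℝ), S.IsThin N ∧
      ∀ P : ℝ × ℝ, S.InUnboundedChamber (p + q) P → P ∉ N →
        ∃ F : S.DiskClass p q P → S.CurveClass p q P,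
          Function.Bijective F ∧
          ∀ (d : S.Disk p q P) (h : S.Curve p q P),
            F (Quotient.mk _ d) = Quotient.mk _ h ↔ d.IsCompletedTo h := by
  refine ⟨S.integralLines, S.isThin_integralLines, fun P hP hN => ?_⟩
  obtain ⟨i, hi⟩ := hP.exists_mem_openCell
  obtain ⟨X, Y, hY, rfl⟩ := S.exists_dev_of_mem_openCell hi
  choose F hF using fun d : S.Disk p q (S.dev X Y) => d.exists_isCompletedTo hY
  have hiff : ∀ d h, Quotient.mk (S.curveSetoid p q _) (F d) = Quotient.mk _ h ↔
      d.IsCompletedTo h := fun d h =>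
    ⟨fun e => (hF d).of_equiv_right (Quotient.exact e), fun e => Quotient.sound ((hF d).equiv e)⟩
  refine ⟨Quotient.lift (fun d => Quotient.mk _ (F d)) fun d d' e =>
    (hiff d _).2 ((hF d').of_equiv_left e), ⟨?_, ?_⟩, hiff⟩
  · rintro ⟨d⟩ ⟨d'⟩ e
    exact Quotient.sound
      (DelPezzo.DualComplex.Disk.equiv_of_isCompletedTo hp hY hN ((hiff d _).1 e) (hF d'))
  · rintro ⟨h⟩
    obtain ⟨d, hd⟩ := h.exists_isCompletedTo hp hY hP hN
    exact ⟨Quotient.mk _ d, (hiff d h).2 hd⟩
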